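/- Let $\mathbf{Gpd}^{\mathbf G}$ be the category of groupoids equipped with a strict involution and equivariant functors (presheaves of groupoids on $\mathbf B(\mathbb Z/2\mathbb Z)$), with its injective model structure: weak equivalences (resp. cofibrations) are the equivariant functors whose underlying functor is an equivalence (resp. injective on objects), and fibrations are the morphisms with the right lifting property with respect to the trivial cofibrations. Let $(\mathbf{Gpd}^{\mathbf G})_{\mathbf f}$ be the full subcategory of injectively fibrant objects, with the injective fibrations between them as its class of fibrations. Let $\kappa$ be an inaccessible cardinal. Let $U_\Delta$ be the groupoid whose objects are the triples $(A_0,A_1,\chi)$ with $A_0,A_1$ $\kappa$-small sets (discrete groupoids) and $\chi:A_0\to A_1$ a bijection, and whose morphisms $(A_0,A_1,\chi)\to(B_0,B_1,\psi)$ are the pairs of bijections $\rho_i:A_i\to B_i$ with $\psi\rho_0=\rho_1\chi$, with the involution $(A_0,A_1,\chi)\mapsto(A_1,A_0,\chi^{-1})$, $(\rho_0,\rho_1)\mapsto(\rho_1,\rho_0)$. Let $\widetilde U_\Delta$ be the pointed version: objects $(A_0,A_1,a,\chi)$ with $a\in A_0$, morphisms those $(\rho_0,\rho_1)$ with $\rho_0(a)=b$,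 and involution $(A_0,A_1,a,\chi)\mapsto(A_1,A_0,\chi(a),\chi^{-1})$. Let $p_\Delta:\widetilde U_\Delta\to U_\Delta$ forget the point. Let $PU_\Delta$ be the groupoid of triples $(x,y,\varphi:x\to y)$ in $U_\Delta$, with morphisms $(x,y,\varphi)\to(x',y',\varphi')$ the pairs $(\sigma:x\to x',\tau:y\to y')$ such that $\varphi'=\tau\varphi\sigma^{-1}$ and with the componentwise involution, and let $\delta_1:U_\Delta\to PU_\Delta$, $x\mapsto(x,x,1_x)$, and $\delta_2:PU_\Delta\to U_\Delta\times U_\Delta$, $(x,y,\varphi)\mapsto(x,y)$. A universe $p:\widetilde U\to U$ in a type-theoretic fibration category (in the sense of Shulman) is called univalent if the morphism $U\to E$ over $U\times U$ that sends a small type to its identity equivalence is a (right) homotopy equivalence, where $E\to U\times U$ is the fibration interpreting the dependent type $$(A:\mathrm{Type}),(B:\mathrm{Type})\vdash \mathrm{Equiv}(A,B):=\sum_{f:A\to B}\Big[\Big(\sum_{s:B\to A}\prod_{b:B}f(s(b))=b\Big)\times\Big(\sum_{r:B\to A}\prod_{a:A}r(f(a))=a\Big)\Big],$$ with function types and products interpreted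 by the partial right adjoints $\Pi_g$ of the pullback functors along fibrations, sums by composition, and the identity type of small types by a small path object of $p$ over $U$ (small fibrations are the pullbacks of $p$). **Theorem.** The objects $U_\Delta$, $\widetilde U_\Delta$ and $PU_\Delta$ are injectively fibrant, $(\mathbf{Gpd}^{\mathbf G})_{\mathbf f}$ is a type-theoretic fibration category, $p_\Delta$ is a universe in it, and this universe is univalent. More precisely, $PU_\Delta$ is a path object of $U_\Delta$: $\delta_1$ is an injective trivial cofibration, $\delta_2$ is an injective fibration, and $\delta_2\delta_1$ is the diagonal. For every interpretation $E\to U_\Delta\times U_\Delta$ of $\mathrm{Equiv}(A,B)$ there is an isomorphism $E\cong PU_\Delta$ over $U_\Delta\times U_\Delta$ under which the canonical map $U_\Delta\to E$ corresponds to $\delta_1$; hence $U_\Delta\to E$ is an injective trivial cofibration between fibrant and cofibrant objects, and a homotopy equivalence. -/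

import Mathlib

open CategoryTheory CategoryTheory.Limits
open scoped Cardinal

universe u v w

namespace EquivariantGpd

section TypeTheory

variable {C : Type u} [Category.{v} C]

/-- `q : P ⟶ B`, together with the pullback `P'` of `q` along `g` and the evaluation map
`ev : P' ⟶ X` over `A`, is the value `Π_g f` of the (partial) right adjoint of the pullback functor
`g^* : C/B ⥤ C/A` at `f : X ⟶ A`: for every object `h : Y ⟶ B` of `C/B` and every pullback
`Y'` of `h` along `g`, each morphism `v : Y' ⟶ X` over `A` is obtained from exactly one morphism
`k : Y ⟶ P` over `B`, by pulling back along `g` and composing with `ev`. -/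
structure IsPi {A B X P P' : C} (g : A ⟶ B) (f : X ⟶ A) (q : P ⟶ B)
    (fst : P' ⟶ P) (snd : P' ⟶ A) (ev : P' ⟶ X) : Prop where
  isPullback : IsPullback fst snd q g
  ev_comp : ev ≫ f = snd
  existsUnique : ∀ {Y Y' : C} (h : Y ⟶ B) (y₁ : Y' ⟶ Y) (y₂ : Y' ⟶ A),
    IsPullback y₁ y₂ h g → ∀ v : Y' ⟶ X, v ≫ f = y₂ →
      ∃! k : Y ⟶ P, k ≫ q = h ∧
        ∃ k' : Y' ⟶ P', k' ≫ fst = y₁ ≫ k ∧ k' ≫ snd = y₂ ∧ k' ≫ ev = v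

/-- Type-theoretic fibration categories. The class `F` is the class of fibrations;
the acyclic cofibrations are the morphisms with the left lifting property with respect to all
fibrations, that is, the class `F.llp`. -/
structure IsTypeTheoreticFibrationCategory (F : MorphismProperty C) : Prop where
  hasTerminal : HasTerminal C
  comp : ∀ {X Y Z : C} (f : X ⟶ Y) (g : Y ⟶ Z), F f → F g → F (f ≫ g)
  of_isIso : ∀ {X Y : C} (f : X ⟶ Y), IsIso f → F f
  to_terminal : ∀ {X T : C} (f : X ⟶ T), Nonempty (IsTerminal T) → F f
  exists_pullback : ∀ {X Y Z : C} (f : X ⟶ Z) (g : Y ⟶ Z), F f →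
    ∃ (W : C) (fst : W ⟶ X) (snd : W ⟶ Y), IsPullback fst snd f g
  pullback : ∀ {W X Y Z : C} (fst : W ⟶ X) (snd : W ⟶ Y) (f : X ⟶ Z) (g : Y ⟶ Z),
    IsPullback fst snd f g → F f → F snd
  exists_pi : ∀ {X A B : C} (g : A ⟶ B) (f : X ⟶ A), F g → F f →
    ∃ (P P' : C) (q : P ⟶ B) (fst : P' ⟶ P) (snd : P' ⟶ A) (ev : P' ⟶ X),
      F q ∧ IsPi g f q fst snd ev
  factorization : ∀ {X Y : C} (f : X ⟶ Y),
    ∃ (Z : C) (i : X ⟶ Z) (q : Z ⟶ Y), F.llp i ∧ F q ∧ i ≫ q = f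
  acyclic_pullback : ∀ {A B D X Y Z : C} (i : A ⟶ B) (b : B ⟶ D) (z : Z ⟶ D)
    (j : X ⟶ Y) (y : Y ⟶ Z) (xA : X ⟶ A) (yB : Y ⟶ B),
    F b → F (i ≫ b) → F.llp i → IsPullback j xA yB i → IsPullback y yB z b → F.llp j

/-- Small fibrations: the pullbacks of `p`. -/
def IsSmall {Ut U : C} (p : Ut ⟶ U) : MorphismProperty C := fun X Y f =>
  ∃ (t : X ⟶ Ut) (c : Y ⟶ U), IsPullback t f p c

/-- Universes in a type-theoretic fibration category with class of fibrations `F`. -/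
structure IsUniverse (F : MorphismProperty C) {Ut U : C} (p : Ut ⟶ U) : Prop where
  fibration : F p
  id : ∀ X : C, IsSmall p (𝟙 X)
  comp : ∀ {X Y Z : C} (f : X ⟶ Y) (g : Y ⟶ Z),
    IsSmall p f → IsSmall p g → IsSmall p (f ≫ g)
  pi : ∀ {A B X P P' : C} (g : A ⟶ B) (f : X ⟶ A) (q : P ⟶ B)
    (fst : P' ⟶ P) (snd : P' ⟶ A) (ev : P' ⟶ X),
    IsSmall p f → IsSmall p g → IsPi g f q fst snd ev → IsSmall p q
  factorization : ∀ {A B D : C} (a : A ⟶ D) (b : B ⟶ D) (f : A ⟶ B),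
    IsSmall p a → IsSmall p b → f ≫ b = a →
      ∃ (Z : C) (i : A ⟶ Z) (q : Z ⟶ B), F.llp i ∧ IsSmall p q ∧ i ≫ q = f

/-- A path object of `X`: a factorization of the diagonal of `X` as an acyclic cofibration followed
by a fibration. -/
structure PathData (F : MorphismProperty C) (X : C) where
  prod : C
  fst : prod ⟶ X
  snd : prod ⟶ X
  isLimit : IsLimit (BinaryFan.mk fst snd)
  obj : C
  r : X ⟶ obj
  q : obj ⟶ prod
  acyclic : F.llp r
  fibration : F q
  r_fst : r ≫ q ≫ fst = 𝟙 X
  r_snd : r ≫ q ≫ snd = 𝟙 X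

/-- Right homotopic morphisms. -/
def RightHomotopic (F : MorphismProperty C) {A X : C} (f g : A ⟶ X) : Prop :=
  ∃ (D : PathData F X) (H : A ⟶ D.obj), H ≫ D.q ≫ D.fst = f ∧ H ≫ D.q ≫ D.snd = g

/-- (Right) homotopy equivalences. -/
def IsHomotopyEquivalence (F : MorphismProperty C) {X Y : C} (f : X ⟶ Y) : Prop :=
  ∃ g : Y ⟶ X, RightHomotopic F (g ≫ f) (𝟙 Y) ∧ RightHomotopic F (f ≫ g) (𝟙 X)

/-- The extension `Γ.T` of the context `Γ` by the small type `T` with code `c : Γ ⟶ U`: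
a chosen pullback of `p` along `c`. -/
structure SmallExt {Ut U : C} (p : Ut ⟶ U) {Γ : C} (c : Γ ⟶ U) where
  obj : C
  disp : obj ⟶ Γ
  var : obj ⟶ Ut
  isPullback : IsPullback var disp p c

/-- A chosen value of `Π_g` at `f`. -/
structure PiData {A B X : C} (g : A ⟶ B) (f : X ⟶ A) where
  obj : C
  π : obj ⟶ B
  total : C
  fst : total ⟶ obj
  snd : total ⟶ A
  ev : total ⟶ X
  isPi : IsPi g f π fst snd ev

/-- The identity type of the generic small type: a small path object of `p` in the slice over `U`,
`Ut ⟶ P ⟶ Ut ×_U Ut`, with the first map an acyclic cofibration and the second one a small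
fibration. -/
structure IdData (F : MorphismProperty C) {Ut U : C} (p : Ut ⟶ U) where
  pb : C
  fst : pb ⟶ Ut
  snd : pb ⟶ Ut
  isPullback : IsPullback fst snd p p
  obj : C
  r : Ut ⟶ obj
  q : obj ⟶ pb
  acyclic : F.llp r
  small : IsSmall p q
  r_fst : r ≫ q ≫ fst = 𝟙 Ut
  r_snd : r ≫ q ≫ snd = 𝟙 Ut

/-- The identity type `x = y` in the context `Γ`, for two terms `x`, `y` of the same small type,
given by their classifying maps `x y : Γ ⟶ Ut`: a pullback of the generic identity type along
`⟨x, y⟩ : Γ ⟶ Ut ×_U Ut`. -/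
structure IdType {F : MorphismProperty C} {Ut U : C} {p : Ut ⟶ U} (I : IdData F p) {Γ : C}
    (x y : Γ ⟶ Ut) where
  pair : Γ ⟶ I.pb
  pair_fst : pair ≫ I.fst = x
  pair_snd : pair ≫ I.snd = y
  obj : C
  disp : obj ⟶ Γ
  var : obj ⟶ I.obj
  isPullback : IsPullback var disp I.q pair

/-- An interpretation of the dependent type
`(A : Type), (B : Type) ⊢ Equiv(A, B)`, where `Equiv(A, B)` is
`∑ f : A → B, (∑ s : B → A, ∏ b : B, f (s b) = b) × (∑ r : B → A, ∏ a : A, r (f a) = a)`.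
Function types and products are interpreted by `Π` along display maps, sums by composition of
display maps, products of types by pullbacks; the structure records a choice of all the (unique up
to isomorphism) objects that occur. -/
structure EquivInterpretation (F : MorphismProperty C) {Ut U : C} (p : Ut ⟶ U) where
  -- the context `(A : Type), (B : Type)`
  UU : C
  tyA : UU ⟶ U
  tyB : UU ⟶ U
  isLimit : IsLimit (BinaryFan.mk tyA tyB)
  -- the identity type of small types
  Id : IdData F p
  -- `(A B : Type), (a : A)` and `(A B : Type), (a : A), (b : B)`
  A : SmallExt p tyA
  AB : SmallExt p (A.disp ≫ tyB)
  -- `(A B : Type) ⊢ A → B`; its `total` object is the context `(A B : Type), (f : A → B), (a : A)`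
  Fn : PiData A.disp AB.disp
  -- `(A B : Type), (f : A → B), (b : B)` and `(A B : Type), (f : A → B), (b : B), (a : A)`
  B₁ : SmallExt p (Fn.π ≫ tyB)
  BA₁ : SmallExt p (B₁.disp ≫ Fn.π ≫ tyA)
  -- `(A B : Type), (f : A → B) ⊢ B → A`; its `total` object is the context
  -- `(A B : Type), (f : A → B), (s : B → A), (b : B)`
  Bk : PiData B₁.disp BA₁.disp
  -- the substitution `a := s b` from that context to `(A B : Type), (f : A → B), (a : A)`
  sb : Bk.total ⟶ Fn.total
  sb_fst : sb ≫ Fn.fst = Bk.fst ≫ Bk.π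
  sb_var : sb ≫ Fn.snd ≫ A.var = Bk.ev ≫ BA₁.var
  -- `f (s b) = b`, and `∏ b : B, f (s b) = b`
  IdB : IdType Id (sb ≫ Fn.ev ≫ AB.var) (Bk.snd ≫ B₁.var)
  PiB : PiData Bk.fst IdB.disp
  -- `(A B : Type), (f : A → B), (r : B → A), (a : A)`
  A₂ : SmallExt p (Bk.π ≫ Fn.π ≫ tyA)
  -- the substitutions `(A, B, f, a)` and `b := f a` out of that context
  fa : A₂.obj ⟶ Fn.total
  fa_fst : fa ≫ Fn.fst = A₂.disp ≫ Bk.π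
  fa_var : fa ≫ Fn.snd ≫ A.var = A₂.var
  bfa : A₂.obj ⟶ Bk.total
  bfa_fst : bfa ≫ Bk.fst = A₂.disp
  bfa_var : bfa ≫ Bk.snd ≫ B₁.var = fa ≫ Fn.ev ≫ AB.var
  -- `r (f a) = a`, and `∏ a : A, r (f a) = a`
  IdA : IdType Id (bfa ≫ Bk.ev ≫ BA₁.var) A₂.var
  PiA : PiData A₂.disp IdA.disp
  -- the space of equivalences
  E : C
  sec : E ⟶ PiB.obj
  ret : E ⟶ PiA.obj
  isPullback : IsPullback sec ret (PiB.π ≫ Bk.π) (PiA.π ≫ Bk.π)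

namespace EquivInterpretation

variable {F : MorphismProperty C} {Ut U : C} {p : Ut ⟶ U} (I : EquivInterpretation F p)

/-- The projection from the space of equivalences to the context `(A B : Type), (f : A → B)`. -/
def toFn : I.E ⟶ I.Fn.obj := I.sec ≫ I.PiB.π ≫ I.Bk.π

/-- The projection `E ⟶ U × U`. -/
def proj : I.E ⟶ I.UU := I.toFn ≫ I.Fn.π

/-- The map `k : U ⟶ E` sends a small type `A` to its identity equivalence: it lies over the
diagonal of `U`, its components `f`, `s` and `r` are identity functions, and the two
proofs of `f (s b) = b` and `r (f a) = a` are given by reflexivity. -/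
structure IsIdEquiv (k : U ⟶ I.E) : Prop where
  tyA : k ≫ I.proj ≫ I.tyA = 𝟙 U
  tyB : k ≫ I.proj ≫ I.tyB = 𝟙 U
  fn : ∃ x : Ut ⟶ I.Fn.total, x ≫ I.Fn.fst = p ≫ k ≫ I.toFn ∧
    x ≫ I.Fn.snd ≫ I.A.var = 𝟙 Ut ∧ x ≫ I.Fn.ev ≫ I.AB.var = 𝟙 Ut
  sec : ∃ x : Ut ⟶ I.Bk.total, x ≫ I.Bk.fst = p ≫ k ≫ I.sec ≫ I.PiB.π ∧
    x ≫ I.Bk.snd ≫ I.B₁.var = 𝟙 Ut ∧ x ≫ I.Bk.ev ≫ I.BA₁.var = 𝟙 Ut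
  sec_refl : ∃ x : Ut ⟶ I.PiB.total, x ≫ I.PiB.fst = p ≫ k ≫ I.sec ∧
    x ≫ I.PiB.snd ≫ I.Bk.snd ≫ I.B₁.var = 𝟙 Ut ∧ x ≫ I.PiB.ev ≫ I.IdB.var = I.Id.r
  ret : ∃ x : Ut ⟶ I.Bk.total, x ≫ I.Bk.fst = p ≫ k ≫ I.ret ≫ I.PiA.π ∧
    x ≫ I.Bk.snd ≫ I.B₁.var = 𝟙 Ut ∧ x ≫ I.Bk.ev ≫ I.BA₁.var = 𝟙 Ut
  ret_refl : ∃ x : Ut ⟶ I.PiA.total, x ≫ I.PiA.fst = p ≫ k ≫ I.ret ∧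
    x ≫ I.PiA.snd ≫ I.A₂.var = 𝟙 Ut ∧ x ≫ I.PiA.ev ≫ I.IdA.var = I.Id.r

end EquivInterpretation

/-- Univalence of a universe `p : Ut ⟶ U`: `Equiv(A, B)` has an interpretation, and for every
interpretation, with space of equivalences `E ⟶ U × U`, there is exactly one morphism `U ⟶ E` that
sends a small type to its identity equivalence, and this morphism is a homotopy equivalence. -/
def IsUnivalent (F : MorphismProperty C) {Ut U : C} (p : Ut ⟶ U) : Prop :=
  Nonempty (EquivInterpretation F p) ∧
    ∀ I : EquivInterpretation F p, ∃ k : U ⟶ I.E, I.IsIdEquiv k ∧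
      (∀ k' : U ⟶ I.E, I.IsIdEquiv k' → k' = k) ∧ IsHomotopyEquivalence F k

end TypeTheory

section InvolutiveGroupoids

/-- Groupoids with a (strict) involution, that is, presheaves of groupoids on the one-object
groupoid `B(ℤ/2ℤ)`. -/
structure InvGrpd : Type (w + 1) where
  carrier : Grpd.{w, w}
  inv : carrier ⟶ carrier
  inv_inv : inv ≫ inv = 𝟙 carrier

namespace InvGrpd

/-- Equivariant functors. -/
@[ext]
structure Hom (A B : InvGrpd.{w}) : Type w where
  functor : A.carrier ⟶ B.carrier
  comm : A.inv ≫ functor = functor ≫ B.inv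

instance : Category.{w} InvGrpd.{w} where
  Hom A B := Hom A B
  id A := ⟨𝟙 _, by simp⟩
  comp f g := ⟨f.functor ≫ g.functor, by
    rw [← Category.assoc, f.comm, Category.assoc, g.comm, Category.assoc]⟩

/-- Underlying functor of an equivariant functor. -/
def under {A B : InvGrpd.{w}} (f : A ⟶ B) : A.carrier ⥤ B.carrier := Hom.functor f

/-- Injective weak equivalences: the underlying functor is an equivalence. -/
def weakEquivalences : MorphismProperty InvGrpd.{w} := fun _ _ f => (under f).IsEquivalence

/-- Injective cofibrations: the underlying functor is injective on objects. -/
def cofibrations : MorphismProperty InvGrpd.{w} := fun _ _ f => Function.Injective (under f).obj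

/-- Injective trivial cofibrations. -/
def trivialCofibrations : MorphismProperty InvGrpd.{w} := cofibrations ⊓ weakEquivalences

/-- Injective fibrations. -/
def fibrations : MorphismProperty InvGrpd.{w} := trivialCofibrations.rlp

/-- The terminal object: the one-point groupoid with the identity involution. -/
def one : InvGrpd.{w} := ⟨Grpd.of (Discrete PUnit), 𝟙 _, rfl⟩

/-- The morphism to the terminal object. -/
def toOne (A : InvGrpd.{w}) : A ⟶ one :=
  ⟨(Functor.const A.carrier).obj (Discrete.mk PUnit.unit), rfl⟩

/-- The initial object: the empty groupoid. -/
def zero : InvGrpd.{w} := ⟨Grpd.of (Discrete PEmpty), 𝟙 _, rfl⟩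

/-- The morphism from the initial object. -/
def fromZero (A : InvGrpd.{w}) : zero ⟶ A :=
  ⟨Functor.empty A.carrier, Functor.empty_ext' _ _⟩

/-- Injectively fibrant objects. -/
def IsFibrant : ObjectProperty InvGrpd.{w} := fun A => fibrations (toOne A)

/-- Injectively cofibrant objects. -/
def IsCofibrant : ObjectProperty InvGrpd.{w} := fun A => cofibrations (fromZero A)

/-- The full subcategory of injectively fibrant objects. -/
abbrev Fibrant : Type (w + 1) := IsFibrant.{w}.FullSubcategory

/-- The injective fibrations between injectively fibrant objects. -/
def fibrantFibrations : MorphismProperty Fibrant.{w} := fun _ _ f => fibrations f.hom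

/-- The product of two groupoids with involution. -/
def prod (A B : InvGrpd.{w}) : InvGrpd.{w} where
  carrier := Grpd.of (A.carrier × B.carrier)
  inv := Functor.prod A.inv B.inv
  inv_inv := congrArg₂ Functor.prod A.inv_inv B.inv_inv

end InvGrpd

/-- Objects of the path groupoid of `A`: triples `(x, y, φ : x ≅ y)`. -/
structure PathGrpd (A : Type w) [Groupoid.{w} A] : Type w where
  src : A
  tgt : A
  arr : src ⟶ tgt

namespace PathGrpd

variable {A : Type w} [Groupoid.{w} A]

/-- Morphisms `(x, y, φ) ⟶ (x', y', φ')`: pairs `(σ : x ⟶ x', τ : y ⟶ y')` such that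
`φ' = τ ∘ φ ∘ σ⁻¹`. -/
@[ext]
structure Hom (X Y : PathGrpd A) : Type w where
  σ : X.src ⟶ Y.src
  τ : X.tgt ⟶ Y.tgt
  comm : Y.arr = Groupoid.inv σ ≫ X.arr ≫ τ

instance : Groupoid.{w} (PathGrpd A) where
  Hom X Y := Hom X Y
  id X := ⟨𝟙 _, 𝟙 _, by simp⟩
  comp f g := ⟨f.σ ≫ g.σ, f.τ ≫ g.τ, by rw [g.comm, f.comm]; simp⟩
  inv f := ⟨Groupoid.inv f.σ, Groupoid.inv f.τ, by rw [f.comm]; simp⟩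
  id_comp f := by ext <;> simp
  comp_id f := by ext <;> simp
  assoc f g h := by ext <;> simp
  inv_comp f := by ext <;> simp
  comp_inv f := by ext <;> simp

end PathGrpd

namespace PathGrpd

/-- The action of a functor on path groupoids. -/
def map {A B : Type w} [Groupoid.{w} A] [Groupoid.{w} B] (F : A ⥤ B) : PathGrpd A ⥤ PathGrpd B where
  obj X := ⟨F.obj X.src, F.obj X.tgt, F.map X.arr⟩
  map f := ⟨F.map f.σ, F.map f.τ, by rw [f.comm]; simp [Groupoid.inv_eq_inv]⟩
  map_id X := PathGrpd.Hom.ext (F.map_id _) (F.map_id _)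
  map_comp f g := PathGrpd.Hom.ext (F.map_comp _ _) (F.map_comp _ _)

/-- The functor `x ↦ (x, x, 1)`, `φ ↦ (φ, φ)`. -/
def diag (A : Type w) [Groupoid.{w} A] : A ⥤ PathGrpd A where
  obj x := ⟨x, x, 𝟙 x⟩
  map f := ⟨f, f, by simp⟩
  map_id _ := rfl
  map_comp _ _ := rfl

theorem diag_map {A B : Type w} [Groupoid.{w} A] [Groupoid.{w} B] (F : A ⥤ B) :
    F ⋙ diag B = diag A ⋙ map F := by
  have key : ∀ {x y : B} (a a' : x ⟶ x) (b b' : y ⟶ y) (f : x ⟶ y) (ha : a = a') (hb : b = b')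
      (h : b = Groupoid.inv f ≫ a ≫ f) (h' : b' = Groupoid.inv f ≫ a' ≫ f),
      (⟨f, f, h⟩ : Hom ⟨x, x, a⟩ ⟨y, y, b⟩) ≍ (⟨f, f, h'⟩ : Hom ⟨x, x, a'⟩ ⟨y, y, b'⟩) := by
    rintro x y a _ b _ f rfl rfl h h'
    rfl
  refine CategoryTheory.Functor.hext (fun x => ?_) (fun x y f => ?_)
  · exact congrArg (PathGrpd.mk (F.obj x) (F.obj x)) (F.map_id x).symm
  · exact key _ _ _ _ (F.map f) (F.map_id x).symm (F.map_id y).symm _ _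

end PathGrpd

namespace InvGrpd

/-- The path object of `A`, with the involution applied componentwise. -/
def path (A : InvGrpd.{w}) : InvGrpd.{w} where
  carrier := Grpd.of (PathGrpd A.carrier)
  inv := PathGrpd.map A.inv
  inv_inv := congrArg (fun F : A.carrier ⥤ A.carrier => PathGrpd.map F) A.inv_inv

/-- `δ₁ : A ⟶ PA`, `x ↦ (x, x, 1)`, `φ ↦ (φ, φ)`. -/
def δ₁ (A : InvGrpd.{w}) : A ⟶ path A where
  functor := PathGrpd.diag A.carrier
  comm := PathGrpd.diag_map A.inv

/-- `δ₂ : PA ⟶ A × A`, `(x, y, φ) ↦ (x, y)`, `(σ, τ) ↦ (σ, τ)`. -/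
def δ₂ (A : InvGrpd.{w}) : path A ⟶ prod A A where
  functor :=
    { obj := fun X => (X.src, X.tgt)
      map := fun f => (f.σ, f.τ)
      map_id := fun _ => rfl
      map_comp := fun _ _ => rfl }
  comm := rfl

/-- The two projections of a product. -/
def prodFst (A B : InvGrpd.{w}) : prod A B ⟶ A := ⟨CategoryTheory.Prod.fst A.carrier B.carrier, rfl⟩

/-- The second projection. -/
def prodSnd (A B : InvGrpd.{w}) : prod A B ⟶ B := ⟨CategoryTheory.Prod.snd A.carrier B.carrier, rfl⟩

end InvGrpd

end InvolutiveGroupoids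

section Universe

/-- The `κ`-small sets. -/
abbrev SmallSet (κ : Cardinal.{u}) : Type (u + 1) := {X : Type u // #X < κ}

/-- Objects of `U_Δ`: triples `(A₀, A₁, χ)` of two `κ`-small sets (that is, `κ`-small discrete
groupoids) and a bijection `χ : A₀ ≃ A₁` (that is, an isomorphism of discrete groupoids). -/
structure UObj (κ : Cardinal.{u}) : Type (u + 1) where
  A₀ : SmallSet κ
  A₁ : SmallSet κ
  χ : A₀.1 ≃ A₁.1

/-- Morphisms of `U_Δ`: pairs `(ρ₀, ρ₁)` of bijections forming a commutative square. (A natural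
isomorphism between two functors with values in a discrete groupoid is an equality.) -/
@[ext]
structure UHom {κ : Cardinal.{u}} (A B : UObj κ) : Type (u + 1) where
  ρ₀ : A.A₀.1 ≃ B.A₀.1
  ρ₁ : A.A₁.1 ≃ B.A₁.1
  comm : ∀ x, B.χ (ρ₀ x) = ρ₁ (A.χ x)

instance (κ : Cardinal.{u}) : Groupoid.{u + 1} (UObj κ) where
  Hom A B := UHom A B
  id A := ⟨Equiv.refl _, Equiv.refl _, fun _ => rfl⟩
  comp f g := ⟨f.ρ₀.trans g.ρ₀, f.ρ₁.trans g.ρ₁, fun x => by simp [g.comm, f.comm]⟩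
  inv f := ⟨f.ρ₀.symm, f.ρ₁.symm, fun x => by
    rw [Equiv.eq_symm_apply, ← f.comm, Equiv.apply_symm_apply]⟩
  inv_comp f := by apply UHom.ext <;> simp
  comp_inv f := by apply UHom.ext <;> simp

/-- The involution of `U_Δ`. -/
def UObj.swap (κ : Cardinal.{u}) : UObj κ ⥤ UObj κ where
  obj A := ⟨A.A₁, A.A₀, A.χ.symm⟩
  map {A B} f := ⟨f.ρ₁, f.ρ₀, fun x => by
    rw [Equiv.symm_apply_eq, f.comm, Equiv.apply_symm_apply]⟩

/-- The groupoid with involution `U_Δ`. -/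
def UΔ (κ : Cardinal.{u}) : InvGrpd.{u + 1} := ⟨Grpd.of (UObj κ), UObj.swap κ, rfl⟩

/-- Objects of `Ũ_Δ`: tuples `(A₀, A₁, a, χ)` with `(A₀, A₁, χ)` in `U_Δ` and `a ∈ A₀`. -/
structure UtObj (κ : Cardinal.{u}) : Type (u + 1) where
  base : UObj κ
  pt : base.A₀.1

/-- Morphisms of `Ũ_Δ`: the morphisms `(ρ₀, ρ₁)` of `U_Δ` with `ρ₀ a = b`. -/
@[ext]
structure UtHom {κ : Cardinal.{u}} (A B : UtObj κ) : Type (u + 1) where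
  base : A.base ⟶ B.base
  pt : base.ρ₀ A.pt = B.pt

instance (κ : Cardinal.{u}) : Groupoid.{u + 1} (UtObj κ) where
  Hom A B := UtHom A B
  id A := ⟨𝟙 _, rfl⟩
  comp f g := ⟨f.base ≫ g.base, (congrArg g.base.ρ₀ f.pt).trans g.pt⟩
  inv f := ⟨Groupoid.inv f.base, (Equiv.symm_apply_eq _).2 f.pt.symm⟩
  id_comp f := by apply UtHom.ext; simp
  comp_id f := by apply UtHom.ext; simp
  assoc f g h := by apply UtHom.ext; simp
  inv_comp f := by apply UtHom.ext; simp
  comp_inv f := by apply UtHom.ext; simp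

/-- The involution of `Ũ_Δ`, `(A₀, A₁, a, χ) ↦ (A₁, A₀, χ a, χ⁻¹)`. -/
def UtObj.swap (κ : Cardinal.{u}) : UtObj κ ⥤ UtObj κ where
  obj A := ⟨(UObj.swap κ).obj A.base, A.base.χ A.pt⟩
  map {A B} f := ⟨(UObj.swap κ).map f.base,
    (f.base.comm A.pt).symm.trans (congrArg B.base.χ f.pt)⟩

theorem UtObj.swap_swap (κ : Cardinal.{u}) : UtObj.swap κ ⋙ UtObj.swap κ = 𝟭 (UtObj κ) := by
  have key : ∀ {X Y : UObj κ} (a a' : X.A₀.1) (b b' : Y.A₀.1) (f : X ⟶ Y) (_ : a = a')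
      (_ : b = b') (h : f.ρ₀ a = b) (h' : f.ρ₀ a' = b'),
      (⟨f, h⟩ : UtHom ⟨X, a⟩ ⟨Y, b⟩) ≍ (⟨f, h'⟩ : UtHom ⟨X, a'⟩ ⟨Y, b'⟩) := by
    rintro X Y a _ b _ f rfl rfl h h'
    rfl
  refine CategoryTheory.Functor.hext (fun A => ?_) (fun A B f => ?_)
  · exact congrArg (UtObj.mk A.base) (A.base.χ.symm_apply_apply A.pt)
  · exact key _ _ _ _ f.base (A.base.χ.symm_apply_apply A.pt) (B.base.χ.symm_apply_apply B.pt) _ _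

/-- The groupoid with involution `Ũ_Δ`. -/
def UtΔ (κ : Cardinal.{u}) : InvGrpd.{u + 1} :=
  ⟨Grpd.of (UtObj κ), UtObj.swap κ, UtObj.swap_swap κ⟩

/-- The morphism `p_Δ : Ũ_Δ ⟶ U_Δ` that forgets the point. -/
def pΔ (κ : Cardinal.{u}) : UtΔ κ ⟶ UΔ κ where
  functor :=
    { obj := fun A => A.base
      map := fun f => f.base
      map_id := fun _ => rfl
      map_comp := fun _ _ => rfl }
  comm := rfl

end Universe

end EquivariantGpd
open EquivariantGpd

/-! The argument rests on one observation: between fibrant objects, the small fibrations are exactly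
the equivariant functors whose underlying functor is a covering (discrete fibration) with `κ`-small
fibres (`isSmall_iff`). A covering lifts uniquely against every equivalence of groupoids, and
uniqueness makes the lift in an equivariant square equivariant. Hence coverings are injective
fibrations (`fibrations_of_isCovering`), in particular `pΔ` and `δ₂`. The map `δ₁` is a trivial
cofibration because it is a section of the source map, which is an equivalence.

Fibrancy of `UΔ`: a morphism `Y ⟶ UΔ` amounts to a family of small sets `F y` with an action of the
morphisms of `Y` and bijections `F y ≃ F (σ y)`, where `σ` is the involution of `Y`, that are
natural and square to the identity (`Code`). Such a family extends along a trivial cofibration: pull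
it back along a retraction up to isomorphism, which need not be equivariant, and correct the
bijections by the arrows that compare the retraction with its conjugate by `σ` (`exists_extension`).

Type-theoretic fibration category: factorizations come from the mapping path object, which also
shows that acyclic cofibrations between fibrant objects are trivial cofibrations. Dependent products
are groupoids of sections over the fibres of an isofibration, and inherit the involution through
their universal property.

Univalence: the reflexivity map `r` of an identity type of small types is a section of a covering,
hence itself a covering and a fibration. It is also acyclic, so it lifts against itself and is
invertible (`isIso_r`). Identity types therefore express strict equality, and `Equiv(A, B)`
classifies pairs of mutually inverse maps between small types (`exists_isoClassifier`). The path
object of `UΔ` classifies the same thing, because an arrow of `UΔ` is determined by a bijection of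
first components (`pathClassifier`). The two classifiers are isomorphic, compatibly with identities,
so `U ⟶ E` is `δ₁` up to isomorphism. -/

namespace EquivariantGpd

/-! ### Heterogeneous equality of arrows, needed because functors are compared strictly. -/

section HEq

variable {C : Type*} [Category* C] {D : Type*} [Category* D]

theorem comp_heq_comp {X X' Y Y' Z Z' : C} {f : X ⟶ Y} {f' : X' ⟶ Y'} {g : Y ⟶ Z} {g' : Y' ⟶ Z'}
    (hX : X = X') (hY : Y = Y') (hZ : Z = Z') (hf : f ≍ f') (hg : g ≍ g') :
    f ≫ g ≍ f' ≫ g' := by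
  subst hX hY hZ hf hg; rfl

theorem id_heq_id {X X' : C} (h : X = X') : 𝟙 X ≍ 𝟙 X' := by
  subst h; rfl

theorem inv_heq_inv {C : Type w} [Groupoid.{w} C] {X X' Y Y' : C} {f : X ⟶ Y} {f' : X' ⟶ Y'}
    (hX : X = X') (hY : Y = Y') (hf : f ≍ f') : Groupoid.inv f ≍ Groupoid.inv f' := by
  subst hX hY hf; rfl

theorem map_heq_map (F : C ⥤ D) {X X' Y Y' : C} {f : X ⟶ Y} {f' : X' ⟶ Y'}
    (hX : X = X') (hY : Y = Y') (hf : f ≍ f') : F.map f ≍ F.map f' := by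
  subst hX hY hf; rfl

theorem map_groupoidInv {C D : Type w} [Groupoid.{w} C] [Groupoid.{w} D] (F : C ⥤ D) {X Y : C}
    (f : X ⟶ Y) : F.map (Groupoid.inv f) = Groupoid.inv (F.map f) := by
  simp [Groupoid.inv_eq_inv]

theorem exists_heq_hom {X X' Y Y' : C} (hX : X = X') (hY : Y = Y') (f : X ⟶ Y) :
    ∃ f' : X' ⟶ Y', f' ≍ f := by
  subst hX hY; exact ⟨f, HEq.rfl⟩

end HEq

/-! ### Isofibrations, coverings, and lifting against equivalences. -/

section Coverings

variable {X Y Z K L : Type w} [Groupoid.{w} X] [Groupoid.{w} Y] [Groupoid.{w} Z] [Groupoid.{w} K] [Groupoid.{w} L]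

/-- The action of a functor on the arrows with a given source. -/
def star (F : X ⥤ Y) (x : X) (s : Σ x', x ⟶ x') : Σ y, F.obj x ⟶ y := ⟨F.obj s.1, F.map s.2⟩

/-- Isofibrations of groupoids. -/
def IsIsofibration (F : X ⥤ Y) : Prop := ∀ x, Function.Surjective (star F x)

/-- Coverings (discrete fibrations) of groupoids. -/
def IsCovering (F : X ⥤ Y) : Prop := ∀ x, Function.Bijective (star F x)

theorem IsIsofibration.lift {F : X ⥤ Y} (hF : IsIsofibration F) {x : X} {y y' : Y}
    (h : F.obj x = y) (ψ : y ⟶ y') : ∃ (x' : X) (φ : x ⟶ x'), F.obj x' = y' ∧ F.map φ ≍ ψ := by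
  subst h
  obtain ⟨⟨x', φ⟩, h⟩ := hF x ⟨y', ψ⟩
  obtain ⟨h₁, h₂⟩ := Sigma.mk.inj_iff.1 h
  exact ⟨x', φ, h₁, h₂⟩

theorem isIsofibration_iff {F : X ⥤ Y} : IsIsofibration F ↔
    ∀ (x : X) (y : Y) (ψ : F.obj x ⟶ y), ∃ (x' : X) (φ : x ⟶ x'), F.obj x' = y ∧ F.map φ ≍ ψ := by
  refine ⟨fun h x y ψ => h.lift rfl ψ, fun h x => ?_⟩
  rintro ⟨y, ψ⟩
  obtain ⟨x', φ, h₁, h₂⟩ := h x y ψ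
  exact ⟨⟨x', φ⟩, Sigma.ext h₁ h₂⟩

/-- Uniqueness of lifts of arrows with a given source. -/
def HasUniqueLifts (F : X ⥤ Y) : Prop :=
  ∀ {x x' y y' : X} (φ : x ⟶ y) (φ' : x' ⟶ y'), x = x' → F.obj y = F.obj y' →
    F.map φ ≍ F.map φ' → y = y' ∧ φ ≍ φ'

theorem IsCovering.isIsofibration {F : X ⥤ Y} (hF : IsCovering F) : IsIsofibration F :=
  fun x => (hF x).2

theorem IsCovering.hasUniqueLifts {F : X ⥤ Y} (hF : IsCovering F) : HasUniqueLifts F := by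
  rintro x _ y y' φ φ' rfl h₁ h₂
  have := (hF x).1 (a₁ := ⟨y, φ⟩) (a₂ := ⟨y', φ'⟩) (Sigma.ext h₁ h₂)
  exact Sigma.mk.inj_iff.1 this

theorem isCovering_iff {F : X ⥤ Y} : IsCovering F ↔ IsIsofibration F ∧ HasUniqueLifts F := by
  refine ⟨fun h => ⟨h.isIsofibration, h.hasUniqueLifts⟩, fun h x => ⟨?_, h.1 x⟩⟩
  rintro ⟨y, φ⟩ ⟨y', φ'⟩ h'
  obtain ⟨h₁, h₂⟩ := Sigma.mk.inj_iff.1 h'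
  obtain ⟨h₃, h₄⟩ := h.2 φ φ' rfl h₁ h₂
  exact Sigma.ext h₃ h₄

theorem HasUniqueLifts.map_injective {F : X ⥤ Y} (hF : HasUniqueLifts F) {x y : X} {φ φ' : x ⟶ y}
    (h : F.map φ = F.map φ') : φ = φ' :=
  eq_of_heq (hF φ φ' rfl rfl (heq_of_eq h)).2

theorem star_comp (F : X ⥤ Y) (G : Y ⥤ Z) (x : X) :
    star (F ⋙ G) x = star G (F.obj x) ∘ star F x := rfl

theorem IsCovering.comp {F : X ⥤ Y} {G : Y ⥤ Z} (hF : IsCovering F) (hG : IsCovering G) :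
    IsCovering (F ⋙ G) := fun x => by
  rw [star_comp]; exact (hG _).comp (hF x)

theorem IsCovering.of_comp {F : X ⥤ Y} {G : Y ⥤ Z} (hG : IsCovering G)
    (h : IsCovering (F ⋙ G)) : IsCovering F := fun x => by
  have := h x
  rw [star_comp] at this
  exact (Function.Bijective.of_comp_iff' (hG _) _).1 this

theorem isCovering_id : IsCovering (𝟭 X) := fun _ => Function.bijective_id

/-- Two lifts of a functor through a covering agree if they agree up to isomorphism of objects. -/
theorem HasUniqueLifts.functor_ext {F : X ⥤ Y} (hF : HasUniqueLifts F) (i : K ⥤ L) [i.EssSurj]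
    {h h' : L ⥤ X} (h₁ : i ⋙ h = i ⋙ h') (h₂ : h ⋙ F = h' ⋙ F) : h = h' := by
  -- Every `l` receives an arrow from some `i.obj k`; its two images have the same source and the
  -- same projection, so they have the same target.
  have hobj : ∀ l, h.obj l = h'.obj l := fun l =>
    (hF (h.map (i.objObjPreimageIso l).hom) (h'.map (i.objObjPreimageIso l).hom)
      (Functor.congr_obj h₁ _) (Functor.congr_obj h₂ l) (Functor.hcongr_hom h₂ _)).1
  exact Functor.hext hobj fun l l' f =>
    (hF (h.map f) (h'.map f) (hobj l) (Functor.congr_obj h₂ _) (Functor.hcongr_hom h₂ f)).2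

/-- Coverings lift against equivalences. -/
theorem IsCovering.exists_lift {F : X ⥤ Y} (hF : IsCovering F) (i : K ⥤ L) [i.IsEquivalence]
    (s : K ⥤ X) (t : L ⥤ Y) (sq : s ⋙ F = i ⋙ t) : ∃ h : L ⥤ X, i ⋙ h = s ∧ h ⋙ F = t := by
  have hobj : ∀ k, F.obj (s.obj k) = t.obj (i.obj k) := Functor.congr_obj sq
  let k : L → K := i.objPreimage
  let φ : ∀ l, i.obj (k l) ⟶ l := fun l => (i.objObjPreimageIso l).hom
  -- The value of the lift at `l` is the endpoint of the arrow over `t (φ l)` that starts at `s (k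
  -- l)`.
  choose x χ hx hχ using fun l => hF.isIsofibration.lift (hobj (k l)) (t.map (φ l))
  let p : ∀ {l l' : L} (_ : l ⟶ l'), k l ⟶ k l' := fun {l l'} f =>
    i.preimage (φ l ≫ f ≫ Groupoid.inv (φ l'))
  have ip : ∀ {l l' : L} (f : l ⟶ l'), i.map (p f) = φ l ≫ f ≫ Groupoid.inv (φ l') :=
    fun f => i.map_preimage _
  let h : L ⥤ X :=
    { obj := x
      map := fun {l l'} f => Groupoid.inv (χ l) ≫ s.map (p f) ≫ χ l'
      map_id := fun l => by
        have : p (𝟙 l) = 𝟙 _ := i.map_injective (by simp [ip])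
        simp [this]
      map_comp := fun {a b c} f g => by
        have : p (f ≫ g) = p f ≫ p g := i.map_injective (by simp [ip])
        simp [this] }
  -- On the image of `i`, both `χ` and the image under `s` of the preimage of `φ` lift the same
  -- arrow from the same source. Uniqueness of lifts gives a strict extension of `s` without any
  -- injectivity of `i` on objects.
  have key : ∀ k₀, x (i.obj k₀) = s.obj k₀ ∧ χ (i.obj k₀) ≍ s.map (i.preimage (φ (i.obj k₀))) :=
    fun k₀ => hF.hasUniqueLifts _ _ rfl ((hx _).trans (hobj k₀).symm)
      ((hχ _).trans (((heq_of_eq (by simp)).trans (Functor.hcongr_hom sq _).symm)))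
  refine ⟨h, Functor.hext (fun k₀ => (key k₀).1) fun k₀ k₁ f => ?_,
    Functor.hext hx fun l l' f => ?_⟩
  · have := comp_heq_comp (key k₀).1 rfl (key k₁).1
      (inv_heq_inv rfl (key k₀).1 (key k₀).2)
      (comp_heq_comp rfl rfl (key k₁).1 (HEq.refl (s.map (p (i.map f)))) (key k₁).2)
    refine this.trans (heq_of_eq ?_)
    rw [← map_groupoidInv, ← s.map_comp, ← s.map_comp]
    congr 1
    exact i.map_injective (by simp [ip])
  · have := comp_heq_comp (hx l) (hobj _) (hx l')
      (inv_heq_inv (hobj _) (hx l) (hχ l))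
      (comp_heq_comp (hobj _) (hobj _) (hx l') (Functor.hcongr_hom sq (p f)) (hχ l'))
    refine HEq.trans (heq_of_eq ?_) (this.trans (heq_of_eq ?_))
    · simp [h]
    · simp [ip]

end Coverings

/-! ### Strict pullbacks of groupoids, described by objects and arrows. -/

section StrictPullbacks

variable {W X Y Z V : Type w} [Groupoid.{w} W] [Groupoid.{w} X] [Groupoid.{w} Y] [Groupoid.{w} Z]
  [Groupoid.{w} V]

/-- An elementwise description of the pullback squares of groupoids. -/
structure IsStrictPullback (p : W ⥤ X) (q : W ⥤ Y) (F : X ⥤ Z) (G : Y ⥤ Z) : Prop where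
  comm : p ⋙ F = q ⋙ G
  exists_obj : ∀ x y, F.obj x = G.obj y → ∃ a, p.obj a = x ∧ q.obj a = y
  obj_ext : ∀ {a b}, p.obj a = p.obj b → q.obj a = q.obj b → a = b
  exists_map : ∀ {a b} (φ : p.obj a ⟶ p.obj b) (ψ : q.obj a ⟶ q.obj b), F.map φ ≍ G.map ψ →
    ∃ ω : a ⟶ b, p.map ω = φ ∧ q.map ω = ψ
  map_ext : ∀ {a b} {ω ω' : a ⟶ b}, p.map ω = p.map ω' → q.map ω = q.map ω' → ω = ω'

namespace IsStrictPullback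

variable {p : W ⥤ X} {q : W ⥤ Y} {F : X ⥤ Z} {G : Y ⥤ Z}

theorem flip (h : IsStrictPullback p q F G) : IsStrictPullback q p G F where
  comm := h.comm.symm
  exists_obj y x e := by
    obtain ⟨a, h₁, h₂⟩ := h.exists_obj x y e.symm
    exact ⟨a, h₂, h₁⟩
  obj_ext h₁ h₂ := h.obj_ext h₂ h₁
  exists_map φ ψ e := by
    obtain ⟨a, h₁, h₂⟩ := h.exists_map ψ φ e.symm
    exact ⟨a, h₂, h₁⟩
  map_ext h₁ h₂ := h.map_ext h₂ h₁

theorem exists_map_heq (h : IsStrictPullback p q F G) {a b : W} {x x' : X} {y y' : Y}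
    (hx : p.obj a = x) (hx' : p.obj b = x') (hy : q.obj a = y) (hy' : q.obj b = y')
    (φ : x ⟶ x') (ψ : y ⟶ y') (e : F.map φ ≍ G.map ψ) :
    ∃ ω : a ⟶ b, p.map ω ≍ φ ∧ q.map ω ≍ ψ := by
  subst hx hx' hy hy'
  obtain ⟨ω, h₁, h₂⟩ := h.exists_map φ ψ e
  exact ⟨ω, heq_of_eq h₁, heq_of_eq h₂⟩

theorem map_heq_ext (h : IsStrictPullback p q F G) {a b a' b' : W} {ω : a ⟶ b} {ω' : a' ⟶ b'}
    (ha : a = a') (hb : b = b') (h₁ : p.map ω ≍ p.map ω') (h₂ : q.map ω ≍ q.map ω') :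
    ω ≍ ω' := by
  subst ha hb
  exact heq_of_eq (h.map_ext (eq_of_heq h₁) (eq_of_heq h₂))

theorem functor_ext (h : IsStrictPullback p q F G) {k k' : V ⥤ W} (h₁ : k ⋙ p = k' ⋙ p)
    (h₂ : k ⋙ q = k' ⋙ q) : k = k' := by
  have hobj : ∀ v, k.obj v = k'.obj v := fun v =>
    h.obj_ext (Functor.congr_obj h₁ v) (Functor.congr_obj h₂ v)
  exact Functor.hext hobj fun v v' f =>
    h.map_heq_ext (hobj v) (hobj v') (Functor.hcongr_hom h₁ f) (Functor.hcongr_hom h₂ f)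

theorem exists_lift (h : IsStrictPullback p q F G) (s : V ⥤ X) (t : V ⥤ Y)
    (sq : s ⋙ F = t ⋙ G) : ∃ k : V ⥤ W, k ⋙ p = s ∧ k ⋙ q = t := by
  choose k hp hq using fun v => h.exists_obj (s.obj v) (t.obj v) (Functor.congr_obj sq v)
  choose m mp mq using fun (v v' : V) (f : v ⟶ v') =>
    h.exists_map_heq (hp v) (hp v') (hq v) (hq v') (s.map f) (t.map f) (Functor.hcongr_hom sq f)
  refine ⟨{ obj := k, map := fun f => m _ _ f, map_id := fun v => ?_, map_comp := fun {a b c} f g => ?_ },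
    Functor.hext hp fun _ _ f => mp _ _ f, Functor.hext hq fun _ _ f => mq _ _ f⟩
  · refine h.map_ext (eq_of_heq ?_) (eq_of_heq ?_)
    · exact (mp _ _ _).trans ((heq_of_eq (s.map_id v)).trans
        ((id_heq_id (hp v).symm).trans (heq_of_eq (p.map_id _).symm)))
    · exact (mq _ _ _).trans ((heq_of_eq (t.map_id v)).trans
        ((id_heq_id (hq v).symm).trans (heq_of_eq (q.map_id _).symm)))
  · refine h.map_ext (eq_of_heq ?_) (eq_of_heq ?_)
    · rw [p.map_comp]
      exact (mp _ _ _).trans ((heq_of_eq (s.map_comp f g)).trans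
        (comp_heq_comp (hp a) (hp b) (hp c) (mp _ _ f) (mp _ _ g)).symm)
    · rw [q.map_comp]
      exact (mq _ _ _).trans ((heq_of_eq (t.map_comp f g)).trans
        (comp_heq_comp (hq a) (hq b) (hq c) (mq _ _ f) (mq _ _ g)).symm)

/-- Applied to the comparison isomorphism with an explicit pullback, this transfers the elementwise
description to an arbitrary categorical pullback. -/
theorem precomp (h : IsStrictPullback p q F G) (e : V ⥤ W) (h₁ : e.Full)
    (h₂ : e.Faithful) (he : Function.Bijective e.obj) : IsStrictPullback (e ⋙ p) (e ⋙ q) F G where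
  comm := by rw [Functor.assoc, h.comm, Functor.assoc]
  exists_obj x y hxy := by
    obtain ⟨a, h₁, h₂⟩ := h.exists_obj x y hxy
    obtain ⟨a, rfl⟩ := he.2 a
    exact ⟨a, h₁, h₂⟩
  obj_ext h₁ h₂ := he.1 (h.obj_ext h₁ h₂)
  exists_map φ ψ hφ := by
    obtain ⟨ω, h₁, h₂⟩ := h.exists_map φ ψ hφ
    obtain ⟨ω, rfl⟩ := e.map_surjective ω
    exact ⟨ω, h₁, h₂⟩
  map_ext h₁ h₂ := e.map_injective (h.map_ext h₁ h₂)

/-- Isofibrations are stable under pullback. -/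
theorem isIsofibration (h : IsStrictPullback p q F G) (hF : IsIsofibration F) :
    IsIsofibration q := isIsofibration_iff.2 fun a y ψ => by
  obtain ⟨x', φ, h₁, h₂⟩ := hF.lift (Functor.congr_obj h.comm a) (G.map ψ)
  obtain ⟨b, hb₁, hb₂⟩ := h.exists_obj x' y h₁
  obtain ⟨ω, -, hω⟩ := h.exists_map_heq rfl hb₁ rfl hb₂ φ ψ h₂
  exact ⟨b, ω, hb₂, hω⟩

theorem hasUniqueLifts (h : IsStrictPullback p q F G) (hF : HasUniqueLifts F) :
    HasUniqueLifts q := by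
  rintro a _ b b' ω ω' rfl hb hω
  have hG := map_heq_map G rfl hb hω
  obtain ⟨h₁, h₂⟩ := hF (p.map ω) (p.map ω') rfl
    ((Functor.congr_obj h.comm b).trans ((congrArg G.obj hb).trans
      (Functor.congr_obj h.comm b').symm))
    ((Functor.hcongr_hom h.comm ω).trans (hG.trans (Functor.hcongr_hom h.comm ω').symm))
  have := h.obj_ext h₁ hb
  exact ⟨this, h.map_heq_ext rfl this h₂ hω⟩

/-- Coverings are stable under pullback. -/
theorem isCovering (h : IsStrictPullback p q F G) (hF : IsCovering F) : IsCovering q :=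
  isCovering_iff.2 ⟨h.isIsofibration hF.isIsofibration, h.hasUniqueLifts hF.hasUniqueLifts⟩

theorem full (h : IsStrictPullback p q F G) [F.Full] : q.Full where
  map_surjective {a b} ψ := by
    obtain ⟨ψ', hψ'⟩ := exists_heq_hom (Functor.congr_obj h.comm a).symm
      (Functor.congr_obj h.comm b).symm (G.map ψ)
    obtain ⟨φ, hφ⟩ := F.map_surjective ψ'
    obtain ⟨ω, -, hω⟩ := h.exists_map φ ψ ((heq_of_eq hφ).trans hψ')
    exact ⟨ω, hω⟩

theorem faithful (h : IsStrictPullback p q F G) [F.Faithful] : q.Faithful where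
  map_injective {_ _} ω ω' hω := by
    refine h.map_ext (F.map_injective (eq_of_heq ?_)) hω
    exact (Functor.hcongr_hom h.comm ω).trans ((heq_of_eq (congrArg G.map hω)).trans
      (Functor.hcongr_hom h.comm ω').symm)

theorem obj_injective (h : IsStrictPullback p q F G) (hF : Function.Injective F.obj) :
    Function.Injective q.obj := fun a b e =>
  h.obj_ext (hF ((Functor.congr_obj h.comm a).trans ((congrArg G.obj e).trans
    (Functor.congr_obj h.comm b).symm))) e

/-- The fibres of a pullback. -/
theorem exists_fiber_equiv (h : IsStrictPullback p q F G) (y : Y) :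
    Nonempty ({a // q.obj a = y} ≃ {x // F.obj x = G.obj y}) := by
  refine ⟨Equiv.ofBijective
    (fun a => ⟨p.obj a.1, (Functor.congr_obj h.comm a.1).trans (congrArg G.obj a.2)⟩) ⟨?_, ?_⟩⟩
  · rintro ⟨a, rfl⟩ ⟨b, hb⟩ e
    exact Subtype.ext (h.obj_ext (congrArg Subtype.val e) hb.symm)
  · rintro ⟨x, hx⟩
    obtain ⟨a, h₁, h₂⟩ := h.exists_obj x y hx
    exact ⟨⟨a, h₂⟩, Subtype.ext h₁⟩

end IsStrictPullback

/-- The objects of the pullback of two functors between groupoids. -/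
@[ext]
structure Pullback (F : X ⥤ Z) (G : Y ⥤ Z) : Type w where
  fst : X
  snd : Y
  eq : F.obj fst = G.obj snd

/-- The morphisms of the pullback of two functors between groupoids. -/
@[ext]
structure Pullback.Hom {F : X ⥤ Z} {G : Y ⥤ Z} (a b : Pullback F G) : Type w where
  fst : a.fst ⟶ b.fst
  snd : a.snd ⟶ b.snd
  eq : F.map fst ≍ G.map snd

variable (F : X ⥤ Z) (G : Y ⥤ Z)

instance : Groupoid.{w} (Pullback F G) where
  Hom a b := Pullback.Hom a b
  id a := ⟨𝟙 _, 𝟙 _, by simpa using id_heq_id a.eq⟩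
  comp f g := ⟨f.fst ≫ g.fst, f.snd ≫ g.snd, by
    simpa using comp_heq_comp (Pullback.eq _) (Pullback.eq _) (Pullback.eq _) f.eq g.eq⟩
  inv f := ⟨Groupoid.inv f.fst, Groupoid.inv f.snd, by
    rw [map_groupoidInv, map_groupoidInv]
    exact inv_heq_inv (Pullback.eq _) (Pullback.eq _) f.eq⟩
  id_comp f := by apply Pullback.Hom.ext <;> simp
  comp_id f := by apply Pullback.Hom.ext <;> simp
  assoc f g h := by apply Pullback.Hom.ext <;> simp
  inv_comp f := by apply Pullback.Hom.ext <;> simp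
  comp_inv f := by apply Pullback.Hom.ext <;> simp

/-- The first projection. -/
def Pullback.fstFunctor : Pullback F G ⥤ X where
  obj a := a.fst
  map f := f.fst
  map_id _ := rfl
  map_comp _ _ := rfl

/-- The second projection. -/
def Pullback.sndFunctor : Pullback F G ⥤ Y where
  obj a := a.snd
  map f := f.snd
  map_id _ := rfl
  map_comp _ _ := rfl

theorem Pullback.isStrictPullback :
    IsStrictPullback (Pullback.fstFunctor F G) (Pullback.sndFunctor F G) F G where
  comm := Functor.hext (fun a => a.eq) fun _ _ f => f.eq
  exists_obj x y h := ⟨⟨x, y, h⟩, rfl, rfl⟩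
  obj_ext h₁ h₂ := Pullback.ext h₁ h₂
  exists_map φ ψ h := ⟨⟨φ, ψ, h⟩, rfl, rfl⟩
  map_ext h₁ h₂ := Pullback.Hom.ext h₁ h₂

end StrictPullbacks

/-- Pullback squares of groupoids. -/
theorem IsStrictPullback.isPullback {W X Y Z : Grpd.{w, w}} {p : W ⟶ X} {q : W ⟶ Y} {F : X ⟶ Z}
    {G : Y ⟶ Z} (h : IsStrictPullback p q F G) : IsPullback p q F G := by
  refine ⟨⟨h.comm⟩, ⟨PullbackCone.IsLimit.mk h.comm
    (fun s => (h.exists_lift s.fst s.snd s.condition).choose)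
    (fun s => (h.exists_lift s.fst s.snd s.condition).choose_spec.1)
    (fun s => (h.exists_lift s.fst s.snd s.condition).choose_spec.2) fun s m h₁ h₂ => ?_⟩⟩
  have := (h.exists_lift s.fst s.snd s.condition).choose_spec
  exact h.functor_ext (h₁.trans this.1.symm) (h₂.trans this.2.symm)

theorem grpd_iso_bijective {X Y : Grpd.{w, w}} (e : X ≅ Y) :
    Function.Bijective (Functor.obj e.hom) :=
  Function.bijective_iff_has_inverse.2 ⟨Functor.obj e.inv,
    Functor.congr_obj e.hom_inv_id, Functor.congr_obj e.inv_hom_id⟩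

theorem grpd_iso_isEquivalence {X Y : Grpd.{w, w}} (e : X ≅ Y) :
    Functor.IsEquivalence (C := X) (D := Y) e.hom :=
  (CategoryTheory.Equivalence.mk (C := X) (D := Y) e.hom e.inv (eqToIso e.hom_inv_id.symm)
    (eqToIso e.inv_hom_id)).isEquivalence_functor

theorem isStrictPullback_of_isPullback {W X Y Z : Grpd.{w, w}} {p : W ⟶ X} {q : W ⟶ Y}
    {F : X ⟶ Z} {G : Y ⟶ Z} (h : IsPullback p q F G) : IsStrictPullback p q F G := by
  have h' := Pullback.isStrictPullback (X := X) (Y := Y) (Z := Z) F G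
  have h'' := IsStrictPullback.isPullback (W := Grpd.of (Pullback (X := X) (Y := Y) (Z := Z) F G)) h'
  let e := h.isoIsPullback _ _ h''
  have h₁ : p = e.hom ≫ Pullback.fstFunctor (X := X) (Y := Y) (Z := Z) F G :=
    (h.isoIsPullback_hom_fst _ _ h'').symm
  have h₂ : q = e.hom ≫ Pullback.sndFunctor (X := X) (Y := Y) (Z := Z) F G :=
    (h.isoIsPullback_hom_snd _ _ h'').symm
  have := grpd_iso_isEquivalence e
  rw [h₁, h₂]
  exact h'.precomp _ this.full this.faithful (grpd_iso_bijective e)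

/-! ### Pullbacks of groupoids with involution are pullbacks of the underlying groupoids. -/

namespace InvGrpd

theorem hom_ext {A B : InvGrpd.{w}} {f g : A ⟶ B} (h : under f = under g) : f = g := Hom.ext h

theorem under_comp {A B D : InvGrpd.{w}} (f : A ⟶ B) (g : B ⟶ D) :
    under (f ≫ g) = under f ⋙ under g := rfl

/-- The involution as a functor. -/
abbrev invol (A : InvGrpd.{w}) : A.carrier ⥤ A.carrier := A.inv

theorem invol_invol (A : InvGrpd.{w}) : invol A ⋙ invol A = 𝟭 _ := A.inv_inv

theorem invol_under {A B : InvGrpd.{w}} (f : A ⟶ B) :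
    invol A ⋙ under f = under f ⋙ invol B := Hom.comm f

theorem invol_obj (A : InvGrpd.{w}) (a : A.carrier) : (invol A).obj ((invol A).obj a) = a :=
  Functor.congr_obj A.invol_invol a

theorem invol_map (A : InvGrpd.{w}) {a b : A.carrier} (f : a ⟶ b) :
    (invol A).map ((invol A).map f) ≍ f :=
  Functor.hcongr_hom A.invol_invol f

theorem under_invol_obj {A B : InvGrpd.{w}} (f : A ⟶ B) (a : A.carrier) :
    (under f).obj ((invol A).obj a) = (invol B).obj ((under f).obj a) :=
  Functor.congr_obj (invol_under f) a

theorem under_invol_map {A B : InvGrpd.{w}} (f : A ⟶ B) {a b : A.carrier} (φ : a ⟶ b) :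
    (under f).map ((invol A).map φ) ≍ (invol B).map ((under f).map φ) :=
  Functor.hcongr_hom (invol_under f) φ

/-- The forgetful functor to groupoids. -/
def forget : InvGrpd.{w} ⥤ Grpd.{w, w} where
  obj A := A.carrier
  map f := f.functor
  map_id _ := rfl
  map_comp _ _ := rfl

/-- Pullback squares of groupoids with involution. -/
theorem isPullback_of_strict {W X Y Z : InvGrpd.{w}} {p : W ⟶ X} {q : W ⟶ Y} {f : X ⟶ Z}
    {g : Y ⟶ Z} (h : IsStrictPullback (under p) (under q) (under f) (under g)) :
    IsPullback p q f g := by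
  have lift : ∀ {V : InvGrpd.{w}} (s : V ⟶ X) (t : V ⟶ Y), s ≫ f = t ≫ g →
      ∃ k : V ⟶ W, k ≫ p = s ∧ k ≫ q = t := fun {V} s t e => by
    obtain ⟨k, h₁, h₂⟩ := h.exists_lift (under s) (under t) (congrArg under e)
    -- The underlying lift is equivariant because both composites with the involutions have the same
    -- projections.
    refine ⟨⟨k, h.functor_ext ?_ ?_⟩, hom_ext h₁, hom_ext h₂⟩
    · change invol V ⋙ (k ⋙ under p) = k ⋙ (invol W ⋙ under p)
      rw [h₁, invol_under, invol_under, ← h₁, Functor.assoc]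
    · change invol V ⋙ (k ⋙ under q) = k ⋙ (invol W ⋙ under q)
      rw [h₂, invol_under, invol_under, ← h₂, Functor.assoc]
  have comm : p ≫ f = q ≫ g := hom_ext h.comm
  refine ⟨⟨comm⟩, ⟨PullbackCone.IsLimit.mk comm
    (fun s => (lift s.fst s.snd s.condition).choose)
    (fun s => (lift s.fst s.snd s.condition).choose_spec.1)
    (fun s => (lift s.fst s.snd s.condition).choose_spec.2) fun s m h₁ h₂ => hom_ext ?_⟩⟩
  have := (lift s.fst s.snd s.condition).choose_spec
  exact h.functor_ext (congrArg under (h₁.trans this.1.symm)) (congrArg under (h₂.trans this.2.symm))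

/-- The pullback of groupoids with involution. -/
theorem exists_strict_pullback {X Y Z : InvGrpd.{w}} (f : X ⟶ Z) (g : Y ⟶ Z) :
    ∃ (W : InvGrpd.{w}) (p : W ⟶ X) (q : W ⟶ Y),
      IsStrictPullback (under p) (under q) (under f) (under g) := by
  have h := Pullback.isStrictPullback (under f) (under g)
  -- The involution of the pullback is the one induced by the involutions of the two factors.
  obtain ⟨k, h₁, h₂⟩ := h.exists_lift (Pullback.fstFunctor _ _ ⋙ invol X)
    (Pullback.sndFunctor _ _ ⋙ invol Y) (by
      rw [Functor.assoc, Functor.assoc, invol_under, invol_under, ← Functor.assoc, h.comm,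
        Functor.assoc])
  refine ⟨⟨Grpd.of (Pullback (under f) (under g)), k, h.functor_ext ?_ ?_⟩, ⟨Pullback.fstFunctor _ _, h₁⟩,
    ⟨Pullback.sndFunctor _ _, h₂⟩, h⟩
  · change k ⋙ (k ⋙ Pullback.fstFunctor _ _) = _
    rw [h₁, ← Functor.assoc, h₁, Functor.assoc, invol_invol]; rfl
  · change k ⋙ (k ⋙ Pullback.sndFunctor _ _) = _
    rw [h₂, ← Functor.assoc, h₂, Functor.assoc, invol_invol]; rfl

theorem iso_bijective {X Y : InvGrpd.{w}} (e : X ≅ Y) : Function.Bijective (under e.hom).obj :=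
  grpd_iso_bijective (forget.mapIso e)

theorem iso_isEquivalence {X Y : InvGrpd.{w}} (e : X ≅ Y) : (under e.hom).IsEquivalence :=
  grpd_iso_isEquivalence (forget.mapIso e)

theorem strict_of_isPullback {W X Y Z : InvGrpd.{w}} {p : W ⟶ X} {q : W ⟶ Y} {f : X ⟶ Z}
    {g : Y ⟶ Z} (h : IsPullback p q f g) :
    IsStrictPullback (under p) (under q) (under f) (under g) := by
  obtain ⟨W', p', q', h'⟩ := exists_strict_pullback f g
  have h'' := isPullback_of_strict h'
  let e := h.isoIsPullback _ _ h''
  have h₁ : p = e.hom ≫ p' := (h.isoIsPullback_hom_fst _ _ h'').symm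
  have h₂ : q = e.hom ≫ q' := (h.isoIsPullback_hom_snd _ _ h'').symm
  have := iso_isEquivalence e
  rw [h₁, h₂]
  exact h'.precomp _ this.full this.faithful (iso_bijective e)

end InvGrpd

/-! ### Pullbacks of equivalences, and the path groupoid. -/

section

variable {W X Y Z : Type w} [Groupoid.{w} W] [Groupoid.{w} X] [Groupoid.{w} Y] [Groupoid.{w} Z]

/-- The pullback of an equivalence of groupoids along an isofibration is an equivalence. -/
theorem IsStrictPullback.isEquivalence {p : W ⥤ X} {q : W ⥤ Y} {F : X ⥤ Z} {G : Y ⥤ Z}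
    (h : IsStrictPullback p q F G) [F.IsEquivalence] (hG : IsIsofibration G) :
    q.IsEquivalence where
  full := h.full
  faithful := h.faithful
  essSurj := ⟨fun y => by
    obtain ⟨y', ψ, h₁, -⟩ := hG.lift rfl (F.objObjPreimageIso (G.obj y)).inv
    obtain ⟨a, -, rfl⟩ := h.exists_obj _ y' h₁.symm
    exact ⟨a, ⟨(asIso ψ).symm⟩⟩⟩

namespace PathGrpd

variable (A : Type w) [Groupoid.{w} A]

/-- The source functor. -/
def srcFunctor : PathGrpd A ⥤ A where
  obj X := X.src
  map f := f.σ
  map_id _ := rfl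
  map_comp _ _ := rfl

/-- The target functor. -/
def tgtFunctor : PathGrpd A ⥤ A where
  obj X := X.tgt
  map f := f.τ
  map_id _ := rfl
  map_comp _ _ := rfl

theorem arr_comp {A : Type w} [Groupoid.{w} A] {X Y : PathGrpd A} (f : X ⟶ Y) :
    f.σ ≫ Y.arr = X.arr ≫ f.τ := by
  rw [f.comm]; simp

/-- Since the arrows of paths are invertible, the component on sources determines the component on
targets. This is why the source functor is faithful. -/
theorem hom_ext_src {A : Type w} [Groupoid.{w} A] {X Y : PathGrpd A} {f g : X ⟶ Y}
    (h : f.σ = g.σ) : f = g := by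
  refine Hom.ext h ?_
  rw [← cancel_epi X.arr, ← arr_comp, ← arr_comp, h]

/-- The tautological isomorphism of functors on the path groupoid. -/
noncomputable def srcIsoTgt : srcFunctor A ≅ tgtFunctor A :=
  NatIso.ofComponents (fun X => asIso (X := X.src) (Y := X.tgt) X.arr) (fun f => arr_comp f)

instance : (srcFunctor A).IsEquivalence where
  full := ⟨fun {X Y} (φ : X.src ⟶ Y.src) => ⟨⟨φ, Groupoid.inv X.arr ≫ φ ≫ Y.arr, by simp⟩, rfl⟩⟩
  faithful := ⟨fun h => hom_ext_src h⟩
  essSurj := ⟨fun a => ⟨(diag A).obj a, ⟨Iso.refl _⟩⟩⟩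

end PathGrpd

end

/-! ### Injective fibrations, path objects and mapping path objects. -/

namespace InvGrpd

instance : fibrations.{w}.IsStableUnderComposition :=
  inferInstanceAs trivialCofibrations.rlp.IsStableUnderComposition

instance : fibrations.{w}.IsStableUnderBaseChange :=
  inferInstanceAs trivialCofibrations.rlp.IsStableUnderBaseChange

/-- The terminal object. -/
def isTerminalOne : IsTerminal one.{w} :=
  IsTerminal.ofUniqueHom toOne fun _ _ => hom_ext (Functor.hext (fun _ => rfl) fun _ _ _ =>
    heq_of_eq (Subsingleton.elim (α := (_ : Discrete PUnit) ⟶ _) _ _))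

theorem isFibrant_of_fibrations {X Y : InvGrpd.{w}} {f : X ⟶ Y} (hf : fibrations f)
    (hY : IsFibrant Y) : IsFibrant X := by
  have : toOne X = f ≫ toOne Y := isTerminalOne.hom_ext _ _
  change fibrations (toOne X)
  rw [this]
  exact MorphismProperty.comp_mem _ _ _ hf hY

/-- Equivariant functors whose underlying functor is a covering are fibrations. -/
theorem fibrations_of_isCovering {X Y : InvGrpd.{w}} {f : X ⟶ Y} (hf : IsCovering (under f)) :
    fibrations f := fun K L i hi => ⟨fun {s t} sq => by
  have : (under i).IsEquivalence := hi.2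
  obtain ⟨h, h₁, h₂⟩ := hf.exists_lift (under i) (under s) (under t) (congrArg under sq.w)
  -- The two functors `invol L ⋙ h` and `h ⋙ invol X` agree on the image of `i` and after `f`, so
  -- unique lifting identifies them and `h` is equivariant.
  refine ⟨⟨⟨⟨h, HasUniqueLifts.functor_ext hf.hasUniqueLifts (under i) ?_ ?_⟩, hom_ext h₁, hom_ext h₂⟩⟩⟩
  · change (under i ⋙ invol L) ⋙ h = (under i ⋙ h) ⋙ invol X
    rw [h₁, ← invol_under, Functor.assoc, h₁, invol_under]
  · change invol L ⋙ (h ⋙ under f) = h ⋙ (invol X ⋙ under f)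
    rw [h₂, invol_under, invol_under, ← h₂, Functor.assoc]⟩

/-- The map `δ₂` from the path object is a covering. -/
theorem isCovering_δ₂ (A : InvGrpd.{w}) : IsCovering (under (δ₂ A)) := by
  refine isCovering_iff.2 ⟨isIsofibration_iff.2 fun x => ?_, ?_⟩
  · rintro ⟨y, y'⟩ ⟨σ, τ⟩
    exact ⟨⟨y, y', Groupoid.inv σ ≫ x.arr ≫ τ⟩, ⟨σ, τ, rfl⟩, rfl, HEq.rfl⟩
  · rintro x _ ⟨y₁, y₂, y₃⟩ ⟨z₁, z₂, z₃⟩ φ φ' rfl h₁ h₂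
    obtain ⟨rfl, rfl⟩ : y₁ = z₁ ∧ y₂ = z₂ := Prod.mk_inj.1 h₁
    obtain ⟨hσ, hτ⟩ : φ.σ = φ'.σ ∧ φ.τ = φ'.τ := Prod.mk_inj.1 (eq_of_heq h₂)
    have : y₃ = z₃ := by
      have e₁ := φ.comm
      have e₂ := φ'.comm
      rw [hσ, hτ] at e₁
      exact e₁.trans e₂.symm
    subst this
    exact ⟨rfl, heq_of_eq (PathGrpd.Hom.ext hσ hτ)⟩

theorem fibrations_δ₂ (A : InvGrpd.{w}) : fibrations (δ₂ A) :=
  fibrations_of_isCovering (isCovering_δ₂ A)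

/-- The source map of the path object. -/
abbrev pathSrc (A : InvGrpd.{w}) : path A ⟶ A := δ₂ A ≫ prodFst A A

/-- The target map of the path object. -/
abbrev pathTgt (A : InvGrpd.{w}) : path A ⟶ A := δ₂ A ≫ prodSnd A A

theorem δ₁_pathSrc (A : InvGrpd.{w}) : δ₁ A ≫ pathSrc A = 𝟙 A := rfl

theorem δ₁_pathTgt (A : InvGrpd.{w}) : δ₁ A ≫ pathTgt A = 𝟙 A := rfl

theorem isEquivalence_pathSrc (A : InvGrpd.{w}) : (under (pathSrc A)).IsEquivalence :=
  inferInstanceAs (PathGrpd.srcFunctor A.carrier).IsEquivalence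

/-- A section of an equivalence is a trivial cofibration. -/
theorem trivialCofibrations_of_section {X Y : InvGrpd.{w}} {s : X ⟶ Y} {r : Y ⟶ X}
    (h : s ≫ r = 𝟙 X) (hr : (under r).IsEquivalence) : trivialCofibrations s := by
  have h' : under s ⋙ under r = 𝟭 X.carrier := congrArg under h
  refine ⟨Function.LeftInverse.injective (g := (under r).obj) (Functor.congr_obj h'), ?_⟩
  have : (under s ⋙ under r).IsEquivalence := by rw [h']; infer_instance
  exact Functor.isEquivalence_of_comp_right (under s) (under r)

theorem trivialCofibrations_δ₁ (A : InvGrpd.{w}) : trivialCofibrations (δ₁ A) :=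
  trivialCofibrations_of_section (δ₁_pathSrc A) (isEquivalence_pathSrc A)

/-- The product of a morphism with an identity. -/
def prodMapId {X Y : InvGrpd.{w}} (f : X ⟶ Y) (Z : InvGrpd.{w}) : prod X Z ⟶ prod Y Z :=
  ⟨Functor.prod (under f) (𝟭 Z.carrier), congrArg (fun F => Functor.prod F Z.inv) (invol_under f)⟩

theorem isPullback_prodMapId {X Y : InvGrpd.{w}} (f : X ⟶ Y) (Z : InvGrpd.{w}) :
    IsPullback (prodMapId f Z) (prodFst X Z) (prodFst Y Z) f :=
  isPullback_of_strict
    { comm := rfl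
      exists_obj := fun y x h => ⟨(x, y.2), Prod.ext h.symm rfl, rfl⟩
      obj_ext := fun h₁ h₂ => Prod.ext h₂ (Prod.mk_inj.1 h₁).2
      exists_map := fun φ ψ h => ⟨(ψ, φ.2), Prod.ext (eq_of_heq h).symm rfl, rfl⟩
      map_ext := fun h₁ h₂ => Prod.ext h₂ (Prod.mk_inj.1 h₁).2 }

theorem isPullback_prod (X Y : InvGrpd.{w}) :
    IsPullback (prodFst X Y) (prodSnd X Y) (toOne X) (toOne Y) :=
  isPullback_of_strict
    { comm := rfl
      exists_obj := fun x y _ => ⟨(x, y), rfl, rfl⟩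
      obj_ext := fun h₁ h₂ => Prod.ext h₁ h₂
      exists_map := fun φ ψ _ => ⟨(φ, ψ), rfl, rfl⟩
      map_ext := fun h₁ h₂ => Prod.ext h₁ h₂ }

theorem fibrations_of_isPullback {W X Y Z : InvGrpd.{w}} {p : W ⟶ X} {q : W ⟶ Y} {f : X ⟶ Z}
    {g : Y ⟶ Z} (h : IsPullback p q f g) (hf : fibrations f) : fibrations q :=
  MorphismProperty.of_isPullback h hf

theorem isFibrant_prod {X Y : InvGrpd.{w}} (hX : IsFibrant X) (hY : IsFibrant Y) :
    IsFibrant (prod X Y) :=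
  isFibrant_of_fibrations (fibrations_of_isPullback (isPullback_prod X Y) hX) hY

theorem isFibrant_path {X : InvGrpd.{w}} (hX : IsFibrant X) : IsFibrant (path X) :=
  isFibrant_of_fibrations (fibrations_δ₂ X) (isFibrant_prod hX hX)

/-- The factorization of a morphism through its mapping path object `E`. -/
theorem exists_mapping_path {X Y : InvGrpd.{w}} (f : X ⟶ Y) :
    ∃ (E : InvGrpd.{w}) (a : E ⟶ path Y) (b : E ⟶ X) (j : X ⟶ E),
      IsPullback a b (pathSrc Y) f ∧ j ≫ b = 𝟙 X ∧ j ≫ a = f ≫ δ₁ Y ∧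
      trivialCofibrations j ∧
      (IsFibrant X → fibrations (a ≫ pathTgt Y)) := by
  obtain ⟨E, a, b, h⟩ := exists_strict_pullback (pathSrc Y) f
  have hE := isPullback_of_strict h
  obtain ⟨j, hj₁, hj₂⟩ := hE.exists_lift (f ≫ δ₁ Y) (𝟙 X) (by
    rw [Category.assoc, δ₁_pathSrc, Category.comp_id, Category.id_comp])
  have h₁ := isEquivalence_pathSrc Y
  -- As a pullback of the source equivalence, `b` is fully faithful; constant paths make it
  -- surjective on objects.
  have hb : (under b).IsEquivalence :=
    { full := h.full
      faithful := h.faithful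
      essSurj := ⟨fun x => by
        obtain ⟨e, -, rfl⟩ := h.exists_obj ((under (δ₁ Y)).obj ((under f).obj x)) x rfl
        exact ⟨e, ⟨Iso.refl _⟩⟩⟩ }
  refine ⟨E, a, b, j, hE, hj₂, hj₁, trivialCofibrations_of_section hj₂ hb, fun hX => ?_⟩
  -- The map `c : E ⟶ X × Y` is a pullback of `δ₂` along `f × 1`, hence a fibration, and the
  -- projection `X × Y ⟶ Y` is one when `X` is fibrant.
  obtain ⟨c, hc₁, hc₂⟩ := (isPullback_prodMapId f Y).exists_lift (a ≫ δ₂ Y) b (by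
    rw [Category.assoc]; exact hE.w)
  have hc : IsPullback a c (δ₂ Y) (prodMapId f Y) :=
    IsPullback.of_bot (hc₂ ▸ hE) hc₁.symm (isPullback_prodMapId f Y)
  have : a ≫ pathTgt Y = c ≫ prodSnd X Y := by
    change a ≫ δ₂ Y ≫ prodSnd Y Y = _
    rw [← Category.assoc, ← hc₁, Category.assoc]
    rfl
  rw [this]
  exact MorphismProperty.comp_mem _ _ _ (fibrations_of_isPullback hc (fibrations_δ₂ Y))
    (fibrations_of_isPullback (isPullback_prod X Y) hX)

/-- Fibrations are isofibrations. -/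
theorem isIsofibration_of_fibrations {X Y : InvGrpd.{w}} {f : X ⟶ Y} (hf : fibrations f) :
    IsIsofibration (under f) := by
  obtain ⟨E, a, b, j, hE, hj₁, hj₂, hj, -⟩ := exists_mapping_path f
  -- Retract argument: lifting `j` against the fibration `f` retracts the mapping path object onto
  -- `X` over `Y`.
  have sq : CommSq (𝟙 X) j f (a ≫ pathTgt Y) := ⟨by
    rw [← Category.assoc, hj₂, Category.assoc, δ₁_pathTgt, Category.comp_id, Category.id_comp]⟩
  have := hf _ hj
  have h₁ : under j ⋙ under sq.lift = 𝟭 _ := congrArg under sq.fac_left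
  have h₂ : under sq.lift ⋙ under f = under a ⋙ under (pathTgt Y) := congrArg under sq.fac_right
  have h := strict_of_isPullback hE
  have ha : under j ⋙ under a = under f ⋙ under (δ₁ Y) := congrArg under hj₂
  have hb : under j ⋙ under b = 𝟭 _ := congrArg under hj₁
  refine isIsofibration_iff.2 fun x y ψ => ?_
  obtain ⟨e, he₁, he₂⟩ := h.exists_obj (⟨(under f).obj x, y, ψ⟩ : PathGrpd Y.carrier) x rfl
  -- In the mapping path object, `ω` joins the constant path at `f x` to the path `ψ`, with target
  -- component `ψ`. Its image under the retraction is an arrow from `x` over `ψ`.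
  obtain ⟨ω, hω₁, hω₂⟩ := h.exists_map_heq (Functor.congr_obj ha x) he₁ (Functor.congr_obj hb x) he₂
    (⟨𝟙 _, ψ, (by simp : ψ = Groupoid.inv (𝟙 _) ≫ 𝟙 _ ≫ ψ)⟩ :
      (under (δ₁ Y)).obj ((under f).obj x) ⟶ (⟨(under f).obj x, y, ψ⟩ : PathGrpd Y.carrier)) (𝟙 x)
    (heq_of_eq ((under f).map_id x).symm)
  obtain ⟨φ, hφ⟩ := exists_heq_hom (Functor.congr_obj h₁ x) rfl ((under sq.lift).map ω)
  refine ⟨(under sq.lift).obj e, φ, ?_, ?_⟩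
  · exact (Functor.congr_obj h₂ e).trans (congrArg (under (pathTgt Y)).obj he₁)
  · refine (map_heq_map (under f) (Functor.congr_obj h₁ x).symm rfl hφ).trans
      ((Functor.hcongr_hom h₂ ω).trans ?_)
    exact map_heq_map (under (pathTgt Y)) (Functor.congr_obj ha x) he₁ hω₁

end InvGrpd

/-! ### Recognition and pullback stability of trivial cofibrations. -/

namespace InvGrpd

/-- A morphism with a retraction `r` whose composite `r ≫ i` is homotopic to the identity. -/
theorem trivialCofibrations_of_homotopy {A B : InvGrpd.{w}} {i : A ⟶ B} {r : B ⟶ A}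
    (h : i ≫ r = 𝟙 A) (H : B ⟶ path B) (h₁ : H ≫ pathSrc B = r ≫ i) (h₂ : H ≫ pathTgt B = 𝟙 B) :
    trivialCofibrations i := by
  have h' : under i ⋙ under r = 𝟭 A.carrier := congrArg under h
  refine ⟨Function.LeftInverse.injective (g := (under r).obj) (Functor.congr_obj h'), ?_⟩
  have e₁ : under r ⋙ under i = under H ⋙ PathGrpd.srcFunctor B.carrier :=
    (congrArg under h₁).symm
  have e₂ : under H ⋙ PathGrpd.tgtFunctor B.carrier = 𝟭 B.carrier := congrArg under h₂
  exact (CategoryTheory.Equivalence.mk (under i) (under r) (eqToIso h'.symm)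
    (eqToIso e₁ ≪≫ Functor.isoWhiskerLeft (under H) (PathGrpd.srcIsoTgt B.carrier) ≪≫
      eqToIso e₂)).isEquivalence_functor

/-- Injectivity on objects, fullness and faithfulness pass to any pullback; only essential
surjectivity uses `b`. An isomorphism `φ` from a value of `i` to `yB c` is corrected by lifting `b
φ` through the isofibration `i ≫ b`. The corrected isomorphism lies over an identity, so together
with an identity of `Z` it defines an isomorphism in `Y` that ends at `c` and starts in the image of
`X`. -/
theorem trivialCofibrations_of_isPullback {A B D X Y Z : InvGrpd.{w}} {i : A ⟶ B} {b : B ⟶ D}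
    {z : Z ⟶ D} {j : X ⟶ Y} {y : Y ⟶ Z} {xA : X ⟶ A} {yB : Y ⟶ B} (hi : trivialCofibrations i)
    (hA : IsIsofibration (under (i ≫ b))) (h₁ : IsPullback j xA yB i) (h₂ : IsPullback y yB z b) :
    trivialCofibrations j := by
  have : (under i).IsEquivalence := hi.2
  replace h₁ := (strict_of_isPullback h₁).flip
  replace h₂ := strict_of_isPullback h₂
  refine ⟨h₁.obj_injective hi.1, { full := h₁.full, faithful := h₁.faithful, essSurj := ⟨fun c => ?_⟩ }⟩
  let φ := ((under i).objObjPreimageIso ((under yB).obj c)).hom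
  obtain ⟨a, ψ, ha, hψ⟩ := hA.lift (x := (under i).objPreimage ((under yB).obj c)) rfl
    ((under b).map φ)
  have hc : (under z).obj ((under y).obj c) = (under b).obj ((under yB).obj c) :=
    Functor.congr_obj h₂.comm c
  obtain ⟨c', hc₁, hc₂⟩ := h₂.exists_obj ((under y).obj c) ((under i).obj a) (hc.trans ha.symm)
  obtain ⟨ω, -, -⟩ := h₂.exists_map_heq (a := c') (b := c) hc₁ rfl hc₂ rfl (𝟙 _)
    (Groupoid.inv ((under i).map ψ) ≫ φ) (by
      have e : (under b).map (Groupoid.inv ((under i).map ψ) ≫ φ) ≍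
          Groupoid.inv ((under b).map φ) ≫ (under b).map φ := by
        rw [Functor.map_comp, map_groupoidInv]
        exact comp_heq_comp ha rfl rfl (inv_heq_inv rfl ha hψ) HEq.rfl
      refine HEq.trans ?_ (e.trans (heq_of_eq (Groupoid.inv_comp _))).symm
      exact (heq_of_eq ((under z).map_id _)).trans (id_heq_id hc))
  obtain ⟨x, -, hx⟩ := h₁.exists_obj a c' hc₂.symm
  exact ⟨x, ⟨eqToIso hx ≪≫ asIso ω⟩⟩

end InvGrpd

/-! ### Pullbacks, factorizations and acyclic cofibrations among fibrant objects. -/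

namespace InvGrpd.Fibrant

/-- Pullback squares of fibrant objects along a fibration are computed in `InvGrpd`. -/
theorem isPullback_hom {W X Y Z : Fibrant.{w}} {p : W ⟶ X} {q : W ⟶ Y} {f : X ⟶ Z} {g : Y ⟶ Z}
    (h : IsPullback p q f g) (hf : fibrantFibrations f) :
    IsPullback p.hom q.hom f.hom g.hom := by
  obtain ⟨W', p', q', h'⟩ := exists_strict_pullback f.hom g.hom
  have h'' := isPullback_of_strict h'
  let V : Fibrant.{w} := ⟨W', isFibrant_of_fibrations (fibrations_of_isPullback h'' hf) Y.property⟩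
  let p'' : V ⟶ X := ObjectProperty.homMk p'
  let q'' : V ⟶ Y := ObjectProperty.homMk q'
  have hV : IsPullback p'' q'' f g :=
    IsPullback.of_map_of_faithful IsFibrant.ι (show IsPullback p' q' f.hom g.hom from h'')
  let e := IsFibrant.ι.mapIso (h.isoIsPullback _ _ hV)
  exact h''.of_iso e.symm (Iso.refl _) (Iso.refl _) (Iso.refl _)
    ((Category.comp_id _).trans (congrArg (·.hom) (h.isoIsPullback_inv_fst _ _ hV)).symm)
    ((Category.comp_id _).trans (congrArg (·.hom) (h.isoIsPullback_inv_snd _ _ hV)).symm)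
    (by simp) (by simp)

theorem isPullback_of_hom {W X Y Z : Fibrant.{w}} {p : W ⟶ X} {q : W ⟶ Y} {f : X ⟶ Z} {g : Y ⟶ Z}
    (h : IsPullback p.hom q.hom f.hom g.hom) : IsPullback p q f g :=
  IsPullback.of_map_of_faithful IsFibrant.ι h

theorem exists_pullback {X Y Z : Fibrant.{w}} (f : X ⟶ Z) (g : Y ⟶ Z) (hf : fibrantFibrations f) :
    ∃ (W : Fibrant.{w}) (p : W ⟶ X) (q : W ⟶ Y), IsPullback p q f g := by
  obtain ⟨W', p', q', h'⟩ := exists_strict_pullback f.hom g.hom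
  have h'' := isPullback_of_strict h'
  exact ⟨⟨W', isFibrant_of_fibrations (fibrations_of_isPullback h'' hf) Y.property⟩,
    ObjectProperty.homMk p', ObjectProperty.homMk q', isPullback_of_hom h''⟩

theorem llp_of_trivialCofibrations {A B : Fibrant.{w}} {i : A ⟶ B}
    (hi : trivialCofibrations i.hom) : fibrantFibrations.llp i := fun X Y f hf => ⟨fun {s t} sq => by
  have sq' : CommSq s.hom i.hom f.hom t.hom := ⟨congrArg (·.hom) sq.w⟩
  have := hf _ hi
  exact ⟨⟨⟨ObjectProperty.homMk sq'.lift, ObjectProperty.hom_ext _ sq'.fac_left,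
    ObjectProperty.hom_ext _ sq'.fac_right⟩⟩⟩⟩

/-- The maps `a` and `b` are kept along with the factorization because a section of `q` then yields
both a map back to `X` and a homotopy. -/
theorem exists_factorization {X Y : Fibrant.{w}} (f : X ⟶ Y) :
    ∃ (E : Fibrant.{w}) (a : E ⟶ ⟨path Y.obj, isFibrant_path Y.property⟩) (b : E ⟶ X) (j : X ⟶ E)
      (q : E ⟶ Y), j ≫ b = 𝟙 X ∧ a.hom ≫ pathSrc Y.obj = b.hom ≫ f.hom ∧
        a.hom ≫ pathTgt Y.obj = q.hom ∧ fibrantFibrations.llp j ∧ fibrantFibrations q ∧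
        j ≫ q = f := by
  obtain ⟨E, a, b, j, hE, hj₁, hj₂, hj, hq⟩ := exists_mapping_path f.hom
  refine ⟨⟨E, isFibrant_of_fibrations (hq X.property) Y.property⟩, ObjectProperty.homMk a,
    ObjectProperty.homMk b, ObjectProperty.homMk j, ObjectProperty.homMk (a ≫ pathTgt Y.obj),
    ObjectProperty.hom_ext _ hj₁, hE.w, rfl, llp_of_trivialCofibrations hj, hq X.property,
    ObjectProperty.hom_ext _ ?_⟩
  change j ≫ a ≫ pathTgt Y.obj = _
  rw [← Category.assoc, hj₂, Category.assoc, δ₁_pathTgt, Category.comp_id]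

/-- The acyclic cofibrations between fibrant objects are the trivial cofibrations. -/
theorem trivialCofibrations_of_llp {A B : Fibrant.{w}} {i : A ⟶ B}
    (hi : fibrantFibrations.llp i) : trivialCofibrations i.hom := by
  obtain ⟨E, a, b, j, q, hj, hb, hq, -, hq', hjq⟩ := exists_factorization i
  have := hi _ hq'
  -- A section of `q` extending `j`: its `b`-component is a retraction of `i`, and its `a`-component
  -- is a homotopy from retraction followed by `i` to the identity.
  have sq : CommSq j i q (𝟙 B) := ⟨by rw [hjq, Category.comp_id]⟩
  have h₁ : i.hom ≫ sq.lift.hom = j.hom := congrArg (·.hom) sq.fac_left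
  have h₂ : sq.lift.hom ≫ q.hom = 𝟙 _ := congrArg (·.hom) sq.fac_right
  refine trivialCofibrations_of_homotopy (r := sq.lift.hom ≫ b.hom) ?_ (sq.lift.hom ≫ a.hom) ?_ ?_
  · rw [← Category.assoc, h₁]
    exact congrArg (·.hom) hj
  · rw [Category.assoc, Category.assoc]
    exact congrArg (sq.lift.hom ≫ ·) hb
  · rw [Category.assoc]
    exact (congrArg (sq.lift.hom ≫ ·) hq).trans h₂

end InvGrpd.Fibrant

/-! ### Dependent products of groupoids along isofibrations. -/

section DependentProducts

variable {A B X Y : Type w} [Groupoid.{w} A] [Groupoid.{w} B] [Groupoid.{w} X] [Groupoid.{w} Y]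

theorem over_id (g : A ⥤ B) {a : A} {b : B} (h : g.obj a = b) : g.map (𝟙 a) ≍ 𝟙 b := by
  subst h; simp

theorem over_comp {g : A ⥤ B} {a a' a'' : A} {b b' b'' : B} {α : a ⟶ a'} {α' : a' ⟶ a''}
    {β : b ⟶ b'} {β' : b' ⟶ b''} (h : g.obj a = b) (h' : g.obj a' = b') (h'' : g.obj a'' = b'')
    (hα : g.map α ≍ β) (hα' : g.map α' ≍ β') : g.map (α ≫ α') ≍ β ≫ β' := by
  subst h h' h'' hα hα'; simp

theorem over_inv {g : A ⥤ B} {a a' : A} {b b' : B} {α : a ⟶ a'} {β : b ⟶ b'}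
    (h : g.obj a = b) (h' : g.obj a' = b') (hα : g.map α ≍ β) :
    g.map (Groupoid.inv α) ≍ Groupoid.inv β := by
  subst h h' hα; simp

theorem over_id_comp {g : A ⥤ B} {a a' a'' : A} {b b' : B} {δ : a ⟶ a'} {α : a' ⟶ a''}
    {β : b ⟶ b'} (h : g.obj a = b) (h' : g.obj a' = b) (h'' : g.obj a'' = b')
    (hδ : g.map δ ≍ 𝟙 b) (hα : g.map α ≍ β) : g.map (δ ≫ α) ≍ β := by
  simpa using over_comp h h' h'' hδ hα

theorem over_comp_id {g : A ⥤ B} {a a' a'' : A} {b b' : B} {α : a ⟶ a'} {δ : a' ⟶ a''}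
    {β : b ⟶ b'} (h : g.obj a = b) (h' : g.obj a' = b') (h'' : g.obj a'' = b')
    (hα : g.map α ≍ β) (hδ : g.map δ ≍ 𝟙 b') : g.map (α ≫ δ) ≍ β := by
  simpa using over_comp h h' h'' hα hδ

theorem over_inv_id {g : A ⥤ B} {a a' : A} {b : B} {δ : a ⟶ a'} (h : g.obj a = b)
    (h' : g.obj a' = b) (hδ : g.map δ ≍ 𝟙 b) : g.map (Groupoid.inv δ) ≍ 𝟙 b := by
  simpa using over_inv h h' hδ

/-- The objects of the dependent product of `f : X ⥤ A` along an isofibration `g : A ⥤ B`: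
an object `b` of `B` and a section of `f` over the fibre of `g` at `b`. -/
structure PiObj {g : A ⥤ B} (hg : IsIsofibration g) (f : X ⥤ A) : Type w where
  base : B
  obj : ∀ a, g.obj a = base → X
  obj_f : ∀ a h, f.obj (obj a h) = a
  map : ∀ {a a'} (h : g.obj a = base) (h' : g.obj a' = base) (α : a ⟶ a'),
    g.map α ≍ 𝟙 base → (obj a h ⟶ obj a' h')
  map_f : ∀ {a a'} h h' (α : a ⟶ a') hα, f.map (map h h' α hα) ≍ α
  map_id : ∀ {a} h hα, map h h (𝟙 a) hα = 𝟙 _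
  map_comp : ∀ {a a' a''} h h' h'' (α : a ⟶ a') (α' : a' ⟶ a'') hα hα' hα'',
    map h h'' (α ≫ α') hα'' = map h h' α hα ≫ map h' h'' α' hα'

/-- The morphisms of the dependent product: a morphism `β` of `B` and a family of morphisms of `X`
indexed by the morphisms of `A` over `β`. -/
structure PiHom {g : A ⥤ B} {hg : IsIsofibration g} {f : X ⥤ A} (s t : PiObj hg f) : Type w where
  base : s.base ⟶ t.base
  map : ∀ {a a'} (h : g.obj a = s.base) (h' : g.obj a' = t.base) (α : a ⟶ a'),
    g.map α ≍ base → (s.obj a h ⟶ t.obj a' h')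
  map_f : ∀ {a a'} h h' (α : a ⟶ a') hα, f.map (map h h' α hα) ≍ α
  left : ∀ {a a' a''} h h' h'' (δ : a ⟶ a') (α : a' ⟶ a'') hδ hα hα',
    map h h'' (δ ≫ α) hα' = s.map h h' δ hδ ≫ map h' h'' α hα
  right : ∀ {a a' a''} h h' h'' (α : a ⟶ a') (δ : a' ⟶ a'') hα hδ hα',
    map h h'' (α ≫ δ) hα' = map h h' α hα ≫ t.map h' h'' δ hδ

variable {g : A ⥤ B} {hg : IsIsofibration g} {f : X ⥤ A}

theorem PiObj.ext_heq {s t : PiObj hg f} (h₁ : s.base = t.base)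
    (h₂ : ∀ a h h', s.obj a h = t.obj a h')
    (h₃ : ∀ {a a'} h h' k k' (α : a ⟶ a') hα kα, s.map h h' α hα ≍ t.map k k' α kα) : s = t := by
  obtain ⟨b, so, _, sm, _, _, _⟩ := s
  obtain ⟨b', t₀, _, tm, _, _, _⟩ := t
  obtain rfl : b = b' := h₁
  obtain rfl : so = t₀ := by funext a h; exact h₂ a h h
  obtain rfl : @sm = @tm := by
    funext a a' h h' α hα
    exact eq_of_heq (h₃ h h' h h' α hα hα)
  rfl

theorem PiHom.ext' {s t : PiObj hg f} {σ τ : PiHom s t} (h₁ : σ.base = τ.base)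
    (h₂ : ∀ {a a'} h h' (α : a ⟶ a') hα kα, σ.map h h' α hα = τ.map h h' α kα) : σ = τ := by
  obtain ⟨b, sm, _, _, _⟩ := σ
  obtain ⟨b', tm, _, _, _⟩ := τ
  obtain rfl : b = b' := h₁
  obtain rfl : @sm = @tm := by
    funext a a' h h' α hα
    exact h₂ h h' α hα hα
  rfl

theorem PiHom.ext_heq {s t s' t' : PiObj hg f} {σ : PiHom s t} {τ : PiHom s' t'} (hs : s = s')
    (ht : t = t') (h₁ : σ.base ≍ τ.base)
    (h₂ : ∀ {a a'} h h' k k' (α : a ⟶ a') hα kα, σ.map h h' α hα ≍ τ.map k k' α kα) : σ ≍ τ := by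
  subst hs ht
  exact heq_of_eq (PiHom.ext' (eq_of_heq h₁) fun h h' α hα kα => eq_of_heq (h₂ h h' h h' α hα kα))

theorem PiObj.map_congr (s : PiObj hg f) {a a' : A} {h h'} {α α' : a ⟶ a'}
    {hα hα'} (e : α = α') : s.map h h' α hα = s.map h h' α' hα' := by
  subst e; rfl

theorem PiObj.map_inv (s : PiObj hg f) {a a' : A} (h : g.obj a = s.base) (h' : g.obj a' = s.base)
    (δ : a ⟶ a') (hδ : g.map δ ≍ 𝟙 s.base) (hδ' : g.map (Groupoid.inv δ) ≍ 𝟙 s.base) :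
    s.map h' h (Groupoid.inv δ) hδ' = Groupoid.inv (s.map h h' δ hδ) := by
  rw [← cancel_epi (s.map h h' δ hδ), Groupoid.comp_inv,
    ← s.map_comp h h' h _ _ hδ hδ' (over_comp_id h h' h hδ hδ'), ← s.map_id h (over_id g h)]
  exact s.map_congr (Groupoid.comp_inv _)

theorem PiHom.map_id_comp {s t : PiObj hg f} (σ : PiHom s t) {a a' a'' : A} (h : g.obj a = s.base)
    (h' : g.obj a' = s.base) (h'' : g.obj a'' = t.base) (δ : a ⟶ a') (α : a' ⟶ a'') (γ : a ⟶ a'')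
    (hδ : g.map δ ≍ 𝟙 s.base) (hα : g.map α ≍ σ.base) (hγ : g.map γ ≍ σ.base) (e : γ = δ ≫ α) :
    σ.map h h'' γ hγ = s.map h h' δ hδ ≫ σ.map h' h'' α hα := by
  subst e; exact σ.left ..

theorem PiHom.map_comp_id {s t : PiObj hg f} (σ : PiHom s t) {a a' a'' : A} (h : g.obj a = s.base)
    (h' : g.obj a' = t.base) (h'' : g.obj a'' = t.base) (α : a ⟶ a') (δ : a' ⟶ a'') (γ : a ⟶ a'')
    (hα : g.map α ≍ σ.base) (hδ : g.map δ ≍ 𝟙 t.base) (hγ : g.map γ ≍ σ.base) (e : γ = α ≫ δ) :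
    σ.map h h'' γ hγ = σ.map h h' α hα ≫ t.map h' h'' δ hδ := by
  subst e; exact σ.right ..

/-- Lifting `σ.base` from `a` produces the intermediate object; the remainder automatically lies
over `τ.base`. This is where composition in the dependent product needs `g` to be an isofibration.
-/
theorem PiHom.exists_factor {s t r : PiObj hg f} (σ : PiHom s t) (τ : PiHom t r) {a a' : A}
    (h : g.obj a = s.base) (h' : g.obj a' = r.base) (α : a ⟶ a')
    (hα : g.map α ≍ σ.base ≫ τ.base) :
    ∃ (a₀ : A) (α₀ : a ⟶ a₀) (α₁ : a₀ ⟶ a'), g.obj a₀ = t.base ∧ g.map α₀ ≍ σ.base ∧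
      g.map α₁ ≍ τ.base ∧ α = α₀ ≫ α₁ := by
  obtain ⟨a₀, α₀, h₀, e₀⟩ := hg.lift h σ.base
  exact ⟨a₀, α₀, Groupoid.inv α₀ ≫ α, h₀, e₀,
    by simpa using over_comp h₀ h h' (over_inv h h₀ e₀) hα, by simp⟩

/-- The composition of families of morphisms of a dependent product. -/
theorem PiHom.exists_compMap {s t r : PiObj hg f} (σ : PiHom s t) (τ : PiHom t r) {a a'' : A}
    (h : g.obj a = s.base) (h'' : g.obj a'' = r.base) (γ : a ⟶ a'')
    (hγ : g.map γ ≍ σ.base ≫ τ.base) :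
    ∃ m : s.obj a h ⟶ r.obj a'' h'', ∀ {a' : A} (h' : g.obj a' = t.base) (α : a ⟶ a')
      (α' : a' ⟶ a'') (hα : g.map α ≍ σ.base) (hα' : g.map α' ≍ τ.base), γ = α ≫ α' →
        m = σ.map h h' α hα ≫ τ.map h' h'' α' hα' := by
  obtain ⟨a₀, α₀, α₁, h₀, e₀, e₁, rfl⟩ := σ.exists_factor τ h h'' γ hγ
  refine ⟨σ.map h h₀ α₀ e₀ ≫ τ.map h₀ h'' α₁ e₁, fun {a'} h' α α' hα hα' e => ?_⟩
  -- Two factorizations differ by an arrow over an identity. The fields `right` of `σ` and `left` of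
  -- `τ` move its action across the composite, so the result does not depend on the choice.
  have hδ : g.map (Groupoid.inv α₀ ≫ α) ≍ 𝟙 t.base := by
    simpa using over_comp h₀ h h' (over_inv h h₀ e₀) hα
  rw [σ.map_comp_id h h₀ h' α₀ (Groupoid.inv α₀ ≫ α) α e₀ hδ hα (by simp),
    τ.map_id_comp h₀ h' h'' (Groupoid.inv α₀ ≫ α) α' α₁ hδ hα' e₁ (by simp [← e]), Category.assoc]

/-- The composition of families of morphisms of a dependent product. -/
noncomputable def PiHom.compMap {s t r : PiObj hg f} (σ : PiHom s t) (τ : PiHom t r) {a a' : A}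
    (h : g.obj a = s.base) (h' : g.obj a' = r.base) (α : a ⟶ a') (hα : g.map α ≍ σ.base ≫ τ.base) :
    s.obj a h ⟶ r.obj a' h' :=
  (σ.exists_compMap τ h h' α hα).choose

theorem PiHom.compMap_eq {s t r : PiObj hg f} (σ : PiHom s t) (τ : PiHom t r) {a a' a'' : A}
    (h : g.obj a = s.base) (h' : g.obj a' = t.base) (h'' : g.obj a'' = r.base) (α : a ⟶ a')
    (α' : a' ⟶ a'') (γ : a ⟶ a'') (hα : g.map α ≍ σ.base) (hα' : g.map α' ≍ τ.base)
    (hγ : g.map γ ≍ σ.base ≫ τ.base) (e : γ = α ≫ α') :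
    σ.compMap τ h h'' γ hγ = σ.map h h' α hα ≫ τ.map h' h'' α' hα' :=
  (σ.exists_compMap τ h h'' γ hγ).choose_spec h' α α' hα hα' e

/-- The identity of the dependent product. -/
def PiHom.id (s : PiObj hg f) : PiHom s s := ⟨𝟙 _, s.map, s.map_f, s.map_comp, s.map_comp⟩

/-- The composition of the dependent product. -/
noncomputable def PiHom.comp {s t r : PiObj hg f} (σ : PiHom s t) (τ : PiHom t r) : PiHom s r where
  base := σ.base ≫ τ.base
  map := σ.compMap τ
  map_f h h' α hα := by
    obtain ⟨a₀, α₀, α₁, h₀, e₀, e₁, rfl⟩ := σ.exists_factor τ h h' α hα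
    rw [σ.compMap_eq τ h h₀ h' α₀ α₁ _ e₀ e₁ _ rfl, f.map_comp]
    exact comp_heq_comp (s.obj_f _ _) (t.obj_f _ _) (r.obj_f _ _) (σ.map_f _ _ _ _)
      (τ.map_f _ _ _ _)
  left h h' h'' δ α hδ hα hα' := by
    obtain ⟨a₀, α₀, α₁, h₀, e₀, e₁, rfl⟩ := σ.exists_factor τ h' h'' α hα
    have e₂ : g.map (δ ≫ α₀) ≍ σ.base := over_id_comp h h' h₀ hδ e₀
    rw [σ.compMap_eq τ h' h₀ h'' α₀ α₁ _ e₀ e₁ _ rfl, ← Category.assoc (s.map h h' δ hδ),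
      ← σ.left h h' h₀ δ α₀ hδ e₀ e₂]
    exact σ.compMap_eq τ h h₀ h'' _ α₁ _ e₂ e₁ _ (Category.assoc _ _ _).symm
  right h h' h'' α δ hα hδ hα' := by
    obtain ⟨a₀, α₀, α₁, h₀, e₀, e₁, rfl⟩ := σ.exists_factor τ h h' α hα
    have e₂ : g.map (α₁ ≫ δ) ≍ τ.base := over_comp_id h₀ h' h'' e₁ hδ
    rw [σ.compMap_eq τ h h₀ h' α₀ α₁ _ e₀ e₁ _ rfl, Category.assoc (σ.map h h₀ α₀ e₀),
      ← τ.right h₀ h' h'' α₁ δ e₁ hδ e₂]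
    exact σ.compMap_eq τ h h₀ h'' α₀ _ _ e₀ e₂ _ (Category.assoc _ _ _)

/-- The inverses of the dependent product. -/
def PiHom.inv {s t : PiObj hg f} (σ : PiHom s t) : PiHom t s where
  base := Groupoid.inv σ.base
  map h h' α hα := Groupoid.inv (σ.map h' h (Groupoid.inv α) (by simpa using over_inv h h' hα))
  map_f h h' α hα := by
    rw [map_groupoidInv]
    simpa using inv_heq_inv (s.obj_f _ _) (t.obj_f _ _) (σ.map_f h' h (Groupoid.inv α) (by
      simpa using over_inv h h' hα))
  left h h' h'' δ α hδ hα hα' := by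
    have e₁ : g.map (Groupoid.inv δ) ≍ 𝟙 t.base := over_inv_id h h' hδ
    have e₂ : g.map (Groupoid.inv α) ≍ σ.base := by simpa using over_inv h' h'' hα
    rw [σ.map_comp_id h'' h' h (Groupoid.inv α) (Groupoid.inv δ) (Groupoid.inv (δ ≫ α)) e₂ e₁ _
      (by simp), t.map_inv h h' δ hδ]
    simp
  right h h' h'' α δ hα hδ hα' := by
    have e₁ : g.map (Groupoid.inv δ) ≍ 𝟙 s.base := over_inv_id h' h'' hδ
    have e₂ : g.map (Groupoid.inv α) ≍ σ.base := by simpa using over_inv h h' hα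
    rw [σ.map_id_comp h'' h' h (Groupoid.inv δ) (Groupoid.inv α) (Groupoid.inv (α ≫ δ)) e₁ e₂ _
      (by simp), s.map_inv h' h'' δ hδ]
    simp

noncomputable instance : Groupoid.{w} (PiObj hg f) where
  Hom s t := PiHom s t
  id s := PiHom.id s
  comp σ τ := PiHom.comp σ τ
  inv σ := PiHom.inv σ
  id_comp {s t} σ := by
    refine PiHom.ext' (Category.id_comp _) fun h h' α hα kα => ?_
    obtain ⟨a₀, α₀, α₁, h₀, e₀, e₁, rfl⟩ := (PiHom.id s).exists_factor σ h h' α hα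
    exact ((PiHom.id s).compMap_eq σ h h₀ h' α₀ α₁ _ e₀ e₁ hα rfl).trans (σ.left ..).symm
  comp_id {s t} σ := by
    refine PiHom.ext' (Category.comp_id _) fun h h' α hα kα => ?_
    obtain ⟨a₀, α₀, α₁, h₀, e₀, e₁, rfl⟩ := σ.exists_factor (PiHom.id t) h h' α hα
    exact (σ.compMap_eq (PiHom.id t) h h₀ h' α₀ α₁ _ e₀ e₁ hα rfl).trans (σ.right ..).symm
  assoc {s t r q} σ τ ρ := by
    refine PiHom.ext' (Category.assoc _ _ _) fun {a a'} h h' α hα kα => ?_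
    obtain ⟨a₂, β, α₂, h₂, e, e₂, rfl⟩ := (σ.comp τ).exists_factor ρ h h' α hα
    obtain ⟨a₁, α₀, α₁, h₁, e₀, e₁, rfl⟩ := σ.exists_factor τ h h₂ β e
    have e₃ : g.map (α₁ ≫ α₂) ≍ τ.base ≫ ρ.base := over_comp h₁ h₂ h' e₁ e₂
    refine ((σ.comp τ).compMap_eq ρ h h₂ h' _ α₂ _ e e₂ hα rfl).trans ?_
    refine Eq.trans ?_ (σ.compMap_eq (τ.comp ρ) h h₁ h' α₀ (α₁ ≫ α₂) _ e₀ e₃ kα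
      (Category.assoc _ _ _)).symm
    refine (congrArg (· ≫ _) (σ.compMap_eq τ h h₁ h₂ α₀ α₁ _ e₀ e₁ e rfl)).trans ?_
    exact (Category.assoc _ _ _).trans (congrArg (_ ≫ ·)
      (τ.compMap_eq ρ h₁ h₂ h' α₁ α₂ _ e₁ e₂ e₃ rfl).symm)
  inv_comp {s t} σ := by
    refine PiHom.ext' (Groupoid.inv_comp _) fun h h' α hα kα => ?_
    obtain ⟨a₀, α₀, α₁, h₀, e₀, e₁, rfl⟩ := σ.inv.exists_factor σ h h' α hα
    have e₂ : g.map (Groupoid.inv α₀) ≍ σ.base := by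
      simpa [PiHom.inv] using over_inv h h₀ e₀
    refine (σ.inv.compMap_eq σ h h₀ h' α₀ α₁ _ e₀ e₁ hα rfl).trans ?_
    rw [σ.map_comp_id h₀ h h' (Groupoid.inv α₀) (α₀ ≫ α₁) α₁ e₂ kα e₁ (by simp)]
    exact (Category.assoc _ _ _).symm.trans
      ((congrArg (· ≫ _) (Groupoid.inv_comp _)).trans (Category.id_comp _))
  comp_inv {s t} σ := by
    refine PiHom.ext' (Groupoid.comp_inv _) fun h h' α hα kα => ?_
    obtain ⟨a₀, α₀, α₁, h₀, e₀, e₁, rfl⟩ := σ.exists_factor σ.inv h h' α hα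
    have e₂ : g.map (Groupoid.inv α₁) ≍ σ.base := by
      simpa [PiHom.inv] using over_inv h₀ h' e₁
    refine (σ.compMap_eq σ.inv h h₀ h' α₀ α₁ _ e₀ e₁ hα rfl).trans ?_
    rw [σ.map_id_comp h h' h₀ (α₀ ≫ α₁) (Groupoid.inv α₁) α₀ kα e₂ e₀ (by simp)]
    exact (Category.assoc _ _ _).trans
      ((congrArg (_ ≫ ·) (Groupoid.comp_inv _)).trans (Category.comp_id _))

variable (hg f)

/-- The projection of the dependent product to the base. -/
def PiObj.proj : PiObj hg f ⥤ B where
  obj s := s.base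
  map σ := PiHom.base σ
  map_id _ := rfl
  map_comp _ _ := rfl

/-- The evaluation map of the dependent product. -/
noncomputable def PiObj.ev : Pullback (PiObj.proj hg f) g ⥤ X where
  obj s := s.fst.obj s.snd s.eq.symm
  map σ := PiHom.map σ.fst _ _ σ.snd σ.eq.symm
  map_id s := s.fst.map_id _ _
  map_comp σ τ := PiHom.compMap_eq _ _ _ _ _ _ _ _ _ _ (Pullback.Hom.eq (σ ≫ τ)).symm rfl

theorem PiObj.ev_comp : PiObj.ev hg f ⋙ f = Pullback.sndFunctor (PiObj.proj hg f) g :=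
  Functor.hext (fun s => PiObj.obj_f s.fst s.snd s.eq.symm)
    fun _ _ σ => PiHom.map_f σ.fst _ _ σ.snd σ.eq.symm

variable {hg f}

/-- The transpose of a morphism from a pullback. -/
noncomputable def PiObj.transpose (h : Y ⥤ B) (v : Pullback h g ⥤ X)
    (hv : v ⋙ f = Pullback.sndFunctor h g) : Y ⥤ PiObj hg f where
  obj y :=
    { base := h.obj y
      obj := fun a e => v.obj ⟨y, a, e.symm⟩
      obj_f := fun a e => Functor.congr_obj hv _
      map := fun {a a'} e e' α hα => v.map (X := ⟨y, a, e.symm⟩) (Y := ⟨y, a', e'.symm⟩)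
        ⟨𝟙 y, α, (heq_of_eq (h.map_id y)).trans hα.symm⟩
      map_f := fun _ _ _ _ => Functor.hcongr_hom hv _
      map_id := fun _ _ => v.map_id _
      map_comp := fun _ _ _ α α' _ _ _ => by
        refine Eq.trans ?_ (v.map_comp _ _)
        congr 1
        exact Pullback.Hom.ext (Category.comp_id _).symm rfl }
  map {y y'} φ :=
    { base := h.map φ
      map := fun {a a'} e e' α hα => v.map (X := ⟨y, a, e.symm⟩) (Y := ⟨y', a', e'.symm⟩)
        ⟨φ, α, hα.symm⟩
      map_f := fun _ _ _ _ => Functor.hcongr_hom hv _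
      left := fun _ _ _ α α' _ _ _ => by
        refine Eq.trans ?_ (v.map_comp _ _)
        congr 1
        exact Pullback.Hom.ext (Category.id_comp _).symm rfl
      right := fun _ _ _ α α' _ _ _ => by
        refine Eq.trans ?_ (v.map_comp _ _)
        congr 1
        exact Pullback.Hom.ext (Category.comp_id _).symm rfl }
  map_id y := PiHom.ext' (h.map_id y) fun _ _ _ _ _ => rfl
  map_comp {y y' y''} φ ψ := by
    refine PiHom.ext' (h.map_comp _ _) fun {a a'} e e' α hα kα => ?_
    obtain ⟨a₀, α₀, α₁, h₀, e₀, e₁, rfl⟩ := PiHom.exists_factor _ _ e e' α kα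
    refine Eq.trans ?_ (PiHom.compMap_eq _ _ e h₀ e' α₀ α₁ _ e₀ e₁ kα rfl).symm
    exact v.map_comp (X := ⟨y, a, e.symm⟩) (Y := ⟨y', a₀, h₀.symm⟩) (Z := ⟨y'', a', e'.symm⟩)
      ⟨φ, α₀, e₀.symm⟩ ⟨ψ, α₁, e₁.symm⟩

section

variable {k : Y ⥤ PiObj hg f} {h : Y ⥤ B} {m : Pullback h g ⥤ Pullback (PiObj.proj hg f) g}

/-- The two projections leave no freedom in `m`, so evaluating after `m` reads off the values of the
sections given by `k`. -/
theorem PiObj.obj_eq_ev (e : k ⋙ PiObj.proj hg f = h)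
    (h₁ : m ⋙ Pullback.fstFunctor _ _ = Pullback.fstFunctor h g ⋙ k)
    (h₂ : m ⋙ Pullback.sndFunctor _ _ = Pullback.sndFunctor h g) (y : Y) (a : A)
    (hs : g.obj a = (k.obj y).base) :
    m.obj ⟨y, a, (Functor.congr_obj e y).symm.trans hs.symm⟩ = ⟨k.obj y, a, hs.symm⟩ :=
  Pullback.ext (Functor.congr_obj h₁ _) (Functor.congr_obj h₂ _)

theorem PiObj.map_heq_ev (e : k ⋙ PiObj.proj hg f = h)
    (h₁ : m ⋙ Pullback.fstFunctor _ _ = Pullback.fstFunctor h g ⋙ k)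
    (h₂ : m ⋙ Pullback.sndFunctor _ _ = Pullback.sndFunctor h g) {y y' : Y} (φ : y ⟶ y') {a a' : A}
    (hs : g.obj a = (k.obj y).base) (hs' : g.obj a' = (k.obj y').base) (α : a ⟶ a')
    (hα : g.map α ≍ PiHom.base (k.map φ)) :
    m.map (X := ⟨y, a, (Functor.congr_obj e y).symm.trans hs.symm⟩)
      (Y := ⟨y', a', (Functor.congr_obj e y').symm.trans hs'.symm⟩)
      ⟨φ, α, (Functor.hcongr_hom e φ).symm.trans hα.symm⟩ ≍
    (⟨k.map φ, α, hα.symm⟩ : Pullback.Hom (F := PiObj.proj hg f) (G := g)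
      ⟨k.obj y, a, hs.symm⟩ ⟨k.obj y', a', hs'.symm⟩) :=
  (Pullback.isStrictPullback (PiObj.proj hg f) g).map_heq_ext
    (ω' := (⟨k.map φ, α, hα.symm⟩ : Pullback.Hom (F := PiObj.proj hg f) (G := g)
      ⟨k.obj y, a, hs.symm⟩ ⟨k.obj y', a', hs'.symm⟩)) (obj_eq_ev e h₁ h₂ y a hs)
    (obj_eq_ev e h₁ h₂ y' a' hs') (Functor.hcongr_hom h₁ _) (Functor.hcongr_hom h₂ _)

/-- Uniqueness of transposes: all components of the sections and of their morphisms are recovered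
from the composite with the evaluation map. -/
theorem PiObj.functor_ext {k' : Y ⥤ PiObj hg f} (e : k ⋙ PiObj.proj hg f = h)
    (e' : k' ⋙ PiObj.proj hg f = h) {m' : Pullback h g ⥤ Pullback (PiObj.proj hg f) g}
    (h₁ : m ⋙ Pullback.fstFunctor _ _ = Pullback.fstFunctor h g ⋙ k)
    (h₁' : m' ⋙ Pullback.fstFunctor _ _ = Pullback.fstFunctor h g ⋙ k')
    (h₂ : m ⋙ Pullback.sndFunctor _ _ = Pullback.sndFunctor h g)
    (h₂' : m' ⋙ Pullback.sndFunctor _ _ = Pullback.sndFunctor h g)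
    (h₃ : m ⋙ PiObj.ev hg f = m' ⋙ PiObj.ev hg f) : k = k' := by
  have hbase : ∀ y, (k.obj y).base = (k'.obj y).base := fun y =>
    (Functor.congr_obj e y).trans (Functor.congr_obj e' y).symm
  have hobj : ∀ y a hs hs', (k.obj y).obj a hs = (k'.obj y).obj a hs' := fun y a hs hs' =>
    ((congrArg (PiObj.ev hg f).obj (obj_eq_ev e h₁ h₂ y a hs)).symm.trans
      (Functor.congr_obj h₃ _)).trans (congrArg (PiObj.ev hg f).obj (obj_eq_ev e' h₁' h₂' y a hs'))
  have hmap : ∀ {y y'} (φ : y ⟶ y') {a a'} hs hs' ks ks' (α : a ⟶ a') hα kα,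
      PiHom.map (k.map φ) hs hs' α hα ≍ PiHom.map (k'.map φ) ks ks' α kα :=
    fun {y y'} φ {a a'} hs hs' ks ks' α hα kα =>
    ((map_heq_map (PiObj.ev hg f) (obj_eq_ev e h₁ h₂ _ a hs) (obj_eq_ev e h₁ h₂ _ a' hs')
      (map_heq_ev e h₁ h₂ φ hs hs' α hα)).symm.trans (Functor.hcongr_hom h₃ _)).trans
      (map_heq_map (PiObj.ev hg f) (obj_eq_ev e' h₁' h₂' _ a ks) (obj_eq_ev e' h₁' h₂' _ a' ks')
      (map_heq_ev e' h₁' h₂' φ ks ks' α kα))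
  have hk : ∀ y, k.obj y = k'.obj y := fun y =>
    PiObj.ext_heq (hbase y) (hobj y) fun {a a'} hs hs' ks ks' α hα kα => by
      -- The action of a section on arrows of the fibre is the family underlying its identity
      -- morphism, so the comparison of morphisms at `𝟙 y` covers it.
      have i₁ : PiHom.id (k.obj y) = k.map (𝟙 y) := (k.map_id y).symm
      have i₂ : PiHom.id (k'.obj y) = k'.map (𝟙 y) := (k'.map_id y).symm
      have := hmap (𝟙 y) hs hs' ks ks' α (by rw [← i₁]; exact hα) (by rw [← i₂]; exact kα)
      simp only [← i₁, ← i₂] at this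
      exact this
  exact Functor.hext hk fun y y' φ => PiHom.ext_heq (hk y) (hk y')
    ((Functor.hcongr_hom e φ).trans (Functor.hcongr_hom e' φ).symm) (hmap φ)

end

/-- The transpose of a morphism from a pullback, on the pullback. -/
noncomputable def PiObj.transposePullback (h : Y ⥤ B) (v : Pullback h g ⥤ X)
    (hv : v ⋙ f = Pullback.sndFunctor h g) : Pullback h g ⥤ Pullback (PiObj.proj hg f) g where
  obj y := ⟨(PiObj.transpose h v hv).obj y.fst, y.snd, y.eq⟩
  map φ := ⟨(PiObj.transpose h v hv).map φ.fst, φ.snd, φ.eq⟩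
  map_id _ := Pullback.Hom.ext ((PiObj.transpose h v hv).map_id _) rfl
  map_comp _ _ := Pullback.Hom.ext ((PiObj.transpose h v hv).map_comp _ _) rfl

end DependentProducts

section

variable {C : Type u} [Category.{v} C]

/-- The universal property of a dependent product may be tested on one pullback of each morphism. -/
theorem IsPi.of_exists {A B X P P' : C} {g : A ⟶ B} {f : X ⟶ A} {q : P ⟶ B} {fst : P' ⟶ P}
    {snd : P' ⟶ A} {ev : P' ⟶ X} (h₁ : IsPullback fst snd q g) (h₂ : ev ≫ f = snd)
    (h₃ : ∀ {Y : C} (h : Y ⟶ B), ∃ (Y' : C) (y₁ : Y' ⟶ Y) (y₂ : Y' ⟶ A), IsPullback y₁ y₂ h g ∧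
      ∀ v : Y' ⟶ X, v ≫ f = y₂ → ∃! k : Y ⟶ P, k ≫ q = h ∧
        ∃ k' : Y' ⟶ P', k' ≫ fst = y₁ ≫ k ∧ k' ≫ snd = y₂ ∧ k' ≫ ev = v) :
    IsPi g f q fst snd ev where
  isPullback := h₁
  ev_comp := h₂
  existsUnique {Y Y'} h y₁ y₂ H v hv := by
    obtain ⟨Z, z₁, z₂, H', hZ⟩ := h₃ h
    let e := H.isoIsPullback _ _ H'
    have e₁ : e.hom ≫ z₁ = y₁ := H.isoIsPullback_hom_fst _ _ H'
    have e₂ : e.hom ≫ z₂ = y₂ := H.isoIsPullback_hom_snd _ _ H'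
    have e₃ : e.inv ≫ y₁ = z₁ := H.isoIsPullback_inv_fst _ _ H'
    have e₄ : e.inv ≫ y₂ = z₂ := H.isoIsPullback_inv_snd _ _ H'
    obtain ⟨k, ⟨hk, k', hk₁, hk₂, hk₃⟩, hu⟩ := hZ (e.inv ≫ v) (by rw [Category.assoc, hv, e₄])
    refine ⟨k, ⟨hk, e.hom ≫ k', ?_, ?_, ?_⟩, ?_⟩
    · rw [Category.assoc, hk₁, ← Category.assoc, e₁]
    · rw [Category.assoc, hk₂, e₂]
    · rw [Category.assoc, hk₃, e.hom_inv_id_assoc]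
    · rintro l ⟨hl, l', hl₁, hl₂, hl₃⟩
      refine hu l ⟨hl, e.inv ≫ l', ?_, ?_, ?_⟩
      · rw [Category.assoc, hl₁, ← Category.assoc, e₃]
      · rw [Category.assoc, hl₂, e₄]
      · rw [Category.assoc, hl₃]

end

/-- The dependent product of groupoids. -/
theorem PiObj.isPi {A B X : Grpd.{w, w}} (g : A ⟶ B) (f : X ⟶ A)
    (hg : IsIsofibration (X := A) (Y := B) g) :
    IsPi (P := Grpd.of (PiObj (A := A) (B := B) (X := X) hg f))
      (P' := Grpd.of (Pullback (X := PiObj (A := A) (B := B) (X := X) hg f) (Y := A) (Z := B)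
        (PiObj.proj hg f) g)) g f (PiObj.proj (A := A) (B := B) (X := X) hg f)
      (Pullback.fstFunctor (Y := A) (Z := B) _ g) (Pullback.sndFunctor (Y := A) (Z := B) _ g)
      (PiObj.ev (A := A) (B := B) (X := X) hg f) :=
  IsPi.of_exists (IsStrictPullback.isPullback (Pullback.isStrictPullback _ _))
    (PiObj.ev_comp (A := A) (B := B) (X := X) hg f) fun {Y} h =>
    ⟨Grpd.of (Pullback (X := Y) (Y := A) (Z := B) h g),
      Pullback.fstFunctor (X := Y) (Y := A) (Z := B) h g,
      Pullback.sndFunctor (X := Y) (Y := A) (Z := B) h g,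
      IsStrictPullback.isPullback (Pullback.isStrictPullback _ _), fun v hv =>
      ⟨PiObj.transpose (A := A) (B := B) (X := X) (Y := Y) h v hv,
        ⟨rfl, PiObj.transposePullback (A := A) (B := B) (X := X) (Y := Y) h v hv, rfl, rfl, rfl⟩,
        fun _ ⟨hk, k', hk₁, hk₂, hk₃⟩ =>
          PiObj.functor_ext (A := A) (B := B) (X := X) (Y := Y) (h := h) (m := k')
            (m' := PiObj.transposePullback (A := A) (B := B) (X := X) (Y := Y) h v hv)
            hk rfl hk₁ rfl hk₂ rfl hk₃⟩⟩

/-! ### Dependent products with involution, and the type-theoretic fibration category. -/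

namespace InvGrpd

/-- The involution as an automorphism. -/
def invIso (A : InvGrpd.{w}) : A.carrier ≅ A.carrier := ⟨A.inv, A.inv, A.inv_inv, A.inv_inv⟩

/-- Twisting a pullback square of groupoids by involutions. -/
theorem isPullback_twist {P' P : Grpd.{w, w}} {A B : InvGrpd.{w}} {p : P' ⟶ P}
    {q : P' ⟶ A.carrier} {r : P ⟶ B.carrier} {g : A ⟶ B} (h : IsPullback p q r g.functor) :
    IsPullback p (q ≫ A.inv) (r ≫ B.inv) g.functor :=
  h.of_iso (Iso.refl _) (Iso.refl _) A.invIso B.invIso (by simp) (by simp [invIso])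
    (by simp [invIso]) g.comm.symm

theorem isPullback_forget {W X Y Z : InvGrpd.{w}} {p : W ⟶ X} {q : W ⟶ Y} {f : X ⟶ Z} {g : Y ⟶ Z}
    (h : IsPullback p q f g) : IsPullback p.functor q.functor f.functor g.functor :=
  IsStrictPullback.isPullback (strict_of_isPullback h)

/-- A dependent product of the underlying groupoids carries an involution, and is then a dependent
product of groupoids with involution. -/
theorem exists_isPi_of_forget {A B X : InvGrpd.{w}} {g : A ⟶ B} {f : X ⟶ A}
    {P P' : Grpd.{w, w}} {q : P ⟶ B.carrier} {fst : P' ⟶ P} {snd : P' ⟶ A.carrier}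
    {ev : P' ⟶ X.carrier} (H : IsPi g.functor f.functor q fst snd ev) :
    ∃ (τ : P ⟶ P) (hτ : τ ≫ τ = 𝟙 P) (τ' : P' ⟶ P') (hτ' : τ' ≫ τ' = 𝟙 P')
      (hq : τ ≫ q = q ≫ B.inv) (hfst : τ' ≫ fst = fst ≫ τ) (hsnd : τ' ≫ snd = snd ≫ A.inv)
      (hev : τ' ≫ ev = ev ≫ X.inv),
      IsPi (P := ⟨P, τ, hτ⟩) (P' := ⟨P', τ', hτ'⟩) g f ⟨q, hq⟩ ⟨fst, hfst⟩ ⟨snd, hsnd⟩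
        ⟨ev, hev⟩ := by
  -- The involution is the transpose of `ev ≫ X.inv` over the defining square twisted by the
  -- involutions of `A` and `B`.
  obtain ⟨τ, ⟨hq, τ', hfst, hsnd, hev⟩, -⟩ := H.existsUnique (q ≫ B.inv) fst (snd ≫ A.inv)
    (isPullback_twist H.isPullback) (ev ≫ X.inv) (by
      rw [Category.assoc, f.comm, ← Category.assoc, H.ev_comp])
  -- Both sides are transposes of `ev` itself.
  have hτ : τ ≫ τ = 𝟙 P := by
    refine (H.existsUnique q fst snd H.isPullback ev H.ev_comp).unique
      ⟨?_, τ' ≫ τ', ?_, ?_, ?_⟩ ⟨by simp, 𝟙 _, by simp, by simp, by simp⟩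
    · rw [Category.assoc, hq, ← Category.assoc, hq, Category.assoc, B.inv_inv, Category.comp_id]
    · rw [Category.assoc, hfst, ← Category.assoc, hfst, Category.assoc]
    · rw [Category.assoc, hsnd, ← Category.assoc, hsnd, Category.assoc, A.inv_inv,
        Category.comp_id]
    · rw [Category.assoc, hev, ← Category.assoc, hev, Category.assoc, X.inv_inv,
        Category.comp_id]
  have hτ' : τ' ≫ τ' = 𝟙 P' := by
    refine H.isPullback.hom_ext ?_ ?_
    · rw [Category.assoc, hfst, ← Category.assoc, hfst, Category.assoc, hτ]; simp
    · rw [Category.assoc, hsnd, ← Category.assoc, hsnd, Category.assoc, A.inv_inv]; simp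
  refine ⟨τ, hτ, τ', hτ', hq, hfst, hsnd, hev, ?_, hom_ext H.ev_comp, ?_⟩
  · exact isPullback_of_strict (isStrictPullback_of_isPullback H.isPullback)
  intro Y Y' h y₁ y₂ hY v hv
  have hY' := isPullback_forget hY
  have hv' : v.functor ≫ f.functor = y₂.functor := congrArg Hom.functor hv
  obtain ⟨k, ⟨hk, k', hk₁, hk₂, hk₃⟩, hu⟩ := H.existsUnique h.functor y₁.functor y₂.functor hY'
    v.functor hv'
  -- Equivariance of the transpose again follows from uniqueness: both sides transpose `v.functor ≫
  -- X.inv` over the twisted square.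
  have hkτ : Y.inv ≫ k = k ≫ τ := by
    refine (H.existsUnique (h.functor ≫ B.inv) y₁.functor (y₂.functor ≫ A.inv)
      (isPullback_twist hY') (v.functor ≫ X.inv)
      (by rw [Category.assoc, f.comm, ← Category.assoc, hv'])).unique
      ⟨?_, Y'.inv ≫ k', ?_, ?_, ?_⟩ ⟨?_, k' ≫ τ', ?_, ?_, ?_⟩
    · rw [Category.assoc, hk, h.comm]
    · rw [Category.assoc, hk₁, ← Category.assoc, y₁.comm, Category.assoc]
    · rw [Category.assoc, hk₂, y₂.comm]
    · rw [Category.assoc, hk₃, v.comm]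
    · rw [Category.assoc, hq, ← Category.assoc, hk]
    · rw [Category.assoc, hfst, ← Category.assoc, hk₁, Category.assoc]
    · rw [Category.assoc, hsnd, ← Category.assoc, hk₂]
    · rw [Category.assoc, hev, ← Category.assoc, hk₃]
  have hkτ' : Y'.inv ≫ k' = k' ≫ τ' := by
    refine H.isPullback.hom_ext ?_ ?_
    · rw [Category.assoc, hk₁, ← Category.assoc, y₁.comm, Category.assoc, hkτ, Category.assoc,
        hfst, ← Category.assoc k', hk₁, Category.assoc]
    · rw [Category.assoc, hk₂, y₂.comm, Category.assoc, hsnd, ← Category.assoc, hk₂]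
  refine ⟨⟨k, hkτ⟩, ⟨hom_ext hk, ⟨k', hkτ'⟩, hom_ext hk₁, hom_ext hk₂, hom_ext hk₃⟩, ?_⟩
  rintro l ⟨hl, l', hl₁, hl₂, hl₃⟩
  exact hom_ext (hu l.functor ⟨congrArg Hom.functor hl, l'.functor, congrArg Hom.functor hl₁,
    congrArg Hom.functor hl₂, congrArg Hom.functor hl₃⟩)

/-- Dependent products of fibrations along fibrations are fibrations. -/
theorem fibrations_of_isPi {A B X P P' : InvGrpd.{w}} {g : A ⟶ B} {f : X ⟶ A} {q : P ⟶ B}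
    {fst : P' ⟶ P} {snd : P' ⟶ A} {ev : P' ⟶ X} (H : IsPi g f q fst snd ev)
    (hg : IsIsofibration (under g)) (hf : fibrations f) : fibrations q :=
  fun K L i hi => ⟨fun {s t} sq => by
    -- The lifting problem of `i` against `q` is transposed into one of `j` against `f`, where `j`
    -- is the pullback of `i` to `A`. It remains a trivial cofibration because it is a pullback
    -- along an isofibration.
    obtain ⟨L', l₁, l₂, hL⟩ := exists_strict_pullback t g
    obtain ⟨K', c, j, hK⟩ := exists_strict_pullback i l₁
    have : (under i).IsEquivalence := hi.2
    have hj : trivialCofibrations j :=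
      ⟨hK.obj_injective hi.1, hK.isEquivalence (hL.flip.isIsofibration hg)⟩
    replace hL := isPullback_of_strict hL
    replace hK := isPullback_of_strict hK
    have hKL : IsPullback c (j ≫ l₂) (i ≫ t) g := (hK.flip.paste_horiz hL.flip).flip
    obtain ⟨m, hm₁, hm₂⟩ := H.isPullback.exists_lift (c ≫ s) (j ≫ l₂) (by
      rw [Category.assoc, sq.w, hKL.w])
    have sq' : CommSq (m ≫ ev) j f l₂ := ⟨by rw [Category.assoc, H.ev_comp, hm₂]⟩
    have := hf _ hj
    obtain ⟨k, ⟨hk, k', hk₁, hk₂, hk₃⟩, -⟩ := H.existsUnique t l₁ l₂ hL sq'.lift sq'.fac_right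
    refine ⟨⟨⟨k, ?_, hk⟩⟩⟩
    refine (H.existsUnique (i ≫ t) c (j ≫ l₂) hKL (m ≫ ev) sq'.w).unique
      ⟨by rw [Category.assoc, hk], j ≫ k', ?_, ?_, ?_⟩ ⟨sq.w, m, hm₁, hm₂, rfl⟩
    · rw [Category.assoc, hk₁, ← Category.assoc, ← hK.w, Category.assoc]
    · rw [Category.assoc, hk₂]
    · rw [Category.assoc, hk₃, sq'.fac_left]⟩

theorem isPi_of_hom {A B X P P' : Fibrant.{w}} {g : A ⟶ B} {f : X ⟶ A} {q : P ⟶ B}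
    {fst : P' ⟶ P} {snd : P' ⟶ A} {ev : P' ⟶ X} (hg : fibrantFibrations g)
    (H : IsPi g.hom f.hom q.hom fst.hom snd.hom ev.hom) : IsPi g f q fst snd ev where
  isPullback := Fibrant.isPullback_of_hom H.isPullback
  ev_comp := ObjectProperty.hom_ext _ H.ev_comp
  existsUnique {Y Y'} h y₁ y₂ hY v hv := by
    obtain ⟨k, ⟨hk, k', hk₁, hk₂, hk₃⟩, hu⟩ := H.existsUnique h.hom y₁.hom y₂.hom
      (Fibrant.isPullback_hom hY.flip hg).flip v.hom (congrArg (·.hom) hv)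
    refine ⟨ObjectProperty.homMk k, ⟨ObjectProperty.hom_ext _ hk, ObjectProperty.homMk k',
      ObjectProperty.hom_ext _ hk₁, ObjectProperty.hom_ext _ hk₂, ObjectProperty.hom_ext _ hk₃⟩, ?_⟩
    rintro l ⟨hl, l', hl₁, hl₂, hl₃⟩
    exact ObjectProperty.hom_ext _ (hu l.hom ⟨congrArg (·.hom) hl, l'.hom, congrArg (·.hom) hl₁,
      congrArg (·.hom) hl₂, congrArg (·.hom) hl₃⟩)

/-- Dependent products of fibrations between fibrant objects, with their explicit underlying
groupoids. -/
theorem exists_isPi {A B X : Fibrant.{w}} (g : A ⟶ B) (f : X ⟶ A) (hg : fibrantFibrations g)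
    (hf : fibrantFibrations f) :
    ∃ (hg' : IsIsofibration (under g.hom)) (P P' : Fibrant.{w}) (q : P ⟶ B) (fst : P' ⟶ P)
      (snd : P' ⟶ A) (ev : P' ⟶ X), fibrantFibrations q ∧ IsPi g f q fst snd ev ∧
        ∀ M : ∀ Q : Grpd.{w, w}, (Q ⥤ B.obj.carrier) → Prop,
          M (Grpd.of (PiObj hg' (under f.hom))) (PiObj.proj hg' (under f.hom)) →
            M P.obj.carrier (under q.hom) := by
  have hg' := isIsofibration_of_fibrations hg
  obtain ⟨τ, hτ, τ', hτ', hq, hfst, hsnd, hev, H⟩ :=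
    exists_isPi_of_forget (PiObj.isPi g.hom.functor f.hom.functor hg')
  have hq' := fibrations_of_isPi H hg' hf
  have hP := isFibrant_of_fibrations hq' B.property
  have hP' := isFibrant_of_fibrations (fibrations_of_isPullback H.isPullback.flip hg) hP
  -- The underlying projection is the explicit one by construction, so the clause that transfers an
  -- arbitrary property `M` is the identity implication.
  exact ⟨hg', ⟨_, hP⟩, ⟨_, hP'⟩, ObjectProperty.homMk _, ObjectProperty.homMk _,
    ObjectProperty.homMk _, ObjectProperty.homMk _, hq', isPi_of_hom hg H, fun _ h => h⟩

theorem fibrations_of_isIso {X Y : InvGrpd.{w}} (f : X ⟶ Y) [IsIso f] : fibrations f :=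
  MorphismProperty.rlp_of_isIso _ f

theorem isFibrant_one : IsFibrant one.{w} := by
  have : toOne one.{w} = 𝟙 _ := isTerminalOne.hom_ext _ _
  change fibrations (toOne one)
  rw [this]
  exact fibrations_of_isIso _

/-- The terminal fibrant object. -/
def Fibrant.isTerminalOne : IsTerminal (⟨one, isFibrant_one⟩ : Fibrant.{w}) :=
  IsTerminal.ofUniqueHom (fun X => ObjectProperty.homMk (toOne X.obj))
    fun _ _ => ObjectProperty.hom_ext _ (InvGrpd.isTerminalOne.hom_ext _ _)

/-- The injectively fibrant groupoids with involution form a type-theoretic fibration category. -/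
theorem isTypeTheoreticFibrationCategory :
    IsTypeTheoreticFibrationCategory fibrantFibrations.{w} where
  hasTerminal := Fibrant.isTerminalOne.hasTerminal
  comp f g hf hg := MorphismProperty.comp_mem fibrations _ _ hf hg
  of_isIso {X Y} f hf := by
    have : IsIso f.hom := inferInstanceAs (IsIso (IsFibrant.ι.map f))
    exact fibrations_of_isIso f.hom
  to_terminal {X T} f hT := by
    obtain ⟨hT⟩ := hT
    let e := Fibrant.isTerminalOne.uniqueUpToIso hT
    have : f = ObjectProperty.homMk (toOne X.obj) ≫ e.hom := hT.hom_ext _ _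
    have he : IsIso e.hom.hom := inferInstanceAs (IsIso (IsFibrant.ι.map e.hom))
    rw [this]
    exact MorphismProperty.comp_mem fibrations _ _ X.property (fibrations_of_isIso e.hom.hom)
  exists_pullback f g hf := Fibrant.exists_pullback f g hf
  pullback _ _ _ _ h hf := fibrations_of_isPullback (Fibrant.isPullback_hom h hf) hf
  exists_pi g f hg hf := by
    obtain ⟨-, P, P', q, fst, snd, ev, hq, H, -⟩ := exists_isPi g f hg hf
    exact ⟨P, P', q, fst, snd, ev, hq, H⟩
  factorization f := by
    obtain ⟨E, -, -, j, q, -, -, -, hj, hq, h⟩ := Fibrant.exists_factorization f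
    exact ⟨E, j, q, hj, hq, h⟩
  acyclic_pullback i b z j y xA yB hb hib hi h₁ h₂ := by
    have h₂' := (Fibrant.isPullback_hom h₂.flip hb).flip
    -- The square over `i` cannot be transferred directly, as `i` need not be a fibration. It is
    -- recovered from the pasted rectangle, which lies over the fibration `i ≫ b`.
    have h₁' := IsPullback.of_right
      (Fibrant.isPullback_hom (h₁.paste_horiz h₂).flip hib).flip (congrArg (·.hom) h₁.w) h₂'
    exact Fibrant.llp_of_trivialCofibrations (trivialCofibrations_of_isPullback
      (Fibrant.trivialCofibrations_of_llp hi) (isIsofibration_of_fibrations hib) h₁' h₂')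

end InvGrpd

/-! ### Morphisms to `UΔ` as families of sets, and fibrancy of `UΔ`. -/

section Codes

variable {κ : Cardinal.{u}}

theorem UObj.ext_heq {A B : UObj κ} (h₀ : A.A₀ = B.A₀) (h₁ : A.A₁ = B.A₁)
    (hχ : ∀ (a : A.A₀.1) (b : B.A₀.1), a ≍ b → A.χ a ≍ B.χ b) : A = B := by
  obtain ⟨A₀, A₁, χ⟩ := A
  obtain ⟨B₀, B₁, ψ⟩ := B
  obtain rfl : A₀ = B₀ := h₀
  obtain rfl : A₁ = B₁ := h₁
  obtain rfl : χ = ψ := Equiv.ext fun a => eq_of_heq (hχ a a HEq.rfl)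
  rfl

theorem UHom.ext_ρ₀ {A B : UObj κ} {f g : A ⟶ B} (h : ∀ a, f.ρ₀ a = g.ρ₀ a) : f = g := by
  refine UHom.ext (Equiv.ext h) (Equiv.ext fun b => ?_)
  obtain ⟨a, rfl⟩ := A.χ.surjective b
  rw [← f.comm, ← g.comm, h]

theorem UHom.ext_heq {A B A' B' : UObj κ} {f : A ⟶ B} {g : A' ⟶ B'} (hA : A = A') (hB : B = B')
    (h : ∀ (a : A.A₀.1) (b : A'.A₀.1), a ≍ b → f.ρ₀ a ≍ g.ρ₀ b) : f ≍ g := by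
  subst hA hB
  exact heq_of_eq (UHom.ext_ρ₀ fun a => eq_of_heq (h a a HEq.rfl))

theorem UHom.ρ₀_heq {A B A' B' : UObj κ} {f : A ⟶ B} {g : A' ⟶ B'} (hA : A = A') (hB : B = B')
    (h : f ≍ g) {a : A.A₀.1} {b : A'.A₀.1} (hab : a ≍ b) : f.ρ₀ a ≍ g.ρ₀ b := by
  subst hA hB hab h; rfl

theorem UObj.χ_heq {A B : UObj κ} (hA : A = B) {a : A.A₀.1} {b : B.A₀.1} (hab : a ≍ b) :
    A.χ a ≍ B.χ b := by
  subst hA hab; rfl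

/-- Families of `κ`-small sets indexed by a groupoid with involution, with an action of its
morphisms and a compatible involution. They are the same thing as morphisms to `UΔ κ`. -/
structure Code (κ : Cardinal.{u}) (Y : InvGrpd.{u + 1}) where
  F : Y.carrier → SmallSet κ
  map : ∀ {y y' : Y.carrier}, (y ⟶ y') → ((F y).1 ≃ (F y').1)
  map_id : ∀ y a, map (𝟙 y) a = a
  map_comp : ∀ {y y' y''} (φ : y ⟶ y') (ψ : y' ⟶ y'') a, map (φ ≫ ψ) a = map ψ (map φ a)
  χ : ∀ y, (F y).1 ≃ (F (Y.invol.obj y)).1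
  naturality : ∀ {y y'} (φ : y ⟶ y') a, χ y' (map φ a) = map (Y.invol.map φ) (χ y a)
  χ_χ : ∀ y a, χ _ (χ y a) ≍ a

namespace Code

variable {Y : InvGrpd.{u + 1}} (C : Code κ Y)

theorem map_heq {y y' z z' : Y.carrier} {φ : y ⟶ y'} {ψ : z ⟶ z'} (h : y = z) (h' : y' = z')
    (hφ : φ ≍ ψ) {a : (C.F y).1} {b : (C.F z).1} (hab : a ≍ b) : C.map φ a ≍ C.map ψ b := by
  subst h h' hφ hab; rfl

theorem χ_heq {y z : Y.carrier} (h : y = z) {a : (C.F y).1} {b : (C.F z).1} (hab : a ≍ b) :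
    C.χ y a ≍ C.χ z b := by
  subst h hab; rfl

/-- The morphism to `UΔ κ` given by a code. -/
def toHom : Y ⟶ UΔ κ where
  functor :=
    { obj := fun y => (⟨C.F y, C.F (Y.invol.obj y), C.χ y⟩ : UObj κ)
      map := fun φ => (⟨C.map φ, C.map (Y.invol.map φ), C.naturality φ⟩ : UHom _ _)
      map_id := fun y => UHom.ext_ρ₀ (C.map_id y)
      map_comp := fun φ ψ => UHom.ext_ρ₀ (C.map_comp φ ψ) }
  comm := by
    -- Since the second set at `y` is the first set at the conjugate of `y`, strict equivariance on
    -- objects is exactly the condition `χ_χ`.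
    have key : ∀ y : Y.carrier, (⟨C.F (Y.invol.obj y), C.F (Y.invol.obj (Y.invol.obj y)),
        C.χ (Y.invol.obj y)⟩ : UObj κ) = ⟨C.F (Y.invol.obj y), C.F y, (C.χ y).symm⟩ := fun y => by
      refine UObj.ext_heq rfl (congrArg C.F (Y.invol_obj y)) ?_
      rintro a _ ⟨⟩
      obtain ⟨a, rfl⟩ := (C.χ y).surjective a
      exact (C.χ_χ y a).trans (heq_of_eq (Equiv.symm_apply_apply _ _).symm)
    refine CategoryTheory.Functor.hext key fun y y' φ => UHom.ext_heq (key y) (key y') ?_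
    rintro a _ ⟨⟩
    rfl

/-- The underlying family of sets of a morphism to `UΔ κ`. -/
abbrev fam (c : Y ⟶ UΔ κ) (y : Y.carrier) : UObj κ := (InvGrpd.under c).obj y

/-- The action of morphisms on the family of sets of a morphism to `UΔ κ`. -/
abbrev famMap (c : Y ⟶ UΔ κ) {y y' : Y.carrier} (φ : y ⟶ y') : UHom (fam c y) (fam c y') :=
  (InvGrpd.under c).map φ

theorem fam_inv (c : Y ⟶ UΔ κ) (y : Y.carrier) :
    fam c (Y.invol.obj y) = (UObj.swap κ).obj (fam c y) :=
  InvGrpd.under_invol_obj c y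

theorem famMap_inv (c : Y ⟶ UΔ κ) {y y' : Y.carrier} (φ : y ⟶ y') :
    famMap c (Y.invol.map φ) ≍ (UObj.swap κ).map (famMap c φ) :=
  InvGrpd.under_invol_map c φ

/-- Equivariance makes the second set redundant, which is why a code records only the first sets. -/
theorem fam_A₁ (c : Y ⟶ UΔ κ) (y : Y.carrier) : (fam c y).A₁ = (fam c (Y.invol.obj y)).A₀ :=
  (congrArg UObj.A₀ (fam_inv c y)).symm

theorem hom_ext {c c' : Y ⟶ UΔ κ} (h₀ : ∀ y, (fam c y).A₀ = (fam c' y).A₀)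
    (h₁ : ∀ y (a : (fam c y).A₀.1) (b : (fam c' y).A₀.1), a ≍ b → (fam c y).χ a ≍ (fam c' y).χ b)
    (h₂ : ∀ {y y'} (φ : y ⟶ y') (a : (fam c y).A₀.1) (b : (fam c' y).A₀.1), a ≍ b →
      (famMap c φ).ρ₀ a ≍ (famMap c' φ).ρ₀ b) : c = c' := by
  have h : ∀ y, fam c y = fam c' y := fun y => UObj.ext_heq (h₀ y)
    ((fam_A₁ c y).trans ((h₀ _).trans (fam_A₁ c' y).symm)) (h₁ y)
  exact InvGrpd.hom_ext (CategoryTheory.Functor.hext h fun y y' φ => UHom.ext_heq (h y) (h y') (h₂ φ))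

/-- The code of a morphism to `UΔ κ`. -/
def ofHom (c : Y ⟶ UΔ κ) : Code κ Y where
  F y := (fam c y).A₀
  map φ := (famMap c φ).ρ₀
  map_id y a := by
    rw [show famMap c (𝟙 y) = 𝟙 (fam c y) from (InvGrpd.under c).map_id y]
    rfl
  map_comp φ ψ a := by
    rw [show famMap c (φ ≫ ψ) = CategoryStruct.comp (X := fam c _) (Y := fam c _) (Z := fam c _)
      (famMap c φ) (famMap c ψ) from (InvGrpd.under c).map_comp φ ψ]
    rfl
  χ y := (fam c y).χ.trans (Equiv.cast (congrArg Subtype.val (fam_A₁ c y)))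
  naturality {y y'} φ a := by
    refine eq_of_heq ((cast_heq _ _).trans ((heq_of_eq ((famMap c φ).comm a)).trans ?_))
    exact (UHom.ρ₀_heq (fam_inv c y) (fam_inv c y') (famMap_inv c φ) (cast_heq _ _)).symm
  χ_χ y a := by
    refine (cast_heq _ _).trans ((UObj.χ_heq (fam_inv c y) (cast_heq _ _)).trans ?_)
    exact heq_of_eq ((fam c y).χ.symm_apply_apply a)

theorem ofHom_χ_heq (c : Y ⟶ UΔ κ) (y : Y.carrier) (a : (fam c y).A₀.1) :
    (ofHom c).χ y a ≍ (fam c y).χ a := cast_heq _ _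

end Code

end Codes

/-- The choice is normalized to be an identity on the image of `i`; the families built from it then
extend the given one strictly and not just up to isomorphism. -/
theorem exists_deformation {K L : Type w} [Groupoid.{w} K] [Groupoid.{w} L] (i : K ⥤ L)
    [i.EssSurj] (hi : Function.Injective i.obj) (l : L) :
    ∃ (k : K) (φ : i.obj k ⟶ l), ∀ k', i.obj k' = l → k = k' ∧ φ ≍ 𝟙 l := by
  by_cases h : ∃ k', i.obj k' = l
  · obtain ⟨k', rfl⟩ := h
    exact ⟨k', 𝟙 _, fun k hk => ⟨(hi hk).symm, HEq.rfl⟩⟩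
  · exact ⟨_, (i.objObjPreimageIso l).hom, fun k' hk => (h ⟨k', hk⟩).elim⟩

theorem heq_of_map_heq {K L : Type w} [Groupoid.{w} K] [Groupoid.{w} L] (i : K ⥤ L) [i.Faithful]
    {a b a' b' : K} {f : a ⟶ b} {f' : a' ⟶ b'} (ha : a = a') (hb : b = b')
    (h : i.map f ≍ i.map f') : f ≍ f' := by
  subst ha hb
  exact heq_of_eq (i.map_injective (eq_of_heq h))

/-- Extension of families along trivial cofibrations. -/
theorem exists_extension {κ : Cardinal.{u}} {K L : InvGrpd.{u + 1}} (i : K ⟶ L)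
    (hi : InvGrpd.trivialCofibrations i) (s : K ⟶ UΔ κ) : ∃ h : L ⟶ UΔ κ, i ≫ h = s := by
  have : (InvGrpd.under i).IsEquivalence := hi.2
  -- A retraction `r` of `L` onto `K` up to the isomorphisms `φ`; in general it does not commute
  -- with the involutions.
  choose r φ hr using exists_deformation (InvGrpd.under i) hi.1
  let I := InvGrpd.under i
  let S := Code.ofHom s
  have hσ : ∀ k, I.obj (K.invol.obj k) = L.invol.obj (I.obj k) := InvGrpd.under_invol_obj i
  let m : ∀ {l l' : L.carrier} (_ : l ⟶ l'), r l ⟶ r l' := fun {l l'} f =>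
    I.preimage (φ l ≫ f ≫ Groupoid.inv (φ l'))
  have hm : ∀ {l l' : L.carrier} (f : l ⟶ l'), I.map (m f) = φ l ≫ f ≫ Groupoid.inv (φ l') :=
    fun f => I.map_preimage _
  -- The arrow `d l` measures the failure of `r` to be equivariant at `l`.
  have hd : ∀ l, ∃ d : K.invol.obj (r l) ⟶ r (L.invol.obj l),
      I.map d ≍ L.invol.map (φ l) ≫ Groupoid.inv (φ (L.invol.obj l)) := fun l => by
    obtain ⟨d', hd'⟩ := exists_heq_hom (hσ (r l)).symm rfl
      (L.invol.map (φ l) ≫ Groupoid.inv (φ (L.invol.obj l)))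
    exact ⟨I.preimage d', (heq_of_eq (I.map_preimage _)).trans hd'⟩
  choose d hd using hd
  have hd_nat : ∀ {l l' : L.carrier} (f : l ⟶ l'),
      K.invol.map (m f) ≫ d l' = d l ≫ m (L.invol.map f) := fun {l l'} f => by
    refine I.map_injective (eq_of_heq ?_)
    rw [I.map_comp, I.map_comp, hm]
    refine (comp_heq_comp (hσ _) (hσ _) rfl (InvGrpd.under_invol_map i (m f)) (hd l')).trans
      (HEq.trans ?_ (comp_heq_comp (hσ _) rfl rfl (hd l) HEq.rfl).symm)
    refine heq_of_eq ?_
    change L.invol.map (I.map (m f)) ≫ _ = _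
    rw [hm]
    simp
  -- Cocycle condition: the two corrections cancel, so the corrected bijections still square to the
  -- identity.
  have hd_d : ∀ l, K.invol.map (d l) ≫ d (L.invol.obj l) ≍ 𝟙 (r l) := fun l => by
    refine heq_of_map_heq I (K.invol_obj _) (congrArg r (L.invol_obj l)) ?_
    rw [I.map_comp, I.map_id]
    have e₁ : I.map (K.invol.map (d l)) ≍ L.invol.map (L.invol.map (φ l)) ≫
        Groupoid.inv (L.invol.map (φ (L.invol.obj l))) := by
      refine (InvGrpd.under_invol_map i (d l)).trans ((map_heq_map L.invol (hσ _) rfl (hd l)).trans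
        (heq_of_eq ?_))
      simp
    refine (comp_heq_comp ((hσ _).trans (congrArg _ (hσ _))) (hσ _) rfl e₁ (hd _)).trans ?_
    have e₂ : φ (L.invol.obj (L.invol.obj l)) ≍ φ l := by rw [L.invol_obj l]
    refine HEq.trans (heq_of_eq ?_) ((comp_heq_comp (L.invol_obj _) (L.invol_obj _)
      (congrArg (fun l => I.obj (r l)) (L.invol_obj l)) (L.invol_map (φ l))
      (inv_heq_inv (congrArg (fun l => I.obj (r l)) (L.invol_obj l)) (L.invol_obj l) e₂)).trans
        (heq_of_eq (Groupoid.comp_inv _)))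
    simp
  -- The family is pulled back along `r`, and its involution is that of `S` followed by transport
  -- along `d`.
  let D : Code κ L :=
    { F := fun l => S.F (r l)
      map := fun f => S.map (m f)
      map_id := fun l a => by
        have : m (𝟙 l) = 𝟙 _ := I.map_injective (by simp [hm, I])
        rw [this, S.map_id]
      map_comp := fun f g a => by
        have : m (f ≫ g) = m f ≫ m g := I.map_injective (by simp [hm])
        rw [this, S.map_comp]
      χ := fun l => (S.χ (r l)).trans (S.map (d l))
      naturality := fun f a => by
        simp only [Equiv.trans_apply]
        rw [S.naturality, ← S.map_comp, hd_nat, S.map_comp]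
      χ_χ := fun l a => by
        simp only [Equiv.trans_apply]
        rw [S.naturality, ← S.map_comp]
        exact (S.map_heq (K.invol_obj _) (congrArg r (L.invol_obj l)) (hd_d l)
          (S.χ_χ _ a)).trans (heq_of_eq (S.map_id _ a)) }
  have hr₁ : ∀ k, r (I.obj k) = k := fun k => (hr _ k rfl).1
  have hφ : ∀ k, φ (I.obj k) ≍ 𝟙 (I.obj k) := fun k => (hr _ k rfl).2
  refine ⟨D.toHom, Code.hom_ext (fun k => congrArg S.F (hr₁ k)) (fun k a b hab => ?_)
    fun {k k'} f a b hab => ?_⟩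
  -- On the image of `i` the normalization makes the correction trivial.
  · have hdk : d (I.obj k) ≍ 𝟙 (K.invol.obj k) := by
      have e₀ : r (L.invol.obj (I.obj k)) = K.invol.obj k := by rw [← hσ, hr₁]
      refine heq_of_map_heq I (congrArg _ (hr₁ k)) e₀ ((hd _).trans ?_)
      have e₁ : φ (L.invol.obj (I.obj k)) ≍ 𝟙 (L.invol.obj (I.obj k)) := by
        rw [← hσ]; exact hφ _
      have e₂ := map_heq_map L.invol (congrArg I.obj (hr₁ k)) rfl (hφ k)
      have := comp_heq_comp (congrArg (fun x => L.invol.obj (I.obj x)) (hr₁ k)) rfl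
        ((congrArg I.obj e₀).trans (hσ k)) e₂
        (inv_heq_inv ((congrArg I.obj e₀).trans (hσ k)) rfl e₁)
      refine this.trans ?_
      simpa using id_heq_id (hσ k).symm
    refine HEq.trans (b := S.χ k b) ?_ (Code.ofHom_χ_heq s k b)
    have := S.map_heq (congrArg _ (hr₁ k)) (by rw [← hσ, hr₁]) hdk (S.χ_heq (hr₁ k) hab)
    exact this.trans (heq_of_eq (S.map_id _ _))
  · refine S.map_heq (hr₁ k) (hr₁ k') (heq_of_map_heq I (hr₁ k) (hr₁ k') ?_) hab
    have := comp_heq_comp (congrArg I.obj (hr₁ k)) rfl (congrArg I.obj (hr₁ k')) (hφ k)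
      (comp_heq_comp rfl rfl (congrArg I.obj (hr₁ k')) (HEq.refl (I.map f))
        (inv_heq_inv (congrArg I.obj (hr₁ k')) rfl (hφ k')))
    refine (heq_of_eq (hm _)).trans (this.trans (heq_of_eq ?_))
    simp

theorem isFibrant_UΔ (κ : Cardinal.{u}) : InvGrpd.IsFibrant (UΔ κ) := fun _ _ i hi =>
  ⟨fun {s t} sq => by
    obtain ⟨h, hh⟩ := exists_extension i hi s
    exact ⟨⟨⟨h, hh, InvGrpd.isTerminalOne.hom_ext _ _⟩⟩⟩⟩

/-! ### Transport between the fibres of a covering. -/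

section Transport

variable {X Y : Type w} [Groupoid.{w} X] [Groupoid.{w} Y] {F : X ⥤ Y} (hF : IsCovering F)

/-- The fibres of a functor. -/
abbrev Fib (F : X ⥤ Y) (y : Y) : Type w := {x // F.obj x = y}

include hF in
theorem IsCovering.existsUnique_transport {y y' : Y} (φ : y ⟶ y') (x : Fib F y) :
    ∃! x' : Fib F y', ∃ ψ : x.1 ⟶ x'.1, F.map ψ ≍ φ := by
  obtain ⟨x', ψ, h, hψ⟩ := hF.isIsofibration.lift x.2 φ
  refine ⟨⟨x', h⟩, ⟨ψ, hψ⟩, ?_⟩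
  rintro ⟨x'', h''⟩ ⟨ψ', hψ'⟩
  exact Subtype.ext (hF.hasUniqueLifts ψ' ψ rfl (h''.trans h.symm) (hψ'.trans hψ.symm)).1

/-- Transport along a morphism between the fibres of a covering. -/
noncomputable def IsCovering.transport {y y' : Y} (φ : y ⟶ y') (x : Fib F y) : Fib F y' :=
  (hF.existsUnique_transport φ x).choose

theorem IsCovering.transport_spec {y y' : Y} (φ : y ⟶ y') (x : Fib F y) :
    ∃ ψ : x.1 ⟶ (hF.transport φ x).1, F.map ψ ≍ φ :=
  (hF.existsUnique_transport φ x).choose_spec.1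

theorem IsCovering.transport_eq {y y' : Y} (φ : y ⟶ y') {x : Fib F y} {x' : Fib F y'}
    (ψ : x.1 ⟶ x'.1) (h : F.map ψ ≍ φ) : hF.transport φ x = x' :=
  ((hF.existsUnique_transport φ x).choose_spec.2 x' ⟨ψ, h⟩).symm

theorem IsCovering.transport_id {y : Y} (x : Fib F y) : hF.transport (𝟙 y) x = x :=
  hF.transport_eq _ (𝟙 _) (over_id F x.2)

theorem IsCovering.transport_comp {y y' y'' : Y} (φ : y ⟶ y') (φ' : y' ⟶ y'') (x : Fib F y) :
    hF.transport (φ ≫ φ') x = hF.transport φ' (hF.transport φ x) := by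
  obtain ⟨ψ, hψ⟩ := hF.transport_spec φ x
  obtain ⟨ψ', hψ'⟩ := hF.transport_spec φ' (hF.transport φ x)
  exact hF.transport_eq _ (ψ ≫ ψ') (over_comp x.2 (hF.transport _ _).2 (hF.transport _ _).2 hψ hψ')

/-- Transport along a morphism as a bijection of fibres. -/
noncomputable def IsCovering.transportEquiv {y y' : Y} (φ : y ⟶ y') : Fib F y ≃ Fib F y' where
  toFun := hF.transport φ
  invFun := hF.transport (Groupoid.inv φ)
  left_inv x := by rw [← hF.transport_comp, Groupoid.comp_inv, hF.transport_id]
  right_inv x := by rw [← hF.transport_comp, Groupoid.inv_comp, hF.transport_id]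

end Transport

/-! ### Size of fibres under composition and dependent products. -/

section SmallFibers

variable {X Y Z : Type (u + 1)} [Groupoid.{u + 1} X] [Groupoid.{u + 1} Y] [Groupoid.{u + 1} Z]
  {κ : Cardinal.{u}}

/-- Functors with `κ`-small fibres. -/
def HasSmallFibers (κ : Cardinal.{u}) (F : X ⥤ Y) : Prop :=
  ∀ y, ∃ S : SmallSet κ, Nonempty (S.1 ≃ Fib F y)

/-- The type `T` may live in a larger universe; the range of the embedding is a copy of it in the
universe of `S`. -/
theorem exists_small_equiv {S : SmallSet κ} {T : Type w} (e : T ↪ S.1) :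
    ∃ S' : SmallSet κ, Nonempty (S'.1 ≃ T) :=
  ⟨⟨Set.range e, (Cardinal.mk_set_le _).trans_lt S.2⟩, ⟨(Equiv.ofInjective e e.injective).symm⟩⟩

theorem hasSmallFibers_of_embedding {F : X ⥤ Y}
    (h : ∀ y, ∃ S : SmallSet κ, Nonempty (Fib F y ↪ S.1)) : HasSmallFibers κ F := fun y => by
  obtain ⟨S, ⟨e⟩⟩ := h y
  exact exists_small_equiv e

theorem HasSmallFibers.comp (hκ : κ.IsInaccessible) {F : X ⥤ Y} {G : Y ⥤ Z}
    (hF : HasSmallFibers κ F) (hG : HasSmallFibers κ G) : HasSmallFibers κ (F ⋙ G) := fun z => by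
  obtain ⟨S, ⟨e⟩⟩ := hG z
  choose T t using hF
  refine exists_small_equiv (S := ⟨Σ s : S.1, (T (e s).1).1, ?_⟩) ⟨fun x => ⟨e.symm ⟨F.obj x.1, x.2⟩,
    (t _).some.symm ⟨x.1, by simp⟩⟩, ?_⟩
  · rw [Cardinal.mk_sigma]
    exact Cardinal.sum_lt_of_isRegular hκ.isRegular S.2 fun s => (T _).2
  · intro x x' h
    obtain ⟨h₁, h₂⟩ := Sigma.mk.inj_iff.1 h
    have key : ∀ {a b : Y} (_ : a = b) (p : Fib F a) (q : Fib F b),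
        (t a).some.symm p ≍ (t b).some.symm q → p.1 = q.1 := by
      rintro a _ rfl p q h
      exact congrArg Subtype.val ((t a).some.symm.injective (eq_of_heq h))
    exact Subtype.ext (key (congrArg (fun s => (e s).1) h₁) _ _ h₂)

/-- A function is determined by its graph, a subset of the small product, and `κ` is a strong limit.
-/
theorem small_pi (hκ : κ.IsInaccessible) (S T : SmallSet κ) : #(S.1 → T.1) < κ := by
  have h : #(S.1 × T.1) < κ := by
    rw [Cardinal.mk_prod, Cardinal.lift_id, Cardinal.lift_id]
    exact Cardinal.mul_lt_of_lt hκ.aleph0_lt.le S.2 T.2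
  refine lt_of_le_of_lt ?_ (hκ.isStrongLimit.isStrongPrelimit h)
  rw [← Cardinal.mk_set]
  refine Cardinal.mk_le_of_injective (f := fun f => {x : S.1 × T.1 | f x.1 = x.2}) fun f f' h => ?_
  funext s
  have : (s, f s) ∈ {x : S.1 × T.1 | f' x.1 = x.2} := by
    have h' : {x : S.1 × T.1 | f x.1 = x.2} = {x : S.1 × T.1 | f' x.1 = x.2} := h
    rw [← h']; rfl
  exact this.symm

variable {A B : Type w} [Groupoid.{w} A] [Groupoid.{w} B] {X' : Type w} [Groupoid.{w} X']

/-- Each value of the target section is the endpoint of an arrow of `X` over a lift of the base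
arrow, starting at a value of the source section. Unique lifting along `f` determines this endpoint,
and then all arrows. -/
theorem PiObj.hasUniqueLifts_proj {g : A ⥤ B} (hg : IsIsofibration g) {f : X' ⥤ A}
    (hf : HasUniqueLifts f) : HasUniqueLifts (PiObj.proj hg f) := by
  rintro s _ t t' (σ : PiHom s t) (σ' : PiHom _ t') rfl (hb : t.base = t'.base)
    (hσ : σ.base ≍ σ'.base)
  have hobj : ∀ a h h', t.obj a h = t'.obj a h' := fun a h h' => by
    obtain ⟨a', β, ha', hβ⟩ := hg.lift h (Groupoid.inv σ.base)
    have hβ' : g.map (Groupoid.inv β) ≍ σ.base := by simpa using over_inv h ha' hβ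
    exact (hf (σ.map ha' h _ hβ') (σ'.map ha' h' _ (hβ'.trans hσ)) rfl
      ((t.obj_f _ _).trans (t'.obj_f _ _).symm) ((σ.map_f ..).trans (σ'.map_f ..).symm)).1
  have ht : t = t' := PiObj.ext_heq hb hobj fun {a a'} h h' k k' α hα kα =>
    (hf _ _ (hobj a h k) ((t.obj_f _ _).trans (t'.obj_f _ _).symm)
      ((t.map_f ..).trans (t'.map_f ..).symm)).2
  refine ⟨ht, PiHom.ext_heq rfl ht hσ fun {a a'} h h' k k' α hα kα => ?_⟩
  exact (hf _ _ rfl ((t.obj_f _ _).trans (t'.obj_f _ _).symm)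
    ((σ.map_f ..).trans (σ'.map_f ..).symm)).2

/-- With unique lifts along `f`, a section is determined by its values on objects. The fibre thus
embeds in the functions from a fibre of `g` to a fibre of `f ⋙ g`. -/
theorem PiObj.hasSmallFibers_proj (hκ : κ.IsInaccessible) {g : Y ⥤ Z} (hg : IsIsofibration g)
    {f : X ⥤ Y} (hf : HasUniqueLifts f) (hg' : HasSmallFibers κ g) (hf' : HasSmallFibers κ f) :
    HasSmallFibers κ (PiObj.proj hg f) := hasSmallFibers_of_embedding fun z => by
  obtain ⟨S, ⟨e⟩⟩ := hg' z
  obtain ⟨T, ⟨t⟩⟩ := hf'.comp hκ hg' z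
  refine ⟨⟨S.1 → T.1, small_pi hκ S T⟩, ⟨⟨fun s a => t.symm ⟨s.1.obj (e a).1 ((e a).2.trans s.2.symm),
    (congrArg g.obj (s.1.obj_f _ _)).trans (e a).2⟩, ?_⟩⟩⟩
  rintro ⟨s, rfl⟩ ⟨s', (hs' : s'.base = s.base)⟩ h
  have hobj : ∀ a h h', s.obj a h = s'.obj a h' := fun a ha ha' => by
    have := congrArg Subtype.val (t.symm.injective (congrFun h (e.symm ⟨a, ha⟩)))
    simpa using this
  exact Subtype.ext (PiObj.ext_heq hs'.symm hobj fun {a a'} h h' k k' α hα kα =>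
    (hf _ _ (hobj a h k) ((s.obj_f _ _).trans (s'.obj_f _ _).symm)
      ((s.map_f ..).trans (s'.map_f ..).symm)).2)

end SmallFibers

/-! ### Coverings with small fibres are classified by `UΔ`. -/

section Universe

variable {κ : Cardinal.{u}}

theorem UtObj.ext_heq {A B : UtObj κ} (h : A.base = B.base) (h' : A.pt ≍ B.pt) : A = B := by
  obtain ⟨A, a⟩ := A
  obtain ⟨B, b⟩ := B
  obtain rfl : A = B := h
  obtain rfl : a = b := eq_of_heq h'
  rfl

theorem UtHom.ext_heq {A B A' B' : UtObj κ} {f : A ⟶ B} {g : A' ⟶ B'} (hA : A = A') (hB : B = B')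
    (h : f.base ≍ g.base) : f ≍ g := by
  subst hA hB
  exact heq_of_eq (UtHom.ext (eq_of_heq h))

theorem isCovering_pΔ (κ : Cardinal.{u}) : IsCovering (InvGrpd.under (pΔ κ)) := by
  refine isCovering_iff.2 ⟨isIsofibration_iff.2 fun (A : UtObj κ) (B : UObj κ) (ψ : UHom _ B) =>
    ⟨(⟨B, ψ.ρ₀ A.pt⟩ : UtObj κ), (⟨ψ, rfl⟩ : UtHom _ _), rfl, HEq.rfl⟩, ?_⟩
  rintro (A : UtObj κ) _ (B : UtObj κ) (B' : UtObj κ) (φ : UtHom A B) (φ' : UtHom _ B') rfl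
    (h : B.base = B'.base) (h' : φ.base ≍ φ'.base)
  have hB : B = B' := UtObj.ext_heq h (by
    rw [← φ.pt, ← φ'.pt]; exact UHom.ρ₀_heq rfl h h' HEq.rfl)
  exact ⟨hB, UtHom.ext_heq rfl hB h'⟩

theorem hasSmallFibers_pΔ (κ : Cardinal.{u}) : HasSmallFibers κ (InvGrpd.under (pΔ κ)) := by
  refine hasSmallFibers_of_embedding fun (A : UObj κ) => ⟨A.A₀, ⟨⟨fun x =>
    (cast (congrArg (fun A : UObj κ => A.A₀.1) x.2) (UtObj.pt x.1)), ?_⟩⟩⟩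
  rintro ⟨⟨A, a⟩, rfl⟩ ⟨⟨B, b⟩, hB⟩ h
  obtain rfl : B = A := hB
  obtain rfl : a = b := h
  rfl

/-- Coverings with `κ`-small fibres are pullbacks of `pΔ κ`. -/
theorem exists_classifying {X Y : InvGrpd.{u + 1}} (f : X ⟶ Y)
    (hf : IsCovering (InvGrpd.under f)) (hs : HasSmallFibers κ (InvGrpd.under f)) :
    ∃ (t : X ⟶ UtΔ κ) (c : Y ⟶ UΔ κ), IsPullback t f (pΔ κ) c := by
  choose S e using hs
  replace e := fun y => (e y).some
  have e_heq : ∀ {y z : Y.carrier} (_ : y = z) (x : Fib (InvGrpd.under f) y)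
      (x' : Fib (InvGrpd.under f) z), x.1 = x'.1 → (e y).symm x ≍ (e z).symm x' := by
    rintro y _ rfl x x' h
    rw [Subtype.ext h]
  have hinv : ∀ {y} (x : Fib (InvGrpd.under f) y),
      (InvGrpd.under f).obj (X.invol.obj x.1) = Y.invol.obj y := fun x =>
    (InvGrpd.under_invol_obj f x.1).trans (congrArg _ x.2)
  -- The code consists of small copies of the fibres, with transport as action and the involution of
  -- `X` as comparison between conjugate fibres.
  let C : Code κ Y :=
    { F := S
      map := fun φ => (e _).trans ((hf.transportEquiv φ).trans (e _).symm)
      map_id := fun y a => by simp [IsCovering.transportEquiv, hf.transport_id]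
      map_comp := fun φ ψ a => by simp [IsCovering.transportEquiv, hf.transport_comp]
      χ := fun y => (e _).trans (Equiv.trans
        { toFun := fun x => ⟨X.invol.obj x.1, hinv x⟩
          invFun := fun x => ⟨X.invol.obj x.1, (hinv x).trans (Y.invol_obj y)⟩
          left_inv := fun x => Subtype.ext (X.invol_obj x.1)
          right_inv := fun x => Subtype.ext (X.invol_obj x.1) } (e _).symm)
      naturality := fun {y y'} φ a => by
        obtain ⟨ψ, hψ⟩ := hf.transport_spec φ (e y a)
        simp only [Equiv.trans_apply, Equiv.apply_symm_apply, Equiv.coe_fn_mk,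
          IsCovering.transportEquiv, EmbeddingLike.apply_eq_iff_eq]
        refine (hf.transport_eq _ (X.invol.map ψ) ?_).symm
        exact (InvGrpd.under_invol_map f ψ).trans
          (map_heq_map Y.invol (e y a).2 (hf.transport _ _).2 hψ)
      χ_χ := fun y a => by
        simp only [Equiv.trans_apply, Equiv.apply_symm_apply, Equiv.coe_fn_mk]
        refine (e_heq (Y.invol_obj y) _ (e y a) (X.invol_obj _)).trans (heq_of_eq (by simp)) }
  have map_e : ∀ {y y' : Y.carrier} (φ : y ⟶ y') (x : Fib (InvGrpd.under f) y),
      C.map φ ((e y).symm x) = (e y').symm (hf.transport φ x) := fun φ x => by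
    simp [C, IsCovering.transportEquiv]
  let T : X.carrier ⥤ UtObj κ :=
    { obj := fun x => ⟨Code.fam C.toHom ((InvGrpd.under f).obj x), (e _).symm ⟨x, rfl⟩⟩
      map := fun {x x'} ψ => (⟨Code.famMap C.toHom ((InvGrpd.under f).map ψ),
        (map_e _ _).trans (congrArg _ (hf.transport_eq _ ψ HEq.rfl))⟩ : UtHom _ _)
      map_id := fun x => UtHom.ext ((congrArg _ ((InvGrpd.under f).map_id x)).trans
        ((InvGrpd.under C.toHom).map_id _))
      map_comp := fun φ ψ => UtHom.ext ((congrArg _ ((InvGrpd.under f).map_comp φ ψ)).trans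
        ((InvGrpd.under C.toHom).map_comp _ _)) }
  have hT : X.invol ⋙ T = T ⋙ UtObj.swap κ := by
    have hobj : ∀ x, T.obj (X.invol.obj x) = (UtObj.swap κ).obj (T.obj x) := fun x => by
      refine UtObj.ext_heq ((congrArg (Code.fam C.toHom) (InvGrpd.under_invol_obj f x)).trans
        (Code.fam_inv _ _)) ?_
      refine (e_heq (InvGrpd.under_invol_obj f x) _ ⟨X.invol.obj x, hinv ⟨x, rfl⟩⟩ rfl).trans
        (heq_of_eq ?_)
      change _ = C.χ _ ((e _).symm ⟨x, rfl⟩)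
      simp [C]
    refine CategoryTheory.Functor.hext hobj fun x x' ψ => UtHom.ext_heq (hobj x) (hobj x') ?_
    exact (map_heq_map (InvGrpd.under C.toHom) (InvGrpd.under_invol_obj f x)
      (InvGrpd.under_invol_obj f x') (InvGrpd.under_invol_map f ψ)).trans (Code.famMap_inv _ _)
  refine ⟨⟨T, hT⟩, C.toHom, InvGrpd.isPullback_of_strict
    { comm := rfl
      exists_obj := ?_
      obj_ext := ?_
      exists_map := ?_
      map_ext := fun _ h => HasUniqueLifts.map_injective hf.hasUniqueLifts h }⟩
  · rintro ⟨A, a⟩ y (rfl : A = Code.fam C.toHom y)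
    obtain ⟨⟨x, rfl⟩, rfl⟩ := (e y).symm.surjective a
    exact ⟨x, rfl, rfl⟩
  · intro x x' h₁ h₂
    have key : ∀ {A B : UtObj κ} (_ : A = B), A.pt ≍ B.pt := by rintro A _ rfl; rfl
    have h₃ := (key h₁).trans (e_heq h₂.symm ⟨x', rfl⟩ ⟨x', h₂.symm⟩ rfl)
    exact congrArg Subtype.val ((e _).symm.injective (eq_of_heq h₃))
  · intro x x' (φ : UtHom (T.obj x) (T.obj x')) ψ h
    have h₁ : φ.base = Code.famMap C.toHom ψ := eq_of_heq h
    -- Preservation of points says that transport along `ψ` sends `x` to `x'`, which provides the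
    -- arrow of `X` over `ψ`.
    have h₂ : C.map ψ ((e _).symm ⟨x, rfl⟩) = (e _).symm ⟨x', rfl⟩ := by
      have := φ.pt
      rw [h₁] at this
      exact this
    rw [map_e] at h₂
    have h₃ := (e _).symm.injective h₂
    obtain ⟨ω, hω⟩ : ∃ ω : x ⟶ x', (InvGrpd.under f).map ω ≍ ψ := by
      have := hf.transport_spec ψ ⟨x, rfl⟩
      rw [h₃] at this
      exact this
    obtain rfl := eq_of_heq hω
    exact ⟨ω, UtHom.ext h₁.symm, rfl⟩

end Universe

section

variable {C : Type u} [Category.{v} C]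

/-- Dependent products are unique up to isomorphism. -/
theorem IsPi.exists_iso {A B X P P' Q Q' : C} {g : A ⟶ B} {f : X ⟶ A} {q : P ⟶ B} {fst : P' ⟶ P}
    {snd : P' ⟶ A} {ev : P' ⟶ X} {r : Q ⟶ B} {fst' : Q' ⟶ Q} {snd' : Q' ⟶ A} {ev' : Q' ⟶ X}
    (H : IsPi g f q fst snd ev) (H' : IsPi g f r fst' snd' ev') :
    ∃ e : P ≅ Q, e.hom ≫ r = q := by
  obtain ⟨k, ⟨hk, k', hk₁, hk₂, hk₃⟩, -⟩ := H'.existsUnique q fst snd H.isPullback ev H.ev_comp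
  obtain ⟨l, ⟨hl, l', hl₁, hl₂, hl₃⟩, -⟩ := H.existsUnique r fst' snd' H'.isPullback ev' H'.ev_comp
  refine ⟨⟨k, l, ?_, ?_⟩, hk⟩
  · refine (H.existsUnique q fst snd H.isPullback ev H.ev_comp).unique
      ⟨by rw [Category.assoc, hl, hk], k' ≫ l', ?_, ?_, ?_⟩ ⟨by simp, 𝟙 _, by simp, by simp, by simp⟩
    · rw [Category.assoc, hl₁, ← Category.assoc, hk₁, Category.assoc]
    · rw [Category.assoc, hl₂, hk₂]
    · rw [Category.assoc, hl₃, hk₃]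
  · refine (H'.existsUnique r fst' snd' H'.isPullback ev' H'.ev_comp).unique
      ⟨by rw [Category.assoc, hk, hl], l' ≫ k', ?_, ?_, ?_⟩ ⟨by simp, 𝟙 _, by simp, by simp, by simp⟩
    · rw [Category.assoc, hk₁, ← Category.assoc, hl₁, Category.assoc]
    · rw [Category.assoc, hk₂, hl₂]
    · rw [Category.assoc, hk₃, hl₃]

theorem IsSmall.precomp_iso {Ut U : C} {p : Ut ⟶ U} {X X' Y : C} {f : X ⟶ Y} (hf : IsSmall p f)
    (e : X' ≅ X) : IsSmall p (e.hom ≫ f) := by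
  obtain ⟨t, c, h⟩ := hf
  exact ⟨e.hom ≫ t, c, h.of_iso e.symm (Iso.refl _) (Iso.refl _) (Iso.refl _) (by simp) (by simp)
    (by simp) (by simp)⟩

end

theorem isFibrant_UtΔ (κ : Cardinal.{u}) : InvGrpd.IsFibrant (UtΔ κ) :=
  InvGrpd.isFibrant_of_fibrations (InvGrpd.fibrations_of_isCovering (isCovering_pΔ κ))
    (isFibrant_UΔ κ)

/-! ### The universe `p` and its closure properties. -/

namespace InvGrpd.Fibrant

/-- The fibrant object `UΔ κ`. -/
def U (κ : Cardinal.{u}) : Fibrant.{u + 1} := ⟨UΔ κ, isFibrant_UΔ κ⟩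

/-- The fibrant object `UtΔ κ`. -/
def Ut (κ : Cardinal.{u}) : Fibrant.{u + 1} := ⟨UtΔ κ, isFibrant_UtΔ κ⟩

/-- The universe `pΔ κ` as a morphism of fibrant objects. -/
def p (κ : Cardinal.{u}) : Ut κ ⟶ U κ := ObjectProperty.homMk (pΔ κ)

variable {κ : Cardinal.{u}}

theorem fibrantFibrations_p (κ : Cardinal.{u}) : fibrantFibrations (p κ) :=
  fibrations_of_isCovering (isCovering_pΔ κ)

/-- The small fibrations are the coverings with small fibres. -/
theorem isSmall_iff {X Y : Fibrant.{u + 1}} {f : X ⟶ Y} : IsSmall (p κ) f ↔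
    IsCovering (under f.hom) ∧ HasSmallFibers κ (under f.hom) := by
  constructor
  · rintro ⟨t, c, h⟩
    have h' := strict_of_isPullback (isPullback_hom h (fibrantFibrations_p κ))
    refine ⟨h'.isCovering (isCovering_pΔ κ), fun y => ?_⟩
    obtain ⟨S, ⟨e⟩⟩ := hasSmallFibers_pΔ κ ((under c.hom).obj y)
    obtain ⟨e'⟩ := h'.exists_fiber_equiv y
    exact ⟨S, ⟨e.trans e'.symm⟩⟩
  · rintro ⟨h₁, h₂⟩
    obtain ⟨t, c, h⟩ := exists_classifying f.hom h₁ h₂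
    exact ⟨ObjectProperty.homMk t, ObjectProperty.homMk c, isPullback_of_hom h⟩

theorem fibrantFibrations_of_isSmall {X Y : Fibrant.{u + 1}} {f : X ⟶ Y} (hf : IsSmall (p κ) f) :
    fibrantFibrations f :=
  fibrations_of_isCovering (isSmall_iff.1 hf).1

/-- Cancellation is inherited from coverings: every map between small types in the same context is
itself small. -/
theorem isSmall_of_comp {X Y Z : Fibrant.{u + 1}} {f : X ⟶ Y} {g : Y ⟶ Z} (hg : IsSmall (p κ) g)
    (hfg : IsSmall (p κ) (f ≫ g)) : IsSmall (p κ) f := by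
  rw [isSmall_iff] at *
  refine ⟨IsCovering.of_comp hg.1 hfg.1, hasSmallFibers_of_embedding fun y => ?_⟩
  obtain ⟨S, ⟨e⟩⟩ := hfg.2 ((under g.hom).obj y)
  exact ⟨S, ⟨⟨fun x => e.symm ⟨x.1, congrArg (under g.hom).obj x.2⟩, fun x x' h =>
    Subtype.ext (Subtype.mk_eq_mk.1 (e.symm.injective h))⟩⟩⟩

theorem llp_id (X : Fibrant.{w}) : fibrantFibrations.llp (𝟙 X) :=
  MorphismProperty.llp_of_isIso _ _

/-- `pΔ κ` is a universe. -/
theorem isUniverse_p (hκ : κ.IsInaccessible) : IsUniverse fibrantFibrations (p κ) where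
  fibration := fibrantFibrations_p κ
  id X := isSmall_iff.2 ⟨isCovering_id, hasSmallFibers_of_embedding fun y =>
    ⟨⟨PUnit, by simpa using Cardinal.one_lt_aleph0.trans hκ.aleph0_lt⟩, ⟨⟨fun _ => PUnit.unit,
      fun x x' _ => Subtype.ext (x.2.trans x'.2.symm)⟩⟩⟩⟩
  comp f g hf hg := by
    rw [isSmall_iff] at *
    exact ⟨hf.1.comp hg.1, hf.2.comp hκ hg.2⟩
  pi g f q fst snd ev hf hg H := by
    obtain ⟨hg', P, P', r, fst', snd', ev', hr, H', hM⟩ := exists_isPi g f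
      (fibrantFibrations_of_isSmall hg) (fibrantFibrations_of_isSmall hf)
    -- Any dependent product is isomorphic over the base to the explicit one, whose lifts and fibres
    -- are known.
    obtain ⟨e, rfl⟩ := H.exists_iso H'
    refine IsSmall.precomp_iso (isSmall_iff.2 ?_) e
    have hf' := isSmall_iff.1 hf
    have := hM (fun _ F => HasUniqueLifts F ∧ HasSmallFibers κ F)
      ⟨PiObj.hasUniqueLifts_proj hg' hf'.1.hasUniqueLifts,
        PiObj.hasSmallFibers_proj hκ hg' hf'.1.hasUniqueLifts (isSmall_iff.1 hg).2 hf'.2⟩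
    exact ⟨isCovering_iff.2 ⟨isIsofibration_of_fibrations hr, this.1⟩, this.2⟩
  -- By cancellation `f` is already small, so the identity serves as acyclic cofibration.
  factorization a b f ha hb h := ⟨_, 𝟙 _, f, llp_id _, isSmall_of_comp hb (h ▸ ha),
    Category.id_comp _⟩

end InvGrpd.Fibrant

/-! ### Function types between small types, and abstract classifiers of isomorphisms. -/

section

variable {C : Type u} [Category.{v} C] {Ut U : C} {p : Ut ⟶ U}

/-- The total object of a dependent product along the display map of a small type. -/
theorem PiData.isPullback_total {B : C} {c : B ⟶ U} {A : SmallExt p c} {X : C} {f : X ⟶ A.obj}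
    (D : PiData A.disp f) : IsPullback D.fst (D.snd ≫ A.var) (D.π ≫ c) p :=
  D.isPi.isPullback.paste_vert A.isPullback.flip

/-- The universal property of function types between small types. -/
theorem PiData.existsUnique_fun {B : C} {c e : B ⟶ U} {A : SmallExt p c}
    {T : SmallExt p (A.disp ≫ e)} (D : PiData A.disp T.disp) {Γ X : C} (h : Γ ⟶ B) {x : X ⟶ Ut}
    {d : X ⟶ Γ} (hX : IsPullback x d p (h ≫ c)) (v : X ⟶ Ut) (hv : v ≫ p = d ≫ h ≫ e) :
    ∃! k : Γ ⟶ D.obj, k ≫ D.π = h ∧ ∃ k' : X ⟶ D.total, k' ≫ D.fst = d ≫ k ∧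
      k' ≫ D.snd ≫ A.var = x ∧ k' ≫ D.ev ≫ T.var = v := by
  obtain ⟨y, hy₁, hy₂⟩ := A.isPullback.exists_lift x (d ≫ h) (by rw [hX.w, Category.assoc])
  have hY : IsPullback d y h A.disp :=
    IsPullback.of_bot (by rw [hy₁]; exact hX.flip) hy₂.symm A.isPullback.flip
  obtain ⟨t, ht₁, ht₂⟩ := T.isPullback.exists_lift v y (by rw [hv, ← Category.assoc y, hy₂,
    Category.assoc])
  obtain ⟨k, ⟨hk, k', hk₁, hk₂, hk₃⟩, hu⟩ := D.isPi.existsUnique h d y hY t ht₂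
  refine ⟨k, ⟨hk, k', hk₁, by rw [reassoc_of% hk₂, hy₁], by rw [reassoc_of% hk₃, ht₁]⟩, ?_⟩
  rintro l ⟨hl, l', hl₁, hl₂, hl₃⟩
  have hl₄ : l' ≫ D.snd = y := by
    refine A.isPullback.hom_ext (by rw [Category.assoc, hl₂, hy₁]) ?_
    rw [hy₂, Category.assoc, ← D.isPi.isPullback.w, reassoc_of% hl₁, hl]
  refine hu l ⟨hl, l', hl₁, hl₄, T.isPullback.hom_ext (by rw [Category.assoc, hl₃, ht₁]) ?_⟩
  rw [ht₂, Category.assoc, D.isPi.ev_comp, hl₄]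

theorem PiData.exists_of_mono {A B X : C} {g : A ⟶ B} {f : X ⟶ A} (D : PiData g f) {Γ Y : C}
    {h : Γ ⟶ B} {y₁ : Y ⟶ Γ} {y₂ : Y ⟶ A} (hY : IsPullback y₁ y₂ h g) (v : Y ⟶ X)
    (hv : v ≫ f = y₂) : ∃ k : Γ ⟶ D.obj, k ≫ D.π = h := by
  obtain ⟨k, ⟨hk, -⟩, -⟩ := D.isPi.existsUnique h y₁ y₂ hY v hv
  exact ⟨k, hk⟩

/-- Dependent products of propositions are propositions. -/
theorem PiData.mono {A B X : C} {g : A ⟶ B} {f : X ⟶ A} (D : PiData g f) [Mono f]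
    (hg : ∀ {Γ : C} (h : Γ ⟶ B), ∃ (Y : C) (y₁ : Y ⟶ Γ) (y₂ : Y ⟶ A), IsPullback y₁ y₂ h g) :
    Mono D.π where
  right_cancellation {Γ} k l h := by
    obtain ⟨Y, y₁, y₂, hY⟩ := hg (k ≫ D.π)
    have H := D.isPi.isPullback
    obtain ⟨k', hk₁, hk₂⟩ := H.exists_lift (y₁ ≫ k) y₂ (by rw [Category.assoc, hY.w])
    obtain ⟨l', hl₁, hl₂⟩ := H.exists_lift (y₁ ≫ l) y₂ (by rw [Category.assoc, ← h, hY.w])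
    refine (D.isPi.existsUnique (k ≫ D.π) y₁ y₂ hY (k' ≫ D.ev)
      (by rw [Category.assoc, D.isPi.ev_comp, hk₂])).unique ⟨rfl, k', hk₁, hk₂, rfl⟩
      ⟨h.symm, l', hl₁, hl₂, ?_⟩
    rw [← cancel_mono f, Category.assoc, Category.assoc, D.isPi.ev_comp, hk₂, hl₂]

theorem exists_pullback_of_isSmall
    (hp : ∀ {Γ : C} (c : Γ ⟶ U), ∃ (W : C) (t : W ⟶ Ut) (d : W ⟶ Γ), IsPullback t d p c)
    {A B : C} {g : A ⟶ B} (hg : IsSmall p g) {Γ : C} (h : Γ ⟶ B) :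
    ∃ (Y : C) (y₁ : Y ⟶ Γ) (y₂ : Y ⟶ A), IsPullback y₁ y₂ h g := by
  obtain ⟨t, c, H⟩ := hg
  obtain ⟨W, s, d, hW⟩ := hp (h ≫ c)
  obtain ⟨y, hy₁, hy₂⟩ := H.exists_lift s (d ≫ h) (by rw [hW.w, Category.assoc])
  exact ⟨W, d, y, IsPullback.of_bot (by rw [hy₁]; exact hW.flip) hy₂.symm H.flip⟩

/-- Mutually inverse maps over `Γ` between two small types in context `Γ`. -/
def InversePair {Γ X Y : C} (x : X ⟶ Ut) (dx : X ⟶ Γ) (y : Y ⟶ Ut) (dy : Y ⟶ Γ) (v : X ⟶ Ut)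
    (w : Y ⟶ Ut) : Prop :=
  (∃ m : X ⟶ Y, m ≫ y = v ∧ m ≫ dy = dx ∧ m ≫ w = x) ∧
    ∃ n : Y ⟶ X, n ≫ x = w ∧ n ≫ dx = dy ∧ n ≫ v = y

variable (p) in
/-- An object that classifies the isomorphisms between small types. -/
structure IsoClassifier where
  obj : C
  src : obj ⟶ U
  tgt : obj ⟶ U
  W : C
  var : W ⟶ Ut
  disp : W ⟶ obj
  isPullback : IsPullback var disp p src
  θ : W ⟶ Ut
  θ_p : θ ≫ p = disp ≫ tgt
  exists_inverse : ∃ (V : C) (v : V ⟶ Ut) (d : V ⟶ obj) (η : V ⟶ Ut), IsPullback v d p tgt ∧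
    η ≫ p = d ≫ src ∧ InversePair var disp v d θ η
  exists_lift : ∀ {Γ X Y : C} {a b : Γ ⟶ U} {x : X ⟶ Ut} {dx : X ⟶ Γ} {y : Y ⟶ Ut} {dy : Y ⟶ Γ}
    (v : X ⟶ Ut) (w : Y ⟶ Ut), IsPullback x dx p a → IsPullback y dy p b → v ≫ p = dx ≫ b →
      w ≫ p = dy ≫ a → InversePair x dx y dy v w →
      ∃ k : Γ ⟶ obj, k ≫ src = a ∧ k ≫ tgt = b ∧
        ∃ m : X ⟶ W, m ≫ disp = dx ≫ k ∧ m ≫ var = x ∧ m ≫ θ = v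
  uniq : ∀ {Γ X : C} {k k' : Γ ⟶ obj} {x : X ⟶ Ut} {dx : X ⟶ Γ} (m m' : X ⟶ W),
    IsPullback x dx p (k ≫ src) → k ≫ src = k' ≫ src → k ≫ tgt = k' ≫ tgt → m ≫ disp = dx ≫ k →
      m ≫ var = x → m' ≫ disp = dx ≫ k' → m' ≫ var = x → m ≫ θ = m' ≫ θ → k = k'

namespace IsoClassifier

variable (P Q : IsoClassifier p)

/-- Morphisms compatible with the universal isomorphisms. -/
structure IsMor (k : P.obj ⟶ Q.obj) : Prop where
  src : k ≫ Q.src = P.src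
  tgt : k ≫ Q.tgt = P.tgt
  exists_map : ∃ m : P.W ⟶ Q.W, m ≫ Q.disp = P.disp ≫ k ∧ m ≫ Q.var = P.var ∧ m ≫ Q.θ = P.θ

/-- The section that sends a small type to its identity. -/
structure IsRefl (k : U ⟶ P.obj) : Prop where
  src : k ≫ P.src = 𝟙 U
  tgt : k ≫ P.tgt = 𝟙 U
  exists_map : ∃ m : Ut ⟶ P.W, m ≫ P.disp = p ≫ k ∧ m ≫ P.var = 𝟙 Ut ∧ m ≫ P.θ = 𝟙 Ut

/-- The universal isomorphism carried by `P` is itself classified by a map to `Q`. -/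
theorem exists_isMor : ∃ k, IsMor P Q k := by
  obtain ⟨V, v, d, η, hV, hη, hP⟩ := P.exists_inverse
  obtain ⟨k, h₁, h₂, h₃⟩ := Q.exists_lift P.θ η P.isPullback hV P.θ_p hη hP
  exact ⟨k, h₁, h₂, h₃⟩

variable {P Q}

theorem IsMor.comp {R : IsoClassifier p} {k : P.obj ⟶ Q.obj} {l : Q.obj ⟶ R.obj}
    (hk : IsMor P Q k) (hl : IsMor Q R l) : IsMor P R (k ≫ l) := by
  obtain ⟨m, h₁, h₂, h₃⟩ := hk.exists_map
  obtain ⟨n, h₁', h₂', h₃'⟩ := hl.exists_map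
  refine ⟨by rw [Category.assoc, hl.src, hk.src], by rw [Category.assoc, hl.tgt, hk.tgt],
    m ≫ n, ?_, by rw [Category.assoc, h₂', h₂], by rw [Category.assoc, h₃', h₃]⟩
  rw [Category.assoc, h₁', reassoc_of% h₁]

theorem IsMor.id : IsMor P P (𝟙 _) :=
  ⟨Category.id_comp _, Category.id_comp _, 𝟙 _, by simp, by simp, by simp⟩

theorem IsMor.unique {k l : P.obj ⟶ Q.obj} (hk : IsMor P Q k) (hl : IsMor P Q l) : k = l := by
  obtain ⟨m, h₁, h₂, h₃⟩ := hk.exists_map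
  obtain ⟨n, h₁', h₂', h₃'⟩ := hl.exists_map
  exact Q.uniq m n (x := P.var) (dx := P.disp) (by rw [hk.src]; exact P.isPullback)
    (hk.src.trans hl.src.symm) (hk.tgt.trans hl.tgt.symm) h₁ h₂ h₁' h₂' (h₃.trans h₃'.symm)

theorem IsRefl.comp {k : U ⟶ P.obj} {l : P.obj ⟶ Q.obj} (hk : IsRefl P k) (hl : IsMor P Q l) :
    IsRefl Q (k ≫ l) := by
  obtain ⟨m, h₁, h₂, h₃⟩ := hk.exists_map
  obtain ⟨n, h₁', h₂', h₃'⟩ := hl.exists_map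
  refine ⟨by rw [Category.assoc, hl.src, hk.src], by rw [Category.assoc, hl.tgt, hk.tgt],
    m ≫ n, ?_, by rw [Category.assoc, h₂', h₂], by rw [Category.assoc, h₃', h₃]⟩
  rw [Category.assoc, h₁', reassoc_of% h₁]

theorem IsRefl.unique {k l : U ⟶ P.obj} (hk : IsRefl P k) (hl : IsRefl P l) : k = l := by
  obtain ⟨m, h₁, h₂, h₃⟩ := hk.exists_map
  obtain ⟨n, h₁', h₂', h₃'⟩ := hl.exists_map
  exact P.uniq m n (x := 𝟙 Ut) (dx := p) (by rw [hk.src]; exact IsPullback.of_horiz_isIso ⟨by simp⟩)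
    (hk.src.trans hl.src.symm) (hk.tgt.trans hl.tgt.symm) h₁ h₂ h₁' h₂' (h₃.trans h₃'.symm)

variable (P Q)

/-- Any two classifiers of isomorphisms are isomorphic. -/
theorem exists_iso : ∃ e : P.obj ≅ Q.obj, IsMor P Q e.hom ∧ IsMor Q P e.inv := by
  obtain ⟨k, hk⟩ := exists_isMor P Q
  obtain ⟨l, hl⟩ := exists_isMor Q P
  exact ⟨⟨k, l, (hk.comp hl).unique IsMor.id, (hl.comp hk).unique IsMor.id⟩, hk, hl⟩

end IsoClassifier

end

/-! ### The space of equivalences when the reflexivity map is invertible. -/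

section

variable {C : Type u} [Category.{v} C] {F : MorphismProperty C} {Ut U : C} {p : Ut ⟶ U}

theorem PiData.ev_p {B : C} {c e : B ⟶ U} {A : SmallExt p c} {T : SmallExt p (A.disp ≫ e)}
    (D : PiData A.disp T.disp) : D.ev ≫ T.var ≫ p = D.fst ≫ D.π ≫ e := by
  rw [T.isPullback.w, reassoc_of% D.isPi.ev_comp, D.isPi.isPullback.w_assoc]

theorem SmallExt.isSmall {Γ : C} {c : Γ ⟶ U} (A : SmallExt p c) : IsSmall p A.disp :=
  ⟨_, _, A.isPullback⟩

section

variable {D : IdData F p}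

/-- When `r` is invertible, `q` is the diagonal up to isomorphism. Identity types are then
propositions, and an element of one forces strict equality of its endpoints. -/
theorem IdData.q_fst_eq [IsIso D.r] : D.q ≫ D.fst = D.q ≫ D.snd := by
  rw [← cancel_epi D.r, D.r_fst, D.r_snd]

theorem IdData.isIso_q_snd [IsIso D.r] : IsIso (D.q ≫ D.snd) := by
  rw [← IsIso.inv_eq_of_hom_inv_id D.r_snd]
  infer_instance

theorem IdData.mono_q [IsIso D.r] : Mono D.q :=
  have := IdData.isIso_q_snd (D := D)
  mono_of_mono D.q D.snd

variable {Γ : C} {x y : Γ ⟶ Ut} (J : IdType D x y)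

theorem IdType.disp_eq [IsIso D.r] : J.disp ≫ x = J.disp ≫ y := by
  have h₁ : J.disp ≫ x = J.var ≫ D.q ≫ D.fst := by rw [J.isPullback.w_assoc, J.pair_fst]
  have h₂ : J.disp ≫ y = J.var ≫ D.q ≫ D.snd := by rw [J.isPullback.w_assoc, J.pair_snd]
  rw [h₁, h₂, IdData.q_fst_eq]

theorem IdType.mono_disp [IsIso D.r] : Mono J.disp :=
  have := IdData.mono_q (D := D)
  (MorphismProperty.monomorphisms C).of_isPullback J.isPullback this

/-- Conversely, strictly equal terms are identified by reflexivity. -/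
theorem IdType.exists_lift {Γ' : C} (z : Γ' ⟶ Γ) (h : z ≫ x = z ≫ y) :
    ∃ t : Γ' ⟶ J.obj, t ≫ J.disp = z := by
  obtain ⟨t, -, ht⟩ := J.isPullback.exists_lift (z ≫ x ≫ D.r) z (by
    refine D.isPullback.hom_ext ?_ ?_
    · simp only [Category.assoc, D.r_fst, J.pair_fst, Category.comp_id]
    · simp only [Category.assoc, D.r_snd, J.pair_snd, Category.comp_id, h])
  exact ⟨t, ht⟩

/-- Every element of an identity type is reflexivity. This makes the reflexivity clauses of
`IsIdEquiv` automatic. -/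
theorem IdType.comp_var [IsIso D.r] {Γ' : C} (t : Γ' ⟶ J.obj) : t ≫ J.var = t ≫ J.disp ≫ y ≫ D.r := by
  have := IdData.isIso_q_snd (D := D)
  rw [← cancel_mono (D.q ≫ D.snd)]
  simp only [Category.assoc, D.r_snd, J.isPullback.w_assoc, J.pair_snd, Category.comp_id]

end

namespace EquivInterpretation

variable (I : EquivInterpretation F p)

/-- Evaluating the homotopy `∏ b, f (s b) = b` at `n` gives an element of an identity type, so the
equation `f (s b) = b` holds strictly. -/
theorem sec_inverse [IsIso I.Id.r] {Y : C} {n : Y ⟶ I.Bk.total} {s : Y ⟶ I.PiB.obj}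
    (h : n ≫ I.Bk.fst = s ≫ I.PiB.π) : ∃ t : Y ⟶ I.PiB.total, t ≫ I.PiB.fst = s ∧
      t ≫ I.PiB.snd = n ∧ n ≫ I.sb ≫ I.Fn.ev ≫ I.AB.var = n ≫ I.Bk.snd ≫ I.B₁.var := by
  obtain ⟨t, ht, rfl⟩ := I.PiB.isPi.isPullback.exists_lift s n h.symm
  refine ⟨t, ht, rfl, ?_⟩
  rw [← I.PiB.isPi.ev_comp]
  simp only [Category.assoc]
  rw [I.IdB.disp_eq]

theorem ret_inverse [IsIso I.Id.r] {X : C} {a : X ⟶ I.A₂.obj} {s : X ⟶ I.PiA.obj}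
    (h : a ≫ I.A₂.disp = s ≫ I.PiA.π) : ∃ t : X ⟶ I.PiA.total, t ≫ I.PiA.fst = s ∧
      t ≫ I.PiA.snd = a ∧ a ≫ I.bfa ≫ I.Bk.ev ≫ I.BA₁.var = a ≫ I.A₂.var := by
  obtain ⟨t, ht, rfl⟩ := I.PiA.isPi.isPullback.exists_lift s a h.symm
  refine ⟨t, ht, rfl, ?_⟩
  rw [← I.PiA.isPi.ev_comp]
  simp only [Category.assoc]
  rw [I.IdA.disp_eq]

theorem isSmall_Bk_fst : IsSmall p I.Bk.fst :=
  ⟨_, _, I.Bk.isPullback_total.flip⟩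

section

variable (hp : ∀ {Γ : C} (c : Γ ⟶ U), ∃ (W : C) (t : W ⟶ Ut) (d : W ⟶ Γ), IsPullback t d p c)
include hp

theorem mono_PiB [IsIso I.Id.r] : Mono I.PiB.π :=
  have := I.IdB.mono_disp
  I.PiB.mono fun h => exists_pullback_of_isSmall hp I.isSmall_Bk_fst h

theorem mono_PiA [IsIso I.Id.r] : Mono I.PiA.π :=
  have := I.IdA.mono_disp
  I.PiA.mono fun h => exists_pullback_of_isSmall hp I.A₂.isSmall h

end

set_option maxHeartbeats 1000000 in
/-- A right inverse `s ≫ π` and a left inverse `t ≫ π` of the same map agree. -/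
theorem exists_inversePair [IsIso I.Id.r] {Γ X Y : C} {h : Γ ⟶ I.Fn.obj} {s : Γ ⟶ I.PiB.obj}
    {t : Γ ⟶ I.PiA.obj} (hs : s ≫ I.PiB.π ≫ I.Bk.π = h) (ht : t ≫ I.PiA.π ≫ I.Bk.π = h)
    {x : X ⟶ Ut} {dx : X ⟶ Γ} {y : Y ⟶ Ut} {dy : Y ⟶ Γ} (hX : IsPullback x dx p (h ≫ I.Fn.π ≫ I.tyA))
    (hY : IsPullback y dy p (h ≫ I.Fn.π ≫ I.tyB)) :
    s ≫ I.PiB.π = t ≫ I.PiA.π ∧ ∃ (μ : X ⟶ I.Fn.total) (ν : Y ⟶ I.Bk.total),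
      μ ≫ I.Fn.fst = dx ≫ h ∧ μ ≫ I.Fn.snd ≫ I.A.var = x ∧ ν ≫ I.Bk.fst = dy ≫ s ≫ I.PiB.π ∧
      ν ≫ I.Bk.snd ≫ I.B₁.var = y ∧
      InversePair x dx y dy (μ ≫ I.Fn.ev ≫ I.AB.var) (ν ≫ I.Bk.ev ≫ I.BA₁.var) := by
  -- Here `μ` applies `f` to the generic element of `X`, while `ν` and `ν'` apply the right and left
  -- inverse to that of `Y`. Below, `m` and `n` are `f` and the right inverse as maps over `Γ`.
  obtain ⟨μ, hμ₁, hμ₂⟩ := I.Fn.isPullback_total.exists_lift (dx ≫ h) x (by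
    rw [hX.w, Category.assoc])
  obtain ⟨ν, hν₁, hν₂⟩ := I.Bk.isPullback_total.exists_lift (dy ≫ s ≫ I.PiB.π) y (by
    rw [hY.w, ← hs]; simp only [Category.assoc])
  obtain ⟨ν', hν₁', hν₂'⟩ := I.Bk.isPullback_total.exists_lift (dy ≫ t ≫ I.PiA.π) y (by
    rw [hY.w, ← ht]; simp only [Category.assoc])
  have hμ : ∀ {Z : C} {i j : Z ⟶ I.Fn.total}, i ≫ I.Fn.fst = j ≫ I.Fn.fst →
      i ≫ I.Fn.snd ≫ I.A.var = j ≫ I.Fn.snd ≫ I.A.var → i = j := fun h₁ h₂ =>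
    I.Fn.isPullback_total.hom_ext h₁ h₂
  have hν : ∀ {Z : C} {i j : Z ⟶ I.Bk.total}, i ≫ I.Bk.fst = j ≫ I.Bk.fst →
      i ≫ I.Bk.snd ≫ I.B₁.var = j ≫ I.Bk.snd ≫ I.B₁.var → i = j := fun h₁ h₂ =>
    I.Bk.isPullback_total.hom_ext h₁ h₂
  obtain ⟨m, hm₁, hm₂⟩ := hY.exists_lift (μ ≫ I.Fn.ev ≫ I.AB.var) dx (by
    simp only [Category.assoc]
    rw [PiData.ev_p, reassoc_of% hμ₁])
  obtain ⟨n, hn₁, hn₂⟩ := hX.exists_lift (ν ≫ I.Bk.ev ≫ I.BA₁.var) dy (by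
    simp only [Category.assoc]
    rw [PiData.ev_p, reassoc_of% hν₁, ← hs]
    simp only [Category.assoc])
  have hnμ : n ≫ μ = ν ≫ I.sb := by
    refine hμ ?_ ?_
    · rw [Category.assoc, hμ₁, reassoc_of% hn₂, Category.assoc, I.sb_fst, reassoc_of% hν₁, hs]
    · rw [Category.assoc, hμ₂, hn₁, Category.assoc, I.sb_var]
  have hnθ : n ≫ μ ≫ I.Fn.ev ≫ I.AB.var = y := by
    obtain ⟨_, -, -, e⟩ := I.sec_inverse (n := ν) (s := dy ≫ s) (by rw [hν₁, Category.assoc])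
    rw [reassoc_of% hnμ, e, hν₂]
  obtain ⟨a, ha₁, ha₂⟩ := I.A₂.isPullback.exists_lift x (dx ≫ t ≫ I.PiA.π) (by
    rw [hX.w, ← ht]; simp only [Category.assoc])
  have hfa : a ≫ I.fa = μ := by
    refine hμ ?_ ?_
    · rw [Category.assoc, I.fa_fst, reassoc_of% ha₂, ht, hμ₁]
    · rw [Category.assoc, I.fa_var, ha₁, hμ₂]
  have hbfa : a ≫ I.bfa = m ≫ ν' := by
    refine hν ?_ ?_
    · rw [Category.assoc, I.bfa_fst, ha₂, Category.assoc, hν₁', reassoc_of% hm₂]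
    · rw [Category.assoc, I.bfa_var, reassoc_of% hfa, Category.assoc, hν₂', hm₁]
  have hmη : m ≫ ν' ≫ I.Bk.ev ≫ I.BA₁.var = x := by
    obtain ⟨_, -, -, e⟩ := I.ret_inverse (a := a) (s := dx ≫ t) (by rw [ha₂, Category.assoc])
    rw [← reassoc_of% hbfa, e, ha₁]
  have hnm : n ≫ m = 𝟙 Y := by
    refine hY.hom_ext ?_ ?_
    · rw [Category.assoc, hm₁, hnθ, Category.id_comp]
    · rw [Category.assoc, hm₂, hn₂, Category.id_comp]
  -- The usual computation `r b = r (f (s b)) = s b`.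
  have hη : ν' ≫ I.Bk.ev ≫ I.BA₁.var = ν ≫ I.Bk.ev ≫ I.BA₁.var := by
    rw [← hn₁, ← hmη, reassoc_of% hnm]
  have hst : s ≫ I.PiB.π = t ≫ I.PiA.π := by
    refine (I.Bk.existsUnique_fun h hY (ν ≫ I.Bk.ev ≫ I.BA₁.var) ?_).unique
      ⟨by rw [Category.assoc, hs], ν, hν₁, hν₂, rfl⟩ ⟨by rw [Category.assoc, ht], ν', hν₁', hν₂', hη⟩
    rw [← hn₁, Category.assoc, hX.w, reassoc_of% hn₂]
  exact ⟨hst, μ, ν, hμ₁, hμ₂, hν₁, hν₂, ⟨m, hm₁, hm₂, by rw [← hη, hmη]⟩, n, hn₁, hn₂, hnθ⟩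

/-- Mutually inverse maps assemble to a point of `E`: `v` gives the function, `w` serves both as
section and as retraction, and the two homotopies are reflexivities. -/
theorem exists_map {Γ X Y : C} {a b : Γ ⟶ U} {x : X ⟶ Ut} {dx : X ⟶ Γ} {y : Y ⟶ Ut} {dy : Y ⟶ Γ}
    (v : X ⟶ Ut) (w : Y ⟶ Ut) (hX : IsPullback x dx p a) (hY : IsPullback y dy p b)
    (hv : v ≫ p = dx ≫ b) (hw : w ≫ p = dy ≫ a) (H : InversePair x dx y dy v w) :
    ∃ k : Γ ⟶ I.E, k ≫ I.proj ≫ I.tyA = a ∧ k ≫ I.proj ≫ I.tyB = b ∧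
      ∃ μ : X ⟶ I.Fn.total, μ ≫ I.Fn.fst = dx ≫ k ≫ I.toFn ∧ μ ≫ I.Fn.snd ≫ I.A.var = x ∧
        μ ≫ I.Fn.ev ≫ I.AB.var = v := by
  obtain ⟨γ, rfl, rfl⟩ : ∃ γ : Γ ⟶ I.UU, γ ≫ I.tyA = a ∧ γ ≫ I.tyB = b :=
    ⟨I.isLimit.lift (BinaryFan.mk a b), I.isLimit.fac (BinaryFan.mk a b) ⟨WalkingPair.left⟩,
      I.isLimit.fac (BinaryFan.mk a b) ⟨WalkingPair.right⟩⟩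
  obtain ⟨⟨m, hm₁, hm₂, hm₃⟩, n, hn₁, hn₂, hn₃⟩ := H
  obtain ⟨f, ⟨rfl, μ, hμ₁, hμ₂, hμ₃⟩, -⟩ := I.Fn.existsUnique_fun γ hX v hv
  simp only [Category.assoc] at hX hY hv hw
  obtain ⟨s, ⟨rfl, ν, hν₁, hν₂, hν₃⟩, -⟩ := I.Bk.existsUnique_fun f hY w hw
  have hnμ : n ≫ μ = ν ≫ I.sb := by
    refine I.Fn.isPullback_total.hom_ext ?_ ?_
    · rw [Category.assoc, hμ₁, reassoc_of% hn₂, Category.assoc, I.sb_fst, reassoc_of% hν₁]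
    · rw [Category.assoc, hμ₂, hn₁, Category.assoc, I.sb_var, hν₃]
  obtain ⟨α, hα₁, hα₂⟩ := I.A₂.isPullback.exists_lift x (dx ≫ s) (by
    rw [hX.w]; simp only [Category.assoc])
  have hfa : α ≫ I.fa = μ := by
    refine I.Fn.isPullback_total.hom_ext ?_ ?_
    · rw [Category.assoc, I.fa_fst, reassoc_of% hα₂, hμ₁]
    · rw [Category.assoc, I.fa_var, hα₁, hμ₂]
  have hbfa : α ≫ I.bfa = m ≫ ν := by
    refine I.Bk.isPullback_total.hom_ext ?_ ?_
    · rw [Category.assoc, I.bfa_fst, hα₂, Category.assoc, hν₁, reassoc_of% hm₂]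
    · rw [Category.assoc, I.bfa_var, reassoc_of% hfa, Category.assoc, hν₂, hm₁, hμ₃]
  obtain ⟨tB, htB⟩ := I.IdB.exists_lift ν (by
    rw [← reassoc_of% hnμ, hμ₃, hn₃, hν₂])
  obtain ⟨tA, htA⟩ := I.IdA.exists_lift α (by
    rw [reassoc_of% hbfa, hν₃, hm₃, hα₁])
  obtain ⟨kB, hkB⟩ := I.PiB.exists_of_mono (IsPullback.of_bot (h₁₁ := dy) (v₁₁ := ν)
    (by rw [hν₂]; simpa only [Category.assoc] using hY.flip) hν₁.symm I.Bk.isPullback_total) tB htB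
  obtain ⟨kA, hkA⟩ := I.PiA.exists_of_mono (IsPullback.of_bot (h₁₁ := dx) (v₁₁ := α)
    (by rw [hα₁]; simpa only [Category.assoc] using hX.flip) hα₂.symm I.A₂.isPullback.flip) tA htA
  obtain ⟨k, hk₁, hk₂⟩ := I.isPullback.exists_lift kB kA (by
    rw [reassoc_of% hkB, reassoc_of% hkA])
  have hk : k ≫ I.toFn = s ≫ I.Bk.π := by
    rw [toFn, reassoc_of% hk₁, reassoc_of% hkB]
  refine ⟨k, ?_, ?_, μ, by rw [hμ₁, hk], hμ₂, hμ₃⟩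
  · simp only [proj, Category.assoc, reassoc_of% hk]
  · simp only [proj, Category.assoc, reassoc_of% hk]

/-- Being an equivalence is a proposition. The section of either point agrees with the retraction of
either point, since both invert the same function, and the homotopies carry no information. -/
theorem hom_ext [IsIso I.Id.r]
    (hp : ∀ {Γ : C} (c : Γ ⟶ U), ∃ (W : C) (t : W ⟶ Ut) (d : W ⟶ Γ), IsPullback t d p c) {Γ : C}
    {k k' : Γ ⟶ I.E} (h : k ≫ I.toFn = k' ≫ I.toFn) : k = k' := by
  obtain ⟨X, x, dx, hX⟩ := hp ((k ≫ I.toFn) ≫ I.Fn.π ≫ I.tyA)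
  obtain ⟨Y, y, dy, hY⟩ := hp ((k ≫ I.toFn) ≫ I.Fn.π ≫ I.tyB)
  have hs : ∀ l : Γ ⟶ I.E, (l ≫ I.sec) ≫ I.PiB.π ≫ I.Bk.π = l ≫ I.toFn := fun l => by
    simp only [toFn, Category.assoc]
  have ht : ∀ l : Γ ⟶ I.E, (l ≫ I.ret) ≫ I.PiA.π ≫ I.Bk.π = l ≫ I.toFn := fun l => by
    simp only [toFn, Category.assoc, I.isPullback.w]
  have h₁ := (I.exists_inversePair (hs k) ((ht k').trans h.symm) hX hY).1
  have h₂ := (I.exists_inversePair ((hs k').trans h.symm) ((ht k').trans h.symm) hX hY).1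
  have h₃ := (I.exists_inversePair (hs k) (ht k) hX hY).1
  have := I.mono_PiA hp
  have := I.mono_PiB hp
  refine I.isPullback.hom_ext ?_ ?_
  · rw [← cancel_mono I.PiB.π, h₁, h₂]
  · rw [← cancel_mono I.PiA.π, ← h₃, h₁]

/-- If identity types are propositions, identity equivalences are recognized by the underlying
function. -/
theorem isIdEquiv_iff [IsIso I.Id.r] {k : U ⟶ I.E} : I.IsIdEquiv k ↔
    k ≫ I.proj ≫ I.tyA = 𝟙 U ∧ k ≫ I.proj ≫ I.tyB = 𝟙 U ∧ ∃ x : Ut ⟶ I.Fn.total,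
      x ≫ I.Fn.fst = p ≫ k ≫ I.toFn ∧ x ≫ I.Fn.snd ≫ I.A.var = 𝟙 Ut ∧
        x ≫ I.Fn.ev ≫ I.AB.var = 𝟙 Ut := by
  refine ⟨fun H => ⟨H.tyA, H.tyB, H.fn⟩, ?_⟩
  rintro ⟨h₁, h₂, x, hx₁, hx₂, hx₃⟩
  have hUt : IsPullback (𝟙 Ut) p p (𝟙 U) := IsPullback.of_horiz_isIso ⟨by simp⟩
  have hs : (k ≫ I.sec) ≫ I.PiB.π ≫ I.Bk.π = k ≫ I.toFn := by simp only [toFn, Category.assoc]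
  have ht : (k ≫ I.ret) ≫ I.PiA.π ≫ I.Bk.π = k ≫ I.toFn := by
    simp only [toFn, Category.assoc, I.isPullback.w]
  have h₁' : (k ≫ I.toFn) ≫ I.Fn.π ≫ I.tyA = 𝟙 U := by
    simpa only [proj, Category.assoc] using h₁
  have h₂' : (k ≫ I.toFn) ≫ I.Fn.π ≫ I.tyB = 𝟙 U := by
    simpa only [proj, Category.assoc] using h₂
  obtain ⟨hb, μ, ν, hμ₁, hμ₂, hν₁, hν₂, -, n, hn₁, hn₂, hn₃⟩ :=
    I.exists_inversePair (x := 𝟙 Ut) (dx := p) (y := 𝟙 Ut) (dy := p) hs ht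
    (by rw [h₁']; exact hUt) (by rw [h₂']; exact hUt)
  obtain rfl : x = μ := I.Fn.isPullback_total.hom_ext (hx₁.trans hμ₁.symm) (hx₂.trans hμ₂.symm)
  -- The inverse `n` of the identity function is forced to be the identity, so the section and
  -- retraction components are identities too.
  rw [hx₃, Category.comp_id] at hn₃
  rw [Category.comp_id, hn₃] at hn₁
  simp only [Category.assoc] at hb hν₁
  refine ⟨h₁, h₂, ⟨x, hx₁, hx₂, hx₃⟩, ⟨ν, hν₁, hν₂, hn₁.symm⟩, ?_,
    ⟨ν, by rw [hν₁, hb], hν₂, hn₁.symm⟩, ?_⟩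
  · obtain ⟨t, ht₁, ht₂, -⟩ := I.sec_inverse (n := ν) (s := p ≫ k ≫ I.sec)
      (by simpa only [Category.assoc] using hν₁)
    refine ⟨t, ht₁, by rw [reassoc_of% ht₂, hν₂], ?_⟩
    rw [← Category.assoc, IdType.comp_var, Category.assoc, reassoc_of% I.PiB.isPi.ev_comp,
      reassoc_of% ht₂, Category.assoc, reassoc_of% hν₂]
  · obtain ⟨a, ha₁, ha₂⟩ := I.A₂.isPullback.exists_lift (𝟙 Ut) (p ≫ k ≫ I.ret ≫ I.PiA.π) (by
      simp only [Category.assoc] at ht h₁' ⊢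
      rw [Category.id_comp, reassoc_of% ht, h₁', Category.comp_id])
    obtain ⟨t, ht₁, ht₂, -⟩ := I.ret_inverse (a := a) (s := p ≫ k ≫ I.ret)
      (by simpa only [Category.assoc] using ha₂)
    refine ⟨t, ht₁, by rw [reassoc_of% ht₂, ha₁], ?_⟩
    rw [← Category.assoc, IdType.comp_var, Category.assoc, reassoc_of% I.PiA.isPi.ev_comp,
      reassoc_of% ht₂, reassoc_of% ha₁]

set_option maxHeartbeats 1000000 in
/-- The space of equivalences classifies isomorphisms if identity types are propositions. -/
theorem exists_isoClassifier [IsIso I.Id.r]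
    (hp : ∀ {Γ : C} (c : Γ ⟶ U), ∃ (W : C) (t : W ⟶ Ut) (d : W ⟶ Γ), IsPullback t d p c) :
    ∃ (P : IsoClassifier p) (e : P.obj ≅ I.E), e.hom ≫ I.proj ≫ I.tyA = P.src ∧
      e.hom ≫ I.proj ≫ I.tyB = P.tgt ∧ ∀ k : U ⟶ P.obj, I.IsIdEquiv (k ≫ e.hom) ↔ P.IsRefl k := by
  obtain ⟨W, var, disp, hW⟩ := hp (I.toFn ≫ I.Fn.π ≫ I.tyA)
  obtain ⟨V, v, d, hV⟩ := hp (I.toFn ≫ I.Fn.π ≫ I.tyB)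
  have ht : I.ret ≫ I.PiA.π ≫ I.Bk.π = I.toFn := I.isPullback.w.symm
  -- The generic point of `E` carries the universal pair of inverse maps; its two halves become `θ`
  -- and its inverse.
  obtain ⟨hsr, μ, ν, hμ₁, hμ₂, hν₁, hν₂, hI⟩ := I.exists_inversePair (h := I.toFn) rfl ht hW hV
  refine ⟨{ obj := I.E, src := I.proj ≫ I.tyA, tgt := I.proj ≫ I.tyB, W := W, var := var
            disp := disp, isPullback := by simpa only [proj, Category.assoc] using hW
            θ := μ ≫ I.Fn.ev ≫ I.AB.var
            θ_p := ?_
            exists_inverse := ⟨V, v, d, ν ≫ I.Bk.ev ≫ I.BA₁.var,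
              by simpa only [proj, Category.assoc] using hV, ?_, hI⟩
            exists_lift := ?_
            uniq := ?_ }, Iso.refl _, Category.id_comp _, Category.id_comp _, fun k => ?_⟩
  · simp only [Category.assoc, PiData.ev_p, reassoc_of% hμ₁, proj]
  · simp only [Category.assoc, PiData.ev_p, reassoc_of% hν₁, proj, toFn]
  · intro Γ X Y a b x dx y dy v w hX hY hv hw H
    obtain ⟨k, hk₁, hk₂, μ', hμ₁', hμ₂', hμ₃'⟩ := I.exists_map v w hX hY hv hw H
    obtain ⟨m, hm₁, hm₂⟩ := hW.exists_lift x (dx ≫ k) (by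
      rw [hX.w, ← hk₁]; simp only [proj, Category.assoc])
    refine ⟨k, hk₁, hk₂, m, hm₂, hm₁, ?_⟩
    have : m ≫ μ = μ' := by
      refine I.Fn.isPullback_total.hom_ext ?_ ?_
      · rw [Category.assoc, hμ₁, reassoc_of% hm₂, hμ₁']
      · rw [Category.assoc, hμ₂, hm₁, hμ₂']
    rw [reassoc_of% this, hμ₃']
  · intro Γ X k k' x dx m m' hX h₁ h₂ hm₁ hm₂ hm₁' hm₂' hθ
    have hγ : k ≫ I.proj = k' ≫ I.proj := BinaryFan.IsLimit.hom_ext I.isLimit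
      ((Category.assoc _ _ _).trans (h₁.trans (Category.assoc _ _ _).symm))
      ((Category.assoc _ _ _).trans (h₂.trans (Category.assoc _ _ _).symm))
    refine I.hom_ext hp ?_
    refine (I.Fn.existsUnique_fun (k ≫ I.proj) (by simpa only [Category.assoc] using hX)
      (m ≫ μ ≫ I.Fn.ev ≫ I.AB.var) ?_).unique
      ⟨by rw [Category.assoc]; rfl, m ≫ μ, ?_, ?_, by simp only [Category.assoc]⟩
      ⟨by rw [Category.assoc, hγ]; rfl, m' ≫ μ, ?_, ?_, by rw [hθ]; simp only [Category.assoc]⟩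
    · simp only [Category.assoc, PiData.ev_p, reassoc_of% hμ₁, reassoc_of% hm₁, proj]
    · rw [Category.assoc, hμ₁, reassoc_of% hm₁]
    · rw [Category.assoc, hμ₂, hm₂]
    · rw [Category.assoc, hμ₁, reassoc_of% hm₁']
    · rw [Category.assoc, hμ₂, hm₂']
  · change U ⟶ I.E at k
    change I.IsIdEquiv (k ≫ 𝟙 I.E) ↔ _
    rw [Category.comp_id, isIdEquiv_iff]
    constructor
    · rintro ⟨h₁, h₂, x, hx₁, hx₂, hx₃⟩
      obtain ⟨m, hm₁, hm₂⟩ := hW.exists_lift (𝟙 Ut) (p ≫ k) (by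
        have : k ≫ I.toFn ≫ I.Fn.π ≫ I.tyA = 𝟙 U := by simpa [proj] using h₁
        rw [Category.assoc, this, Category.id_comp, Category.comp_id])
      have : m ≫ μ = x := by
        refine I.Fn.isPullback_total.hom_ext ?_ ?_
        · rw [Category.assoc, hμ₁, reassoc_of% hm₂, hx₁]
        · rw [Category.assoc, hμ₂, hm₁, hx₂]
      exact ⟨h₁, h₂, m, hm₂, hm₁, by rw [reassoc_of% this, hx₃]⟩
    · rintro ⟨h₁, h₂, H⟩
      obtain ⟨m, hm₁, hm₂, hm₃⟩ : ∃ m : Ut ⟶ W, m ≫ disp = p ≫ k ∧ m ≫ var = 𝟙 Ut ∧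
        m ≫ μ ≫ I.Fn.ev ≫ I.AB.var = 𝟙 Ut := H
      exact ⟨h₁, h₂, m ≫ μ, by rw [Category.assoc, hμ₁, reassoc_of% hm₁],
        by rw [Category.assoc, hμ₂, hm₂], (Category.assoc _ _ _).trans hm₃⟩

end EquivInterpretation

end

/-! ### Homotopy equivalences and the existence of interpretations. -/

section

variable {C : Type u} [Category.{v} C] {F : MorphismProperty C} {Ut U : C} {p : Ut ⟶ U}

namespace IsTypeTheoreticFibrationCategory

variable (hF : IsTypeTheoreticFibrationCategory F)
include hF

theorem exists_terminal : ∃ T : C, Nonempty (IsTerminal T) := by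
  have := hF.hasTerminal
  exact ⟨⊤_ C, ⟨terminalIsTerminal⟩⟩

theorem exists_prod (X Y : C) : ∃ (P : C) (fst : P ⟶ X) (snd : P ⟶ Y),
    Nonempty (IsLimit (BinaryFan.mk fst snd)) := by
  obtain ⟨T, ⟨hT⟩⟩ := hF.exists_terminal
  obtain ⟨P, fst, snd, h⟩ := hF.exists_pullback (hT.from X) (hT.from Y) (hF.to_terminal _ ⟨hT⟩)
  exact ⟨P, fst, snd, ⟨BinaryFan.IsLimit.mk _ (fun f g => h.lift f g (hT.hom_ext _ _))
    (fun f g => h.lift_fst f g _) (fun f g => h.lift_snd f g _)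
    (fun f g m hf hg => h.hom_ext (hf.trans (h.lift_fst f g _).symm)
      (hg.trans (h.lift_snd f g _).symm))⟩⟩

theorem exists_pathData (X : C) : Nonempty (PathData F X) := by
  obtain ⟨P, fst, snd, ⟨h⟩⟩ := hF.exists_prod X X
  obtain ⟨d, hd₁, hd₂⟩ := BinaryFan.IsLimit.lift' h (𝟙 X) (𝟙 X)
  obtain ⟨Z, r, q, hr, hq, rfl⟩ := hF.factorization d
  exact ⟨⟨P, fst, snd, h, Z, r, q, hr, hq, by simpa using hd₁, by simpa using hd₂⟩⟩

theorem rightHomotopic_refl {A X : C} (f : A ⟶ X) : RightHomotopic F f f := by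
  obtain ⟨D⟩ := hF.exists_pathData X
  exact ⟨D, f ≫ D.r, by rw [Category.assoc, D.r_fst, Category.comp_id],
    by rw [Category.assoc, D.r_snd, Category.comp_id]⟩

/-- Acyclic cofibrations are homotopy equivalences. -/
theorem isHomotopyEquivalence_of_llp {X Y : C} {k : X ⟶ Y} (hk : F.llp k) :
    IsHomotopyEquivalence F k := by
  obtain ⟨T, ⟨hT⟩⟩ := hF.exists_terminal
  have := hk _ (hF.to_terminal (hT.from X) ⟨hT⟩)
  -- Lifting against `X ⟶ 1` gives a retraction of `k`; lifting against the path fibration of `Y`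
  -- then gives the homotopy.
  have sq : CommSq (𝟙 X) k (hT.from X) (hT.from Y) := ⟨hT.hom_ext _ _⟩
  refine ⟨sq.lift, ?_, by rw [sq.fac_left]; exact hF.rightHomotopic_refl _⟩
  obtain ⟨D⟩ := hF.exists_pathData Y
  obtain ⟨d, hd₁, hd₂⟩ : ∃ d : Y ⟶ D.prod, d ≫ D.fst = sq.lift ≫ k ∧ d ≫ D.snd = 𝟙 Y :=
    let l := BinaryFan.IsLimit.lift' D.isLimit (sq.lift ≫ k) (𝟙 Y)
    ⟨l.1, l.2⟩
  have := hk _ D.fibration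
  have sq' : CommSq (k ≫ D.r) k D.q d := ⟨by
    have h₁ : (k ≫ D.r) ≫ D.q ≫ D.fst = k ≫ d ≫ D.fst := by
      rw [hd₁, ← Category.assoc k sq.lift, sq.fac_left, Category.assoc, D.r_fst, Category.comp_id,
        Category.id_comp]
    have h₂ : (k ≫ D.r) ≫ D.q ≫ D.snd = k ≫ d ≫ D.snd := by
      rw [hd₂, Category.assoc, D.r_snd]
    exact BinaryFan.IsLimit.hom_ext D.isLimit (by simpa using h₁) (by simpa using h₂)⟩
  refine ⟨D, sq'.lift, ?_, ?_⟩
  · rw [← Category.assoc, sq'.fac_right, hd₁]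
  · rw [← Category.assoc, sq'.fac_right, hd₂]

theorem fibration_of_isSmall (hp : IsUniverse F p) {X Y : C} {f : X ⟶ Y} (hf : IsSmall p f) :
    F f := by
  obtain ⟨t, c, h⟩ := hf
  exact hF.pullback t f p c h hp.fibration

theorem exists_smallExt (hp : IsUniverse F p) {Γ : C} (c : Γ ⟶ U) : Nonempty (SmallExt p c) := by
  obtain ⟨W, t, d, h⟩ := hF.exists_pullback p c hp.fibration
  exact ⟨⟨W, d, t, h⟩⟩

theorem exists_piData {X A B : C} {g : A ⟶ B} {f : X ⟶ A} (hg : F g) (hf : F f) :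
    ∃ D : PiData g f, F D.π := by
  obtain ⟨P, P', q, fst, snd, ev, hq, h⟩ := hF.exists_pi g f hg hf
  exact ⟨⟨P, q, P', fst, snd, ev, h⟩, hq⟩

theorem exists_idData (hp : IsUniverse F p) : Nonempty (IdData F p) := by
  obtain ⟨P, fst, snd, h⟩ := hF.exists_pullback p p hp.fibration
  obtain ⟨d, hd₁, hd₂⟩ := h.exists_lift (𝟙 Ut) (𝟙 Ut) rfl
  have hps : IsSmall p p := ⟨𝟙 _, 𝟙 _, IsPullback.of_horiz_isIso ⟨by simp⟩⟩
  -- The diagonal of `p` is a map between small types over `U`, so it factors with a small second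
  -- map.
  obtain ⟨Z, r, q, hr, hq, rfl⟩ := hp.factorization p (snd ≫ p) d hps
    (hp.comp _ _ ⟨_, _, h⟩ hps) (by rw [reassoc_of% hd₂])
  exact ⟨⟨P, fst, snd, h, Z, r, q, hr, hq, by simpa using hd₁, by simpa using hd₂⟩⟩

theorem exists_idType (hp : IsUniverse F p) (D : IdData F p) {Γ : C} (x y : Γ ⟶ Ut)
    (h : x ≫ p = y ≫ p) : ∃ J : IdType D x y, F J.disp := by
  obtain ⟨d, hd₁, hd₂⟩ := D.isPullback.exists_lift x y h
  have hq := hF.fibration_of_isSmall hp D.small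
  obtain ⟨W, t, e, hW⟩ := hF.exists_pullback D.q d hq
  exact ⟨⟨d, hd₁, hd₂, W, e, t, hW⟩, hF.pullback _ _ _ _ hW hq⟩

theorem exists_equivInterpretation (hp : IsUniverse F p) : Nonempty (EquivInterpretation F p) := by
  have hS : ∀ {Γ : C} {c : Γ ⟶ U} (A : SmallExt p c), F A.disp := fun A =>
    hF.pullback _ _ _ _ A.isPullback hp.fibration
  obtain ⟨UU, tyA, tyB, ⟨h⟩⟩ := hF.exists_prod U U
  obtain ⟨Id⟩ := hF.exists_idData hp
  obtain ⟨A⟩ := hF.exists_smallExt hp tyA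
  obtain ⟨AB⟩ := hF.exists_smallExt hp (A.disp ≫ tyB)
  obtain ⟨Fn, -⟩ := hF.exists_piData (hS A) (hS AB)
  obtain ⟨B₁⟩ := hF.exists_smallExt hp (Fn.π ≫ tyB)
  obtain ⟨BA₁⟩ := hF.exists_smallExt hp (B₁.disp ≫ Fn.π ≫ tyA)
  obtain ⟨Bk, hBk⟩ := hF.exists_piData (hS B₁) (hS BA₁)
  obtain ⟨sb, sb_fst, sb_var⟩ := Fn.isPullback_total.exists_lift (Bk.fst ≫ Bk.π)
    (Bk.ev ≫ BA₁.var) (by simp only [Category.assoc, PiData.ev_p])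
  obtain ⟨IdB, hIdB⟩ := hF.exists_idType hp Id (sb ≫ Fn.ev ≫ AB.var) (Bk.snd ≫ B₁.var) (by
    simp only [Category.assoc, PiData.ev_p, B₁.isPullback.w]
    rw [reassoc_of% sb_fst, Bk.isPi.isPullback.w_assoc])
  obtain ⟨PiB, hPiB⟩ := hF.exists_piData (hF.pullback _ _ _ _ Bk.isPullback_total.flip
    hp.fibration) hIdB
  obtain ⟨A₂⟩ := hF.exists_smallExt hp (Bk.π ≫ Fn.π ≫ tyA)
  obtain ⟨fa, fa_fst, fa_var⟩ := Fn.isPullback_total.exists_lift (A₂.disp ≫ Bk.π) A₂.var (by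
    simp only [Category.assoc, A₂.isPullback.w])
  obtain ⟨bfa, bfa_fst, bfa_var⟩ := Bk.isPullback_total.exists_lift A₂.disp
    (fa ≫ Fn.ev ≫ AB.var) (by simp only [Category.assoc, PiData.ev_p, reassoc_of% fa_fst])
  obtain ⟨IdA, hIdA⟩ := hF.exists_idType hp Id (bfa ≫ Bk.ev ≫ BA₁.var) A₂.var (by
    simp only [Category.assoc, PiData.ev_p, A₂.isPullback.w, reassoc_of% bfa_fst])
  obtain ⟨PiA, hPiA⟩ := hF.exists_piData (hS A₂) hIdA
  obtain ⟨E, sec, ret, hE⟩ := hF.exists_pullback (PiB.π ≫ Bk.π) (PiA.π ≫ Bk.π)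
    (hF.comp _ _ hPiB hBk)
  exact ⟨{ UU, tyA, tyB, isLimit := h, Id, A, AB, Fn, B₁, BA₁, Bk, sb, sb_fst, sb_var, IdB, PiB, A₂,
           fa, fa_fst, fa_var, bfa, bfa_fst, bfa_var, IdA, PiA, E, sec, ret, isPullback := hE }⟩

end IsTypeTheoreticFibrationCategory

end

theorem HasUniqueLifts.functor_ext_obj {X Y L : Type w} [Groupoid.{w} X] [Groupoid.{w} Y]
    [Groupoid.{w} L] {F : X ⥤ Y} (hF : HasUniqueLifts F) {h h' : L ⥤ X}
    (h₁ : ∀ l, h.obj l = h'.obj l) (h₂ : h ⋙ F = h' ⋙ F) : h = h' :=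
  CategoryTheory.Functor.hext h₁ fun l _ f =>
    (hF (h.map f) (h'.map f) (h₁ l) (Functor.congr_obj h₂ _) (Functor.hcongr_hom h₂ f)).2

/-! ### Lifting paths along coverings. -/

namespace PathGrpd

variable {A B : Type w} [Groupoid.{w} A] [Groupoid.{w} B]

theorem ext_heq {X Y : PathGrpd A} (h₁ : X.src = Y.src) (h₂ : X.tgt = Y.tgt) (h : X.arr ≍ Y.arr) :
    X = Y := by
  obtain ⟨x, x', φ⟩ := X
  obtain ⟨y, y', ψ⟩ := Y
  obtain rfl : x = y := h₁
  obtain rfl : x' = y' := h₂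
  obtain rfl : φ = ψ := eq_of_heq h
  rfl

theorem arr_heq {X Y : PathGrpd A} (h : X = Y) : X.arr ≍ Y.arr := by rw [h]

theorem hom_ext_tgt {X Y : PathGrpd A} {f g : X ⟶ Y} (h : f.τ = g.τ) : f = g := by
  refine Hom.ext ?_ h
  rw [← cancel_mono Y.arr, arr_comp, arr_comp, h]

theorem inv_inv_arr {x y : A} (φ : x ⟶ y) : Groupoid.inv (Groupoid.inv φ) = φ := by
  simp [Groupoid.inv_eq_inv]

theorem eq_inv_comp {x x' y y' : A} {σ : x ⟶ x'} {τ : y ⟶ y'} {φ : x ⟶ y} {ψ : x' ⟶ y'}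
    (h : σ ≫ ψ = φ ≫ τ) : ψ = Groupoid.inv σ ≫ φ ≫ τ := by
  rw [← h]; simp

/-- The morphism of paths with a given action on the sources. -/
def homOfSrc {X Y : PathGrpd A} (φ : X.src ⟶ Y.src) : X ⟶ Y :=
  ⟨φ, Groupoid.inv X.arr ≫ φ ≫ Y.arr, by simp⟩

/-- The morphism of paths with a given action on the targets. -/
def homOfTgt {X Y : PathGrpd A} (φ : X.tgt ⟶ Y.tgt) : X ⟶ Y :=
  ⟨X.arr ≫ φ ≫ Groupoid.inv Y.arr, φ, by simp [Groupoid.inv_eq_inv]⟩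

/-- Paths lift uniquely along coverings, given a lift of their source. -/
theorem isStrictPullback_src {F : A ⥤ B} (hF : IsCovering F) :
    IsStrictPullback (srcFunctor A) (map F) F (srcFunctor B) where
  comm := rfl
  exists_obj x Y h := by
    obtain ⟨x', φ, h₁, h₂⟩ := hF.isIsofibration.lift h Y.arr
    exact ⟨⟨x, x', φ⟩, rfl, ext_heq h h₁ h₂⟩
  obj_ext {X Y} h₁ h₂ := by
    obtain ⟨h₃, h₄⟩ := hF.hasUniqueLifts X.arr Y.arr h₁ (congrArg PathGrpd.tgt h₂) (arr_heq h₂)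
    exact ext_heq h₁ h₃ h₄
  exists_map {X Y} φ ψ h :=
    ⟨homOfSrc φ, rfl, hom_ext_src (eq_of_heq h)⟩
  map_ext h₁ _ := hom_ext_src h₁

/-- Paths lift uniquely along coverings, given a lift of their target. -/
theorem isStrictPullback_tgt {F : A ⥤ B} (hF : IsCovering F) :
    IsStrictPullback (tgtFunctor A) (map F) F (tgtFunctor B) where
  comm := rfl
  exists_obj x Y h := by
    obtain ⟨x', φ, h₁, h₂⟩ := hF.isIsofibration.lift h (Groupoid.inv Y.arr)
    exact ⟨⟨x', x, Groupoid.inv φ⟩, rfl, ext_heq h₁ h (by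
      exact (heq_of_eq (map_groupoidInv F φ)).trans ((inv_heq_inv h h₁ h₂).trans
        (heq_of_eq (inv_inv_arr Y.arr))))⟩
  obj_ext {X Y} h₁ h₂ := by
    have h₅ := congrArg PathGrpd.src h₂
    have h₆ := congrArg PathGrpd.tgt h₂
    obtain ⟨h₃, h₄⟩ := hF.hasUniqueLifts (Groupoid.inv X.arr) (Groupoid.inv Y.arr) h₁ h₅ (by
      rw [map_groupoidInv, map_groupoidInv]
      exact inv_heq_inv h₅ h₆ (arr_heq h₂))
    refine ext_heq h₃ h₁ ?_
    exact (heq_of_eq (inv_inv_arr X.arr).symm).trans ((inv_heq_inv h₁ h₃ h₄).trans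
      (heq_of_eq (inv_inv_arr Y.arr)))
  exists_map {X Y} φ ψ h :=
    ⟨homOfTgt φ, rfl, hom_ext_tgt (eq_of_heq h)⟩
  map_ext h₁ _ := hom_ext_tgt h₁

end PathGrpd

namespace InvGrpd

/-- The action of a morphism on path objects. -/
def pathMap {A B : InvGrpd.{w}} (f : A ⟶ B) : path A ⟶ path B :=
  ⟨PathGrpd.map (under f), congrArg (fun F : A.carrier ⥤ B.carrier => PathGrpd.map F)
    (invol_under f)⟩

end InvGrpd

/-! ### Paths in `UΔ` as isomorphisms between small types. -/

section Universe

variable {κ : Cardinal.{u}}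

/-- A path in `UtΔ κ` transports its point along its projection to `UΔ κ`. -/
theorem tgt_of_map_eq {M : PathGrpd (UtObj κ)} {K : PathGrpd (UObj κ)}
    (h : (PathGrpd.map (A := UtObj κ) (B := UObj κ) (InvGrpd.under (pΔ κ))).obj M = K) {s : K.src.A₀.1}
    (hs : M.src = ⟨K.src, s⟩) : M.tgt = ⟨K.tgt, UHom.ρ₀ K.arr s⟩ := by
  subst h
  obtain ⟨⟨A, a⟩, ⟨B, b⟩, ⟨φ, hφ⟩⟩ := M
  obtain rfl : a = s := by
    have : (⟨A, a⟩ : UtObj κ) = ⟨A, s⟩ := hs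
    exact eq_of_heq (UtObj.mk.inj this).2
  exact congrArg (UtObj.mk B) hφ.symm

theorem UtObj.mk_injective {A : UObj κ} {s t : A.A₀.1} (h : (⟨A, s⟩ : UtObj κ) = ⟨A, t⟩) :
    s = t :=
  eq_of_heq (UtObj.mk.inj h).2

variable {Γ X Y : InvGrpd.{u + 1}}

/-- A map to the path object is determined by its two ends and its arrows. An arrow of `UΔ` is
determined by its action on points, and the targets of the lifted paths `m` and `m'` record that
action. -/
theorem path_hom_ext {k k' : Γ ⟶ InvGrpd.path (UΔ κ)} {dx : X ⟶ Γ} {x : X ⟶ UtΔ κ}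
    (hX : IsStrictPullback (InvGrpd.under x) (InvGrpd.under dx) (InvGrpd.under (pΔ κ))
      (InvGrpd.under (k ≫ InvGrpd.pathSrc _))) (h₁ : k ≫ InvGrpd.pathSrc _ = k' ≫ InvGrpd.pathSrc _)
    (h₂ : k ≫ InvGrpd.pathTgt _ = k' ≫ InvGrpd.pathTgt _) {m m' : X ⟶ InvGrpd.path (UtΔ κ)}
    (hm : m ≫ InvGrpd.pathMap (pΔ κ) = dx ≫ k) (hm' : m' ≫ InvGrpd.pathMap (pΔ κ) = dx ≫ k')
    (hx : m ≫ InvGrpd.pathSrc _ = x) (hx' : m' ≫ InvGrpd.pathSrc _ = x)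
    (h : m ≫ InvGrpd.pathTgt _ = m' ≫ InvGrpd.pathTgt _) : k = k' := by
  have hs := fun y => Functor.congr_obj (congrArg InvGrpd.under h₁) y
  have ht := fun y => Functor.congr_obj (congrArg InvGrpd.under h₂) y
  refine InvGrpd.hom_ext (HasUniqueLifts.functor_ext_obj
    (InvGrpd.isCovering_δ₂ (UΔ κ)).hasUniqueLifts (fun y => ?_) ?_)
  · refine PathGrpd.ext_heq (hs y) (ht y) (UHom.ext_heq (hs y) (ht y) fun s s' hss => ?_)
    obtain ⟨z, hz₁, rfl⟩ := hX.exists_obj (⟨_, s⟩ : UtObj κ) y rfl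
    have e₁ := tgt_of_map_eq (Functor.congr_obj (congrArg InvGrpd.under hm) z) (s := s)
      ((Functor.congr_obj (congrArg InvGrpd.under hx) z).trans hz₁)
    have e₂ := tgt_of_map_eq (Functor.congr_obj (congrArg InvGrpd.under hm') z) (s := s')
      ((Functor.congr_obj (congrArg InvGrpd.under hx') z).trans
        (hz₁.trans (UtObj.ext_heq (hs _) hss)))
    exact (UtObj.mk.inj (e₁.symm.trans
      ((Functor.congr_obj (congrArg InvGrpd.under h) z).trans e₂))).2
  · exact congrArg₂ (fun (F G : Γ.carrier ⥤ (UΔ κ).carrier) => F.prod' G)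
      (congrArg InvGrpd.under h₁) (congrArg InvGrpd.under h₂)

/-- The isomorphisms in `UΔ κ` are the bijections of the first components. -/
def UHom.ofEquiv {A B : UObj κ} (e : A.A₀.1 ≃ B.A₀.1) : A ⟶ B :=
  (⟨e, A.χ.symm.trans (e.trans B.χ), fun x => by simp⟩ : UHom A B)

section Functors

variable {Γ X Y : Type (u + 1)} [Groupoid.{u + 1} Γ] [Groupoid.{u + 1} X] [Groupoid.{u + 1} Y]
  {a b : Γ ⥤ UObj κ} {x v : X ⥤ UtObj κ} {dx : X ⥤ Γ} {y w : Y ⥤ UtObj κ} {dy : Y ⥤ Γ}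

/-- An element `s` of the set over `c` is a unique object of the pullback `X`; the point of its
image under `v` defines the function. -/
theorem exists_transport (hX : IsStrictPullback x dx (InvGrpd.under (pΔ κ)) a)
    (hv : v ⋙ InvGrpd.under (pΔ κ) = dx ⋙ b) (c : Γ) :
    ∃ f : (a.obj c).A₀.1 → (b.obj c).A₀.1, ∀ s z, x.obj z = ⟨a.obj c, s⟩ → dx.obj z = c →
      v.obj z = ⟨b.obj c, f s⟩ := by
  have h : ∀ s : (a.obj c).A₀.1, ∃ t : (b.obj c).A₀.1, ∀ z, x.obj z = ⟨a.obj c, s⟩ →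
      dx.obj z = c → v.obj z = ⟨b.obj c, t⟩ := fun s => by
    obtain ⟨z, hz, rfl⟩ := hX.exists_obj (⟨a.obj c, s⟩ : UtObj κ) c rfl
    have hv' : (v.obj z).base = b.obj (dx.obj z) := Functor.congr_obj hv z
    refine ⟨cast (congrArg (fun B : UObj κ => B.A₀.1) hv') (v.obj z).pt, fun z' h₁ h₂ => ?_⟩
    obtain rfl : z' = z := hX.obj_ext (h₁.trans hz.symm) h₂
    exact UtObj.ext_heq hv' (cast_heq _ _).symm
  choose f hf using h
  exact ⟨f, hf⟩

/-- The fibrewise functions of `v` and `w` are inverse to each other because `m` and `n` carry them.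
Naturality holds because `v` is a functor on the arrows of `X` that lift `φ`. -/
theorem exists_isos (hX : IsStrictPullback x dx (InvGrpd.under (pΔ κ)) a)
    (hY : IsStrictPullback y dy (InvGrpd.under (pΔ κ)) b)
    (hv : v ⋙ InvGrpd.under (pΔ κ) = dx ⋙ b) (hw : w ⋙ InvGrpd.under (pΔ κ) = dy ⋙ a)
    {m : X ⥤ Y} (hm₁ : m ⋙ y = v) (hm₂ : m ⋙ dy = dx) (hm₃ : m ⋙ w = x) {n : Y ⥤ X}
    (hn₁ : n ⋙ x = w) (hn₂ : n ⋙ dx = dy) (hn₃ : n ⋙ v = y) :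
    ∃ e : ∀ c : Γ, a.obj c ⟶ b.obj c, (∀ {c c' : Γ} (φ : c ⟶ c'),
      a.map φ ≫ e c' = e c ≫ b.map φ) ∧ ∀ c s z, x.obj z = ⟨a.obj c, s⟩ → dx.obj z = c →
      v.obj z = ⟨b.obj c, (e c).ρ₀ s⟩ := by
  choose f hf using exists_transport hX hv
  choose g hg using exists_transport hY hw
  have hgf : ∀ c s, g c (f c s) = s := fun c s => by
    obtain ⟨z, hz, rfl⟩ := hX.exists_obj (⟨a.obj c, s⟩ : UtObj κ) c rfl
    have h := hg _ _ (m.obj z) ((Functor.congr_obj hm₁ z).trans (hf _ s z hz rfl))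
      (Functor.congr_obj hm₂ z)
    exact UtObj.mk_injective (h.symm.trans ((Functor.congr_obj hm₃ z).trans hz))
  have hfg : ∀ c s, f c (g c s) = s := fun c s => by
    obtain ⟨z, hz, rfl⟩ := hY.exists_obj (⟨b.obj c, s⟩ : UtObj κ) c rfl
    have h := hf _ _ (n.obj z) ((Functor.congr_obj hn₁ z).trans (hg _ s z hz rfl))
      (Functor.congr_obj hn₂ z)
    exact UtObj.mk_injective (h.symm.trans ((Functor.congr_obj hn₃ z).trans hz))
  refine ⟨fun c => UHom.ofEquiv ⟨f c, g c, hgf c, hfg c⟩, fun {c c'} φ => UHom.ext_ρ₀ fun s => ?_,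
    hf⟩
  obtain ⟨z, hz, rfl⟩ := hX.exists_obj (⟨a.obj c, s⟩ : UtObj κ) c rfl
  obtain ⟨z', hz', rfl⟩ := hX.exists_obj (⟨a.obj c', (a.map φ).ρ₀ s⟩ : UtObj κ) c' rfl
  obtain ⟨ω, hω₁, hω₂⟩ := hX.exists_map_heq (F := InvGrpd.under (pΔ κ)) hz hz' rfl rfl
    (⟨a.map φ, rfl⟩ : UtHom (⟨_, s⟩ : UtObj κ) ⟨_, (a.map φ).ρ₀ s⟩) φ HEq.rfl
  obtain rfl := eq_of_heq hω₂
  have h := hf _ _ z hz rfl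
  have h' := hf _ _ z' hz' rfl
  have hω : (v.map ω).base ≍ b.map (dx.map ω) := Functor.hcongr_hom hv ω
  have key : ∀ {P Q : UtObj κ} {B B' : UObj κ} {t : B.A₀.1} {t' : B'.A₀.1} (ψ : P ⟶ Q)
      (χ : B ⟶ B') (_ : P = ⟨B, t⟩) (_ : Q = ⟨B', t'⟩), ψ.base ≍ χ → χ.ρ₀ t = t' := by
    rintro _ _ B B' t t' ψ χ rfl rfl h
    obtain rfl := eq_of_heq h
    exact ψ.pt
  exact (key (v.map ω) (b.map (dx.map ω)) h h' hω).symm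

end Functors

theorem exists_path_hom {Γ X Y : InvGrpd.{u + 1}} {a b : Γ ⟶ UΔ κ} {x v : X ⟶ UtΔ κ} {dx : X ⟶ Γ}
    {y w : Y ⟶ UtΔ κ} {dy : Y ⟶ Γ} (hX : IsPullback x dx (pΔ κ) a) (hY : IsPullback y dy (pΔ κ) b)
    (hv : v ≫ pΔ κ = dx ≫ b) (hw : w ≫ pΔ κ = dy ≫ a) {m : X ⟶ Y} (hm₁ : m ≫ y = v)
    (hm₂ : m ≫ dy = dx) (hm₃ : m ≫ w = x) {n : Y ⟶ X} (hn₁ : n ≫ x = w) (hn₂ : n ≫ dx = dy)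
    (hn₃ : n ≫ v = y) :
    ∃ k : Γ ⟶ InvGrpd.path (UΔ κ), k ≫ InvGrpd.pathSrc _ = a ∧ k ≫ InvGrpd.pathTgt _ = b ∧
      ∃ l : X ⟶ InvGrpd.path (UtΔ κ), l ≫ InvGrpd.pathMap (pΔ κ) = dx ≫ k ∧
        l ≫ InvGrpd.pathSrc _ = x ∧ l ≫ InvGrpd.pathTgt _ = v := by
  have hX' := InvGrpd.strict_of_isPullback hX
  obtain ⟨e, he, hev⟩ := exists_isos hX' (InvGrpd.strict_of_isPullback hY)
    (congrArg InvGrpd.under hv) (congrArg InvGrpd.under hw) (congrArg InvGrpd.under hm₁)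
    (congrArg InvGrpd.under hm₂) (congrArg InvGrpd.under hm₃) (congrArg InvGrpd.under hn₁)
    (congrArg InvGrpd.under hn₂) (congrArg InvGrpd.under hn₃)
  let K : Γ.carrier ⥤ PathGrpd (UObj κ) :=
    { obj := fun c => ⟨(InvGrpd.under a).obj c, (InvGrpd.under b).obj c, e c⟩
      map := fun φ => (⟨(InvGrpd.under a).map φ, (InvGrpd.under b).map φ,
        PathGrpd.eq_inv_comp (he φ)⟩ : PathGrpd.Hom _ _)
      map_id := fun c => PathGrpd.Hom.ext ((InvGrpd.under a).map_id _) ((InvGrpd.under b).map_id _)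
      map_comp := fun φ ψ => PathGrpd.Hom.ext ((InvGrpd.under a).map_comp _ _)
        ((InvGrpd.under b).map_comp _ _) }
  -- Unique lifting along `δ₂` reduces equivariance to the ends and the arrows; the latter are
  -- compared on points, using equivariance of `v`.
  have hK : Γ.invol ⋙ K = K ⋙ PathGrpd.map (UObj.swap κ) := by
    refine HasUniqueLifts.functor_ext_obj (InvGrpd.isCovering_δ₂ (UΔ κ)).hasUniqueLifts
      (fun c => ?_) ?_
    · refine PathGrpd.ext_heq (InvGrpd.under_invol_obj a c) (InvGrpd.under_invol_obj b c)
        (UHom.ext_heq (InvGrpd.under_invol_obj a c) (InvGrpd.under_invol_obj b c) fun s s' hs => ?_)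
      obtain ⟨t, rfl⟩ := UObj.χ ((InvGrpd.under a).obj c) |>.surjective s'
      obtain ⟨z, hz, rfl⟩ := hX'.exists_obj (⟨_, t⟩ : UtObj κ) c rfl
      have h₁ := hev _ t z hz rfl
      have h₂ := hev _ s (X.invol.obj z) ((InvGrpd.under_invol_obj x z).trans
        ((congrArg (UtObj.swap κ).obj hz).trans (UtObj.ext_heq (InvGrpd.under_invol_obj a _).symm
          hs.symm))) (InvGrpd.under_invol_obj dx z)
      have h₃ := h₂.symm.trans ((InvGrpd.under_invol_obj v z).trans
        (congrArg (UtObj.swap κ).obj h₁))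
      exact (UtObj.mk.inj h₃).2.trans (heq_of_eq (UHom.comm (e _) t))
    · exact congrArg₂ (fun (F G : Γ.carrier ⥤ (UΔ κ).carrier) => F.prod' G)
        (InvGrpd.invol_under a) (InvGrpd.invol_under b)
  let k : Γ ⟶ InvGrpd.path (UΔ κ) := ⟨K, hK⟩
  have hP := InvGrpd.isPullback_of_strict (p := InvGrpd.pathSrc (UtΔ κ))
    (q := InvGrpd.pathMap (pΔ κ)) (f := pΔ κ) (g := InvGrpd.pathSrc (UΔ κ))
    (PathGrpd.isStrictPullback_src (isCovering_pΔ κ))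
  obtain ⟨l, hl₁, hl₂⟩ := hP.exists_lift x (dx ≫ k) hX.w
  -- The target of the lifted path is the point transported by `e`, which is the value of `v`.
  refine ⟨k, rfl, rfl, l, hl₂, hl₁, InvGrpd.hom_ext (HasUniqueLifts.functor_ext_obj
    (isCovering_pΔ κ).hasUniqueLifts (fun z => ?_) ?_)⟩
  · have hz : (InvGrpd.under x).obj z = (⟨(InvGrpd.under a).obj ((InvGrpd.under dx).obj z),
        cast (congrArg (fun B : UObj κ => B.A₀.1) (Functor.congr_obj (congrArg InvGrpd.under hX.w) z))
          (UtObj.pt ((InvGrpd.under x).obj z))⟩ : UtObj κ) :=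
      UtObj.ext_heq (Functor.congr_obj (congrArg InvGrpd.under hX.w) z) (cast_heq _ _).symm
    exact (tgt_of_map_eq (Functor.congr_obj (congrArg InvGrpd.under hl₂) z)
      ((Functor.congr_obj (congrArg InvGrpd.under hl₁) z).trans hz)).trans (hev _ _ z hz rfl).symm
  · have h₁ : l ≫ InvGrpd.pathTgt (UtΔ κ) ≫ pΔ κ =
        l ≫ InvGrpd.pathMap (pΔ κ) ≫ InvGrpd.pathTgt (UΔ κ) := rfl
    have h₂ : (l ≫ InvGrpd.pathTgt (UtΔ κ)) ≫ pΔ κ = v ≫ pΔ κ := by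
      rw [Category.assoc, h₁, reassoc_of% hl₂, hv]
      rfl
    exact congrArg InvGrpd.under h₂

end Universe

/-! ### Comparison of `E` with the path object, and univalence. -/

namespace InvGrpd.Fibrant

/-- The path object of `U κ`. -/
def PU (κ : Cardinal.{u}) : Fibrant.{u + 1} := ⟨path (UΔ κ), isFibrant_path (isFibrant_UΔ κ)⟩

/-- The source map of the path object of `U κ`. -/
def src (κ : Cardinal.{u}) : PU κ ⟶ U κ := ObjectProperty.homMk (pathSrc (UΔ κ))

/-- The target map of the path object of `U κ`. -/
def tgt (κ : Cardinal.{u}) : PU κ ⟶ U κ := ObjectProperty.homMk (pathTgt (UΔ κ))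

/-- The constant paths in `U κ`. -/
def refl (κ : Cardinal.{u}) : U κ ⟶ PU κ := ObjectProperty.homMk (δ₁ (UΔ κ))

/-- The path object of `Ut κ`. -/
def PUt (κ : Cardinal.{u}) : Fibrant.{u + 1} := ⟨path (UtΔ κ), isFibrant_path (isFibrant_UtΔ κ)⟩

/-- The path object of `U κ` classifies the isomorphisms between small types. -/
def pathClassifier (κ : Cardinal.{u}) : IsoClassifier (p κ) where
  obj := PU κ
  src := src κ
  tgt := tgt κ
  W := PUt κ
  var := ObjectProperty.homMk (pathSrc (UtΔ κ))
  disp := ObjectProperty.homMk (pathMap (pΔ κ))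
  isPullback := isPullback_of_hom (isPullback_of_strict
    (PathGrpd.isStrictPullback_src (isCovering_pΔ κ)))
  θ := ObjectProperty.homMk (pathTgt (UtΔ κ))
  θ_p := rfl
  -- Paths in `UtΔ` restrict to pullbacks along both ends, so the inverse isomorphism reads the same
  -- lifted path from its target.
  exists_inverse := ⟨PUt κ, ObjectProperty.homMk (pathTgt (UtΔ κ)),
    ObjectProperty.homMk (pathMap (pΔ κ)), ObjectProperty.homMk (pathSrc (UtΔ κ)),
    isPullback_of_hom (isPullback_of_strict (PathGrpd.isStrictPullback_tgt (isCovering_pΔ κ))),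
    rfl, ⟨𝟙 _, Category.id_comp _, Category.id_comp _, Category.id_comp _⟩,
    ⟨𝟙 _, Category.id_comp _, Category.id_comp _, Category.id_comp _⟩⟩
  exists_lift := by
    rintro Γ X Y a b x dx y dy v w hX hY hv hw ⟨⟨m, hm₁, hm₂, hm₃⟩, n, hn₁, hn₂, hn₃⟩
    obtain ⟨k, hk₁, hk₂, l, hl₁, hl₂, hl₃⟩ := exists_path_hom
      (isPullback_hom hX (fibrantFibrations_p κ)) (isPullback_hom hY (fibrantFibrations_p κ))
      (congrArg (·.hom) hv) (congrArg (·.hom) hw) (congrArg (·.hom) hm₁) (congrArg (·.hom) hm₂)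
      (congrArg (·.hom) hm₃) (congrArg (·.hom) hn₁) (congrArg (·.hom) hn₂) (congrArg (·.hom) hn₃)
    exact ⟨ObjectProperty.homMk k, ObjectProperty.hom_ext _ hk₁, ObjectProperty.hom_ext _ hk₂,
      ObjectProperty.homMk l, ObjectProperty.hom_ext _ hl₁, ObjectProperty.hom_ext _ hl₂,
      ObjectProperty.hom_ext _ hl₃⟩
  uniq := by
    intro Γ X k k' x dx m m' hX h₁ h₂ hm₁ hm₂ hm₁' hm₂' h
    exact ObjectProperty.hom_ext _ (path_hom_ext
      (strict_of_isPullback (isPullback_hom hX (fibrantFibrations_p κ)))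
      (congrArg (·.hom) h₁) (congrArg (·.hom) h₂) (congrArg (·.hom) hm₁) (congrArg (·.hom) hm₁')
      (congrArg (·.hom) hm₂) (congrArg (·.hom) hm₂') (congrArg (·.hom) h))

theorem isRefl_refl (κ : Cardinal.{u}) :
    (pathClassifier κ).IsRefl (refl κ) where
  src := rfl
  tgt := rfl
  exists_map := ⟨ObjectProperty.homMk (δ₁ (UtΔ κ)), rfl, rfl, rfl⟩

/-- The reflexivity map of an identity type of small types is an isomorphism. -/
theorem isIso_r {κ : Cardinal.{u}} (D : IdData fibrantFibrations (p κ)) : IsIso D.r := by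
  have hf : IsSmall (p κ) D.fst := by
    have := D.isPullback.flip
    exact ⟨_, _, this⟩
  have h : IsCovering (under (D.q.hom ≫ D.fst.hom)) :=
    (isSmall_iff.1 D.small).1.comp (isSmall_iff.1 hf).1
  -- A section of a covering is a covering, by cancellation against the identity.
  have hr : IsCovering (under D.r.hom) := by
    refine IsCovering.of_comp h ?_
    have : under (D.r.hom ≫ D.q.hom ≫ D.fst.hom) = 𝟭 _ :=
      congrArg (fun f : Ut κ ⟶ Ut κ => under f.hom) D.r_fst
    rw [under_comp] at this
    rw [this]
    exact isCovering_id
  -- Being both an acyclic cofibration and a fibration, `r` lifts against itself, and the lift is an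
  -- inverse.
  have := D.acyclic _ (fibrations_of_isCovering hr)
  have sq : CommSq (𝟙 _) D.r D.r (𝟙 _) := ⟨by simp⟩
  exact ⟨sq.lift, sq.fac_left, sq.fac_right⟩

/-- Every space of equivalences is isomorphic to the path object of `U κ`. -/
theorem exists_iso_path {κ : Cardinal.{u}} (I : EquivInterpretation fibrantFibrations (p κ)) :
    ∃ e : I.E ≅ PU κ, e.hom ≫ src κ = I.proj ≫ I.tyA ∧ e.hom ≫ tgt κ = I.proj ≫ I.tyB ∧
      ∀ k : U κ ⟶ I.E, I.IsIdEquiv k ↔ k ≫ e.hom = refl κ := by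
  have := isIso_r I.Id
  obtain ⟨P, f, hf₁, hf₂, hf₃⟩ := I.exists_isoClassifier
    (fun c => exists_pullback (p κ) c (fibrantFibrations_p κ))
  obtain ⟨e, h₁, h₂, h₃⟩ : ∃ e : P.obj ≅ PU κ, e.hom ≫ src κ = P.src ∧ e.hom ≫ tgt κ = P.tgt ∧
      ∀ k : U κ ⟶ P.obj, P.IsRefl k ↔ k ≫ e.hom = refl κ := by
    obtain ⟨e, he, he'⟩ := IsoClassifier.exists_iso P (pathClassifier κ)
    refine ⟨e, he.src, he.tgt, fun k => ⟨fun h => (h.comp he).unique (isRefl_refl κ), fun h => ?_⟩⟩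
    obtain rfl : k = refl κ ≫ e.inv := ((Iso.comp_inv_eq e).2 h.symm).symm
    exact (isRefl_refl κ).comp he'
  refine ⟨f.symm ≪≫ e, by simp [h₁, ← hf₁], by simp [h₂, ← hf₂], fun k => ?_⟩
  have hk : k = (k ≫ f.inv) ≫ f.hom := by simp
  rw [hk, hf₃, h₃]
  simp

/-- Up to the isomorphism with the path object, `k` is the trivial cofibration `δ₁`. -/
theorem llp_of_isIdEquiv {κ : Cardinal.{u}} {I : EquivInterpretation fibrantFibrations (p κ)}
    {k : U κ ⟶ I.E} (hk : I.IsIdEquiv k) : fibrantFibrations.llp k := by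
  obtain ⟨e, -, -, he⟩ := exists_iso_path I
  obtain rfl : k = refl κ ≫ e.inv := by rw [← (he k).1 hk]; simp
  exact MorphismProperty.comp_mem _ _ _ (llp_of_trivialCofibrations (trivialCofibrations_δ₁ _))
    (MorphismProperty.llp_of_isIso _ _)

/-- `pΔ κ` is univalent. -/
theorem isUnivalent_p {κ : Cardinal.{u}} (hκ : κ.IsInaccessible) :
    IsUnivalent fibrantFibrations (p κ) := by
  refine ⟨isTypeTheoreticFibrationCategory.exists_equivInterpretation (isUniverse_p hκ),
    fun I => ?_⟩
  obtain ⟨e, -, -, he⟩ := exists_iso_path I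
  have hk : I.IsIdEquiv (refl κ ≫ e.inv) := (he _).2 (by simp)
  refine ⟨_, hk, fun k' hk' => ?_,
    isTypeTheoreticFibrationCategory.isHomotopyEquivalence_of_llp (llp_of_isIdEquiv hk)⟩
  rw [← (he k').1 hk']; simp

end InvGrpd.Fibrant

theorem InvGrpd.isCofibrant (A : InvGrpd.{w}) : IsCofibrant A := fun x => x.as.elim

end EquivariantGpd

theorem mainTheorem12 (κ : Cardinal.{u}) (hκ : κ.IsInaccessible) :
    ∃ (hU : InvGrpd.IsFibrant (UΔ κ)) (hUt : InvGrpd.IsFibrant (UtΔ κ))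
      (hP : InvGrpd.IsFibrant (InvGrpd.path (UΔ κ))),
      let U : InvGrpd.Fibrant := ⟨UΔ κ, hU⟩
      let Ut : InvGrpd.Fibrant := ⟨UtΔ κ, hUt⟩
      let PU : InvGrpd.Fibrant := ⟨InvGrpd.path (UΔ κ), hP⟩
      let p : Ut ⟶ U := ObjectProperty.homMk (pΔ κ)
      let δ₁ : U ⟶ PU := ObjectProperty.homMk (InvGrpd.δ₁ (UΔ κ))
      let src : PU ⟶ U :=
        ObjectProperty.homMk (InvGrpd.δ₂ (UΔ κ) ≫ InvGrpd.prodFst (UΔ κ) (UΔ κ))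
      let tgt : PU ⟶ U :=
        ObjectProperty.homMk (InvGrpd.δ₂ (UΔ κ) ≫ InvGrpd.prodSnd (UΔ κ) (UΔ κ))
      IsTypeTheoreticFibrationCategory InvGrpd.fibrantFibrations ∧
      IsUniverse InvGrpd.fibrantFibrations p ∧
      IsUnivalent InvGrpd.fibrantFibrations p ∧
      (InvGrpd.trivialCofibrations (InvGrpd.δ₁ (UΔ κ)) ∧
        InvGrpd.fibrations (InvGrpd.δ₂ (UΔ κ)) ∧ δ₁ ≫ src = 𝟙 U ∧ δ₁ ≫ tgt = 𝟙 U) ∧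
      ∀ I : EquivInterpretation InvGrpd.fibrantFibrations p,
        (∃ e : I.E ≅ PU, e.hom ≫ src = I.proj ≫ I.tyA ∧ e.hom ≫ tgt = I.proj ≫ I.tyB ∧
          ∀ k : U ⟶ I.E, I.IsIdEquiv k → k ≫ e.hom = δ₁) ∧
        InvGrpd.IsCofibrant U.obj ∧ InvGrpd.IsCofibrant I.E.obj ∧
        ∀ k : U ⟶ I.E, I.IsIdEquiv k → InvGrpd.trivialCofibrations k.hom ∧
          IsHomotopyEquivalence InvGrpd.fibrantFibrations k := by
  refine ⟨isFibrant_UΔ κ, isFibrant_UtΔ κ, InvGrpd.isFibrant_path (isFibrant_UΔ κ),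
    InvGrpd.isTypeTheoreticFibrationCategory, InvGrpd.Fibrant.isUniverse_p hκ,
    InvGrpd.Fibrant.isUnivalent_p hκ, ⟨InvGrpd.trivialCofibrations_δ₁ _,
      InvGrpd.fibrations_δ₂ _, rfl, rfl⟩, fun I => ⟨?_, InvGrpd.isCofibrant _,
      InvGrpd.isCofibrant _, fun k hk => ?_⟩⟩
  · obtain ⟨e, h₁, h₂, h₃⟩ := InvGrpd.Fibrant.exists_iso_path I
    exact ⟨e, h₁, h₂, fun k hk => (h₃ k).1 hk⟩
  · have h := InvGrpd.Fibrant.llp_of_isIdEquiv hk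
    exact ⟨InvGrpd.Fibrant.trivialCofibrations_of_llp h,
      InvGrpd.isTypeTheoreticFibrationCategory.isHomotopyEquivalence_of_llp h⟩
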